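/- **Setting.** Let $d\ge 1$, let $Q\subset\mathbb R^d$ be open, let $(\Omega,\mathscr M,\mu)$ be a probability space and $\{T(x)\}_{x\in\mathbb R^d}$ a $d$-dimensional dynamical system on it: $T(0)=\mathrm{id}$, $T(x+x')=T(x)\circ T(x')$, each $T(x)$ preserves $\mu$, and $(x,\omega)\mapsto T(x)\omega$ is measurable for the product of the Lebesgue $\sigma$-algebra with $\mathscr M$. Let $\Phi$ be an $N$-function of class $\Delta_2\cap\Delta'$, i.e. $\Phi(2t)\le k\Phi(t)$ for $t\ge t_0$ (some $t_0>0$, $k>2$) and $\Phi(ts)\le\beta\Phi(t)\Phi(s)$ for all $t,s\ge0$ (some $\beta>0$); let $\widetilde\Phi(t)=\sup_{s\ge0}(st-\Phi(s))$. Let $\varepsilon_1,\varepsilon_2$ be positive functions of $\varepsilon>0$ with $\varepsilon_1,\varepsilon_2,\varepsilon_2/\varepsilon_1\to0$ as $\varepsilon\to0$, such that $x\mapsto x/\varepsilon_1$ and $x\mapsto x/\varepsilon_2$ are actions of the multiplicative group $\mathbb R_+^*$ on $\mathbb R^d$ (i.e. $\varepsilon_i(\varepsilon\varepsilon')=\varepsilon_i(\varepsilon)\varepsilon_i(\varepsilon')$).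 Let $A$ be an $H$-supralgebra: a closed subalgebra of the bounded continuous complex functions on $\mathbb R^d$, containing the constants, stable under conjugation, such that for each $u\in A$ the functions $u(\cdot/\varepsilon_1)$ converge weakly-$*$ in $L^\infty(\mathbb R^d)$, as $\varepsilon\to0$, to a constant. **Notation.** $M(u)=\lim_{r\to\infty}|B_r|^{-1}\int_{B_r}u\,dy$. For $\Psi\in\{\Phi,\widetilde\Phi\}$: * $L^\Psi$ denotes the Orlicz space, with the Luxemburg norm. $\mathfrak X^\Psi_A$ is the closure of $A$ for the norm $\|u\|_{\Xi^\Psi}=\sup_{0<\varepsilon\le1}\|u(\cdot/\varepsilon_1)\|_{L^\Psi(B_1)}$; it carries the seminorm $\|u\|_{\Psi,A}=\inf\{\delta>0: M(\Psi(|u|/\delta))\le1\}$. $\mathcal X^\Psi_A$ is the quotient of $\mathfrak X^\Psi_A$ by the kernel of this seminorm, and $\varrho$ is the canonical map. * $L^\Psi(Q\times\Omega;\mathfrak X_A^\Psi)$ (and, passing to classes, $L^\Psi(Q\times\Omega;\mathcal X_A^\Psi)$) is the set of maps $u:(x,\omega)\mapsto u(x,\omega,\cdot)\in\mathfrak X^\Psi_A$,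 strongly measurable for $\|\cdot\|_{\Psi,A}$, with $\iint_{Q\times\Omega}M(\Psi(\delta|u(x,\omega,\cdot)|))\,dx\,d\mu\to0$ as $\delta\to0^+$. * $\mathfrak X_A^{\Psi,\infty}=\mathfrak X_A^\Psi\cap L^\infty(\mathbb R^d)$ carries the $L^\infty$-norm. $L^\Psi(\Omega;\mathfrak X_A^{\Psi,\infty})$ and $L^\infty(\Omega;\mathfrak X_A^{\Psi,\infty})$ are the spaces of strongly measurable functions $g$ with $\|g(\cdot)\|_{L^\infty(\mathbb R^d)}$ in $L^\Psi(\Omega)$, respectively $L^\infty(\Omega)$. $\mathcal K(Q;X)$ is the space of continuous functions $Q\to X$ with compact support in $Q$; its elements are given by jointly strongly measurable representatives. * The trace is $f^\varepsilon(x,\omega)=f(x,T(x/\varepsilon_1)\omega,x/\varepsilon_2)$, where the value at a point $y$ of a class of locally integrable functions is the limit of its averages over balls shrinking to $y$ (which exists for almost every $y$). * $f\in L^\Psi(Q\times\Omega;\mathfrak X_A^\Psi)$ is admissible (for $\Psi$) if $f^\varepsilon\in L^\Psi(Q\times\Omega)$ for every $\varepsilon>0$ and, as $\varepsilon\to0$,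 $\iint_{Q\times\Omega}\Psi(|f^\varepsilon|/\delta)\,dx\,d\mu\to\iint_{Q\times\Omega}M(\Psi(|f(x,\omega,\cdot)|/\delta))\,dx\,d\mu$ for all $\delta>0$. * $\mathcal C^\infty(\Omega)$ is the set of $\psi\in L^\infty(\Omega)$ possessing stochastic derivatives of all orders in $L^\infty(\Omega)$, the $i$-th stochastic derivative being the $L^\infty(\Omega)$-limit of $t^{-1}(\psi\circ T(te_i)-\psi)$ as $t\to0$. Let $E\subset(0,\infty)$, for instance $E=(0,\infty)$ or $E$ the set of terms of a sequence tending to $0$. A family $(u_\varepsilon)_{\varepsilon\in E}$, bounded in $L^\Phi(Q\times\Omega)$, is *weakly stochastically $\Sigma$-convergent* to $u_0\in L^\Phi(Q\times\Omega;\mathcal X_A^\Phi)$ if $$\iint_{Q\times\Omega}u_\varepsilon f^\varepsilon\,dx\,d\mu\;\longrightarrow\;\iint_{Q\times\Omega}M\big(u_0(x,\omega,\cdot)f(x,\omega,\cdot)\big)\,dx\,d\mu\qquad(E\ni\varepsilon\to0)\tag{3.1}$$ for every $f\in\mathcal C_0^\infty(Q)\otimes\mathcal C^\infty(\Omega)\otimes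 A$. **Statement.** 1. If $(u_\varepsilon)_{\varepsilon\in E}$ is weakly stochastically $\Sigma$-convergent in $L^\Phi(Q\times\Omega)$ to $u_0\in L^\Phi(Q\times\Omega;\mathcal X_A^\Phi)$, then (3.1) holds for every $f\in\mathcal K(Q;L^{\widetilde\Phi}(\Omega;\mathfrak X_A^{\widetilde\Phi,\infty}))$ that is admissible for $\widetilde\Phi$. 2. If $u\in\mathcal K(Q;L^\infty(\Omega;\mathfrak X_A^{\Phi,\infty}))$ is admissible for $\Phi$, then $(u^\varepsilon)_{\varepsilon>0}$ is weakly stochastically $\Sigma$-convergent in $L^\Phi(Q\times\Omega)$ to $\varrho(u)$. -/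

import Mathlib

open MeasureTheory Filter Topology Set
open scoped ENNReal BoundedContinuousFunction

noncomputable section

namespace StochSigma

/-- The Euclidean space `ℝ^d`. -/
abbrev Rd (d : ℕ) : Type := EuclideanSpace ℝ (Fin d)

/-! ### N-functions -/

/-- `Φ : [0,∞) → [0,∞)` is an N-function (only the values on `[0,∞)` matter; `Φ 0 = 0` follows from
continuity and `Φ t / t → 0`). -/
structure IsNFunction (Φ : ℝ → ℝ) : Prop where
  continuousOn : ContinuousOn Φ (Ici 0)
  convexOn : ConvexOn ℝ (Ici 0) Φ
  pos : ∀ t, 0 < t → 0 < Φ t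
  tendsto_zero : Tendsto (fun t => Φ t / t) (𝓝[>] 0) (𝓝 0)
  tendsto_atTop : Tendsto (fun t => Φ t / t) atTop atTop

/-- The class `Δ₂` (at infinity). -/
def DeltaTwo (Φ : ℝ → ℝ) : Prop :=
  ∃ t₀ k : ℝ, 0 < t₀ ∧ 2 < k ∧ ∀ t, t₀ ≤ t → Φ (2 * t) ≤ k * Φ t

/-- The class `Δ'`. -/
def DeltaPrime (Φ : ℝ → ℝ) : Prop :=
  ∃ β : ℝ, 0 < β ∧ ∀ t s : ℝ, 0 ≤ t → 0 ≤ s → Φ (t * s) ≤ β * Φ t * Φ s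

/-- The Fenchel conjugate `Φ̃ t = sup_{s ≥ 0} (s t - Φ s)`. -/
def conj (Φ : ℝ → ℝ) (t : ℝ) : ℝ := sSup ((fun s => s * t - Φ s) '' Ici 0)

/-! ### Orlicz spaces -/

/-- The Luxemburg norm `inf {δ > 0 : ∫ Φ(|f|/δ) dm ≤ 1}`, equal to `∞` if there is no such `δ`. -/
def luxNorm {α F : Type*} [MeasurableSpace α] [NormedAddCommGroup F] (Φ : ℝ → ℝ) (m : Measure α)
    (f : α → F) : ℝ≥0∞ :=
  ⨅ (δ : ℝ) (_ : 0 < δ) (_ : ∫⁻ a, ENNReal.ofReal (Φ (‖f a‖ / δ)) ∂m ≤ 1), ENNReal.ofReal δ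

/-- `f ∈ L^Φ(m)`. -/
def MemOrlicz {α F : Type*} [MeasurableSpace α] [NormedAddCommGroup F] (Φ : ℝ → ℝ) (m : Measure α)
    (f : α → F) : Prop :=
  AEStronglyMeasurable f m ∧
    ∃ δ : ℝ, 0 < δ ∧ ∫⁻ a, ENNReal.ofReal (Φ (‖f a‖ / δ)) ∂m < ∞

/-! ### Dynamical systems and smooth functions on `Ω` -/

/-- A `d`-dimensional dynamical system on `(Ω, μ)`: a measure preserving action of `ℝ^d` which is
jointly measurable with respect to the product of the Lebesgue `σ`-algebra of `ℝ^d` with that of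
`Ω`. Invertibility, `T(x)⁻¹ = T(-x)`, follows from the group property. -/
structure DynSystem (d : ℕ) {Ω : Type*} [MeasurableSpace Ω] (μ : Measure Ω) where
  toFun : Rd d → Ω → Ω
  map_zero : toFun 0 = id
  map_add : ∀ x y, toFun (x + y) = toFun x ∘ toFun y
  measurePreserving : ∀ x, MeasurePreserving (toFun x) μ μ
  measurable_joint :
    Measurable (fun p : NullMeasurableSpace (Rd d) (volume : Measure (Rd d)) × Ω =>
      toFun p.1 p.2)

section Omega

variable {d : ℕ} {Ω : Type*} [MeasurableSpace Ω] {μ : Measure Ω}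

/-- `g` is the `i`-th stochastic derivative of `f` in `L^∞(Ω)`:
`(f(T(t eᵢ)·) - f)/t → g` in `L^∞(Ω)` as `t → 0`. -/
def HasStochDeriv (T : DynSystem d μ) (i : Fin d) (f g : Ω → ℂ) : Prop :=
  Tendsto (fun t : ℝ =>
      eLpNorm (fun ω => (t : ℂ)⁻¹ * (f (T.toFun (EuclideanSpace.single i t) ω) - f ω) - g ω) ∞ μ)
    (𝓝[≠] 0) (𝓝 0)

/-- `f ∈ C^∞(Ω)`: the function `f` has bounded stochastic derivatives `D α = D^α f` of every
order `α ∈ ℕ^d`. -/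
def IsStochSmooth (T : DynSystem d μ) (f : Ω → ℂ) : Prop :=
  ∃ D : (Fin d → ℕ) → Ω → ℂ, D 0 = f ∧ (∀ α, MemLp (D α) ∞ μ) ∧
    ∀ α i, HasStochDeriv T i (D α) (D (α + Pi.single i 1))

end Omega

/-! ### Mean values, homogenization supralgebras and the associated spaces -/

/-- A scale `e`: a positive function of `ε > 0` tending to zero with `ε`, such that
`H_ε : x ↦ x / e(ε)` is an action of the multiplicative group of positive reals. -/
structure IsScale (e : ℝ → ℝ) : Prop where
  pos : ∀ ε, 0 < ε → 0 < e ε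
  map_mul : ∀ ε ε', 0 < ε → 0 < ε' → e (ε * ε') = e ε * e ε'
  tendsto_zero : Tendsto e (𝓝[>] 0) (𝓝 0)

/-- `u` has the mean value `m` for the action `x ↦ x / e(ε)`: `u(·/e(ε)) → m` weakly-* in
`L^∞(ℝ^d)` as `ε → 0`. -/
def HasMeanValue {d : ℕ} (e : ℝ → ℝ) (u : Rd d → ℂ) (m : ℂ) : Prop :=
  ∀ φ : Rd d → ℂ, Integrable φ →
    Tendsto (fun ε => ∫ x, u ((e ε)⁻¹ • x) * φ x) (𝓝[>] 0) (𝓝 (m * ∫ x, φ x))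

/-- `A` is a homogenization supralgebra for the action `x ↦ x / e(ε)`: a closed subalgebra of the
bounded continuous complex functions on `ℝ^d`, containing the constants, closed under complex
conjugation, all of whose elements possess a mean value. -/
def IsHSupralgebra {d : ℕ} (e : ℝ → ℝ) (A : StarSubalgebra ℂ (Rd d →ᵇ ℂ)) : Prop :=
  IsClosed (A : Set (Rd d →ᵇ ℂ)) ∧ ∀ u ∈ A, ∃ m : ℂ, HasMeanValue e u m

/-- The mean value `M(u) = lim_{r → ∞} |B_r|⁻¹ ∫_{B_r} u(y) dy`, that is, the formal integral
`£_A ∫ u(y) dy`. -/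
def mean {d : ℕ} {F : Type*} [NormedAddCommGroup F] [NormedSpace ℝ F] (u : Rd d → F) : F :=
  limUnder atTop (fun r : ℝ => ⨍ y in Metric.ball (0 : Rd d) r, u y)

/-- The norm of `Ξ^Φ`: the supremum over `0 < ε ≤ 1` of the Luxemburg norms of `u(·/e(ε))` on the
unit ball. -/
def xiNorm {d : ℕ} (Φ e : ℝ → ℝ) (u : Rd d → ℂ) : ℝ≥0∞ :=
  ⨆ ε ∈ Ioc (0 : ℝ) 1,
    luxNorm Φ (volume.restrict (Metric.ball (0 : Rd d) 1)) (fun x => u ((e ε)⁻¹ • x))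

/-- `u ∈ 𝔛^Φ_A`: the (class of the) function `u` belongs to the closure of `A` in `Ξ^Φ`. -/
def MemX {d : ℕ} (Φ e : ℝ → ℝ) (A : StarSubalgebra ℂ (Rd d →ᵇ ℂ)) (u : Rd d → ℂ) : Prop :=
  AEStronglyMeasurable u volume ∧
    ∀ η : ℝ, 0 < η → ∃ w ∈ A, xiNorm Φ e (fun y => u y - w y) ≤ ENNReal.ofReal η

/-- The seminorm `‖u‖_{Φ,A} = inf {δ > 0 : M(Φ(|u|/δ)) ≤ 1}` of `𝔛^Φ_A`, whose kernel is the kernel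
of the canonical map `ϱ` of `𝔛^Φ_A` onto `𝒳^Φ_A`. -/
def meanLuxNorm {d : ℕ} (Φ : ℝ → ℝ) (u : Rd d → ℂ) : ℝ≥0∞ :=
  ⨅ (δ : ℝ) (_ : 0 < δ) (_ : mean (fun y => Φ (‖u y‖ / δ)) ≤ 1), ENNReal.ofReal δ

/-! ### Spaces of functions on `Q × Ω × ℝ^d`, traces, convergence -/

section Conv

variable {d : ℕ} {Ω : Type*} [MeasurableSpace Ω] {μ : Measure Ω}

/-- The measure `dx ⊗ dμ` on `Q × Ω`. -/
abbrev measQ (Q : Set (Rd d)) (μ : Measure Ω) : Measure (Rd d × Ω) :=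
  (volume.restrict Q).prod μ

/-- `u` (a representative of) an element of `L^Φ(Q × Ω; 𝒳^Φ_A)`, equivalently an element of
`L^Φ(Q × Ω; 𝔛^Φ_A)`. Here `u(x,ω,·) ∈ 𝔛^Φ_A` for almost every `(x,ω)`, the map `(x,ω) ↦ u(x,ω,·)`
is strongly measurable for the seminorm `‖·‖_{Φ,A}` (it is an a.e. limit of simple functions, which
may be taken with values in the dense subspace `A`), and
`∬ M(Φ(δ|u(x,ω,·)|)) dx dμ → 0` as `δ → 0⁺`. All three conditions depend only on the classes
`ϱ(u(x,ω,·))` of functions in `𝔛^Φ_A`. -/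
structure MemOrliczX (Q : Set (Rd d)) (μ : Measure Ω) (Φ e : ℝ → ℝ)
    (A : StarSubalgebra ℂ (Rd d →ᵇ ℂ)) (u : Rd d → Ω → Rd d → ℂ) : Prop where
  mem : ∀ᵐ p ∂(measQ Q μ), MemX Φ e A (u p.1 p.2)
  measurable : ∃ s : ℕ → SimpleFunc (Rd d × Ω) (Rd d →ᵇ ℂ), (∀ n p, s n p ∈ A) ∧
    ∀ᵐ p ∂(measQ Q μ),
      Tendsto (fun n => meanLuxNorm Φ (fun y => u p.1 p.2 y - s n p y)) atTop (𝓝 0)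
  modular : Tendsto
    (fun δ : ℝ => ∫⁻ p, ENNReal.ofReal (mean (fun y => Φ (δ * ‖u p.1 p.2 y‖))) ∂(measQ Q μ))
    (𝓝[>] 0) (𝓝 0)

/-- The value at `y` of a class of locally integrable functions: the limit of its averages over
balls shrinking to `y`. It exists for almost every `y`, gives back the function almost everywhere,
does not depend on the representative, and is the usual value for continuous functions. -/
def pointValue (v : Rd d → ℂ) (y : Rd d) : ℂ :=
  limUnder (𝓝[>] (0 : ℝ)) (fun r : ℝ => ⨍ z in Metric.ball y r, v z)

theorem pointValue_of_continuous (v : Rd d → ℂ) (hv : Continuous v) (y : Rd d) :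
    pointValue v y = v y := by
  refine Tendsto.limUnder_eq ?_
  rw [Metric.tendsto_nhds]
  intro η hη
  obtain ⟨ρ, hρ, hρv⟩ := Metric.continuousAt_iff.1 (hv.continuousAt (x := y)) (η / 2) (by positivity)
  filter_upwards [Ioo_mem_nhdsGT hρ] with r hr
  have hvol : volume (Metric.ball y r) ≠ 0 := (Metric.measure_ball_pos volume y hr.1).ne'
  have hmem := (convex_closedBall (v y) (η / 2)).set_average_mem Metric.isClosed_closedBall hvol
    measure_ball_lt_top.ne
    (ae_restrict_of_forall_mem measurableSet_ball fun z hz =>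
      (hρv (lt_trans (Metric.mem_ball.1 hz) hr.2)).le)
    ((hv.continuousOn.integrableOn_compact (isCompact_closedBall y r)).mono_set
      Metric.ball_subset_closedBall)
  exact lt_of_le_of_lt (Metric.mem_closedBall.1 hmem) (by linarith)

/-- The trace `f^ε(x,ω) = f(x, T(x/ε₁)ω, x/ε₂)`. -/
def trace (T : DynSystem d μ) (ε₁ ε₂ : ℝ → ℝ) (f : Rd d → Ω → Rd d → ℂ) (ε : ℝ)
    (x : Rd d) (ω : Ω) : ℂ :=
  pointValue (f x (T.toFun ((ε₁ ε)⁻¹ • x) ω)) ((ε₂ ε)⁻¹ • x)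

/-- `f ∈ C₀^∞(Q) ⊗ C^∞(Ω) ⊗ A`. -/
def IsTestFunction (Q : Set (Rd d)) (T : DynSystem d μ) (A : StarSubalgebra ℂ (Rd d →ᵇ ℂ))
    (f : Rd d → Ω → Rd d → ℂ) : Prop :=
  ∃ (n : ℕ) (φ : Fin n → Rd d → ℂ) (ψ : Fin n → Ω → ℂ) (g : Fin n → Rd d →ᵇ ℂ),
    (∀ i, ContDiff ℝ ((⊤ : ℕ∞) : WithTop ℕ∞) (φ i) ∧ HasCompactSupport (φ i) ∧ tsupport (φ i) ⊆ Q) ∧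
    (∀ i, IsStochSmooth T (ψ i)) ∧ (∀ i, g i ∈ A) ∧
    f = fun x ω y => ∑ i, φ i x * ψ i ω * g i y

/-- The convergence, as `E ∋ ε → 0`, of `∬_{Q×Ω} u_ε f^ε dx dμ` to
`∬_{Q×Ω} £_A∫ u₀(x,ω,y) f(x,ω,y) dy dx dμ`. -/
def PairingConverges (Q : Set (Rd d)) (T : DynSystem d μ) (ε₁ ε₂ : ℝ → ℝ) (E : Set ℝ)
    (u : ℝ → Rd d → Ω → ℂ) (u₀ f : Rd d → Ω → Rd d → ℂ) : Prop :=
  Tendsto (fun ε => ∫ p, u ε p.1 p.2 * trace T ε₁ ε₂ f ε p.1 p.2 ∂(measQ Q μ)) (𝓝[E] 0)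
    (𝓝 (∫ p, mean (fun y => u₀ p.1 p.2 y * f p.1 p.2 y) ∂(measQ Q μ)))

/-- The family `(u_ε)_{ε ∈ E}` is bounded in `L^Φ(Q × Ω)` and converges weakly stochastically `Σ`
to (the element of `L^Φ(Q × Ω; 𝒳^Φ_A)` represented by) `u₀`. -/
structure WeakSigmaConverges (Q : Set (Rd d)) (T : DynSystem d μ) (ε₁ ε₂ : ℝ → ℝ)
    (A : StarSubalgebra ℂ (Rd d →ᵇ ℂ)) (Φ : ℝ → ℝ) (E : Set ℝ)
    (u : ℝ → Rd d → Ω → ℂ) (u₀ : Rd d → Ω → Rd d → ℂ) : Prop where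
  mem : ∀ ε ∈ E, MemOrlicz Φ (measQ Q μ) (fun p => u ε p.1 p.2)
  bounded : ∃ C : ℝ, ∀ ε ∈ E, luxNorm Φ (measQ Q μ) (fun p => u ε p.1 p.2) ≤ ENNReal.ofReal C
  limit_mem : MemOrliczX Q μ Φ ε₁ A u₀
  pairing : ∀ f, IsTestFunction Q T A f → PairingConverges Q T ε₁ ε₂ E u u₀ f

/-- Admissible functions in `L^Φ(Q × Ω; 𝔛^Φ_A)`. -/
structure IsAdmissible (Q : Set (Rd d)) (T : DynSystem d μ) (ε₁ ε₂ : ℝ → ℝ)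
    (A : StarSubalgebra ℂ (Rd d →ᵇ ℂ)) (Φ : ℝ → ℝ) (u : Rd d → Ω → Rd d → ℂ) : Prop where
  mem : MemOrliczX Q μ Φ ε₁ A u
  trace_mem : ∀ ε, 0 < ε → MemOrlicz Φ (measQ Q μ) (fun p => trace T ε₁ ε₂ u ε p.1 p.2)
  modular : ∀ δ : ℝ, 0 < δ → Tendsto
    (fun ε => ∫⁻ p, ENNReal.ofReal (Φ (‖trace T ε₁ ε₂ u ε p.1 p.2‖ / δ)) ∂(measQ Q μ)) (𝓝[>] 0)
    (𝓝 (∫⁻ p, ENNReal.ofReal (mean (fun y => Φ (‖u p.1 p.2 y‖ / δ))) ∂(measQ Q μ)))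

/-- `f ∈ 𝒦(Q; 𝓛(Ω; 𝔛^{Φ,∞}_A))`, where `𝔛^{Φ,∞}_A = 𝔛^Φ_A ∩ L^∞(ℝ^d)` carries the `L^∞`-norm and
`𝓛(Ω; 𝔛^{Φ,∞}_A)` is the space of (classes of) strongly measurable functions `g : Ω → 𝔛^{Φ,∞}_A`
with `N g < ∞`: `f` is continuous from `Q` into that space for the norm `N` and vanishes outside a
compact subset of `Q`. As usual `f` is given by a representative which is jointly measurable in
`(x,ω)`; it exists, and is unique up to null sets. -/
structure MemK (Q : Set (Rd d)) (μ : Measure Ω) (Φ e : ℝ → ℝ) (A : StarSubalgebra ℂ (Rd d →ᵇ ℂ))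
    (N : (Ω → Lp ℂ ∞ (volume : Measure (Rd d))) → ℝ≥0∞)
    (f : Rd d → Ω → Lp ℂ ∞ (volume : Measure (Rd d))) : Prop where
  measurable : AEStronglyMeasurable (fun p : Rd d × Ω => f p.1 p.2) (measQ Q μ)
  measurable_slice : ∀ x ∈ Q, AEStronglyMeasurable (f x) μ
  mem : ∀ x ∈ Q, ∀ᵐ ω ∂μ, MemX Φ e A (f x ω)
  norm_lt_top : ∀ x ∈ Q, N (f x) < ∞
  continuous : ∀ x ∈ Q, Tendsto (fun x' => N (fun ω => f x' ω - f x ω)) (𝓝 x) (𝓝 0)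
  support : ∃ K : Set (Rd d), IsCompact K ∧ K ⊆ Q ∧ ∀ x ∈ Q \ K, ∀ᵐ ω ∂μ, f x ω = 0

/-- `f ∈ 𝒦(Q; L^Φ(Ω; 𝔛^{Φ,∞}_A))`. -/
def MemKOrlicz (Q : Set (Rd d)) (μ : Measure Ω) (Φ e : ℝ → ℝ) (A : StarSubalgebra ℂ (Rd d →ᵇ ℂ))
    (f : Rd d → Ω → Lp ℂ ∞ (volume : Measure (Rd d))) : Prop :=
  MemK Q μ Φ e A (fun g => luxNorm Φ μ g) f

/-- `f ∈ 𝒦(Q; L^∞(Ω; 𝔛^{Φ,∞}_A))`. -/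
def MemKLinfty (Q : Set (Rd d)) (μ : Measure Ω) (Φ e : ℝ → ℝ) (A : StarSubalgebra ℂ (Rd d →ᵇ ℂ))
    (f : Rd d → Ω → Lp ℂ ∞ (volume : Measure (Rd d))) : Prop :=
  MemK Q μ Φ e A (fun g => eLpNorm g ∞ μ) f

end Conv

end StochSigma

end

open StochSigma

open MeasureTheory Filter Topology Set
open scoped ENNReal BoundedContinuousFunction

set_option linter.unusedSectionVars false

noncomputable section

namespace StochSigma

/-! Both statements are density arguments resting on Young's inequality with a free parameter: `|uf|
≤ Φ(c|u|) + Ψ(|f|/c)`, where `Ψ` is the conjugate of `Φ`. A family bounded in `L^Φ` has a small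
`Φ`-modular after multiplication by a small `c`. So if `F` is close to `G` in the `Ψ`-modular at
parameter `1/c`, both along the traces for small `ε` and in mean value, the pairings with `F` and
`G` are close on both sides of (3.1). The functions that may be paired (`IsPairable`) are therefore
closed under such approximation (`IsPairable.of_approx`). Condition `Δ'` makes `Φ` and its conjugate
doubling on the whole half-line (`IsNFunction.isYoungPair`), and modular estimates replace norm
estimates throughout.

Starting from test functions, the class grows in stages: rectangles `1_D ⊗ 1_B ⊗ g` with `g ∈ A`
(`IsPairable.rectangle`), arbitrary measurable sets of `Q × Ω` over a compact set
(`IsPairable.indMul_mem`), `w` in the closure of `A` instead of `g` (`IsPairable.indMul_mx`), simple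
functions, and finally strongly measurable `L^∞(ℝ^d)`-valued functions with finite modular
(`IsPairable.of_lp`). Two mechanisms control the traces. A bound `h(x,ω)` uniform in `y` becomes
`h(x, T(x/ε₁)ω)`, which has the same modular because `(x,ω) ↦ (x, T(x/ε₁)ω)` preserves the measure.
An error `w - g` small only on average becomes, at `x/ε₂`, an average over a large ball. Since
scales are powers of `ε` (`IsScale.exists_rpow`), the norm of `Ξ^Ψ` controls all averages over balls
of radius at least one.

The second statement follows by duality. The traces of a fixed test function form a bounded family
in the conjugate space, and they converge weakly to that function. For products of tensors this is
direct: invariance of `μ` decouples the `ω`-integral and the mean value of `A` handles the rest.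
Applying `IsPairable.of_lp` to this family with `Φ` and its conjugate exchanged, and with `v` as the
function paired against it, gives the convergence of `∬ v^ε f^ε`. -/

/-! ### Young functions and modular continuity -/

/-- A continuous convex function on `[0,∞)`, nonnegative and vanishing at `0`, satisfying the
`Δ₂` condition globally. -/
structure YoungFn (Φ : ℝ → ℝ) : Prop where
  cont : ContinuousOn Φ (Ici 0)
  conv : ConvexOn ℝ (Ici 0) Φ
  zero : Φ 0 = 0
  nonneg : ∀ t, 0 ≤ t → 0 ≤ Φ t
  double : ∃ k : ℝ, 0 ≤ k ∧ ∀ t, 0 ≤ t → Φ (2 * t) ≤ k * Φ t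

/-- Two Young functions related by Young's inequality. -/
structure IsYoungPair (Φ Ψ : ℝ → ℝ) : Prop where
  left : YoungFn Φ
  right : YoungFn Ψ
  young : ∀ a b, 0 ≤ a → 0 ≤ b → a * b ≤ Φ a + Ψ b

theorem IsYoungPair.symm {Φ Ψ : ℝ → ℝ} (h : IsYoungPair Φ Ψ) : IsYoungPair Ψ Φ :=
  ⟨h.right, h.left, fun a b ha hb => by linarith [h.young b a hb ha, mul_comm a b]⟩

namespace YoungFn

variable {Φ : ℝ → ℝ}

theorem smul_le (h : YoungFn Φ) {s t : ℝ} (hs : 0 ≤ s) (hs1 : s ≤ 1) (ht : 0 ≤ t) :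
    Φ (s * t) ≤ s * Φ t := by
  have := h.conv.2 (mem_Ici.2 ht) (mem_Ici.2 le_rfl) hs (sub_nonneg.2 hs1) (by ring)
  simpa [h.zero] using this

theorem mono (h : YoungFn Φ) {s t : ℝ} (hs : 0 ≤ s) (hst : s ≤ t) : Φ s ≤ Φ t := by
  rcases hs.eq_or_lt with rfl | hs'
  · rw [h.zero]; exact h.nonneg t hst
  have ht : 0 < t := hs'.trans_le hst
  have h1 := h.smul_le (s := s / t) (t := t) (by positivity) ((div_le_one ht).2 hst) ht.le
  rw [div_mul_cancel₀ _ ht.ne'] at h1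
  have h2 : s / t * Φ t ≤ 1 * Φ t :=
    mul_le_mul_of_nonneg_right ((div_le_one ht).2 hst) (h.nonneg t ht.le)
  linarith

theorem exists_mul_le (h : YoungFn Φ) (c : ℝ) :
    ∃ C : ℝ, 0 ≤ C ∧ ∀ t, 0 ≤ t → 0 ≤ c → Φ (c * t) ≤ C * Φ t := by
  obtain ⟨k, hk0, hk⟩ := h.double
  have hpow : ∀ n : ℕ, ∀ t, 0 ≤ t → Φ (2 ^ n * t) ≤ k ^ n * Φ t := by
    intro n
    induction n with
    | zero => intro t _; simp
    | succ n ih =>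
      intro t ht
      have h1 := hk (2 ^ n * t) (by positivity)
      have h2 := mul_le_mul_of_nonneg_left (ih t ht) hk0
      calc Φ (2 ^ (n + 1) * t) = Φ (2 * (2 ^ n * t)) := by ring_nf
        _ ≤ k * Φ (2 ^ n * t) := h1
        _ ≤ k * (k ^ n * Φ t) := h2
        _ = k ^ (n + 1) * Φ t := by ring
  obtain ⟨n, hn⟩ := pow_unbounded_of_one_lt c (one_lt_two)
  exact ⟨k ^ n, by positivity, fun t ht hc =>
    (h.mono (by positivity) (mul_le_mul_of_nonneg_right hn.le ht)).trans (hpow n t ht)⟩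

theorem add_le_half (h : YoungFn Φ) {a b : ℝ} (ha : 0 ≤ a) (hb : 0 ≤ b) :
    Φ (a + b) ≤ Φ (2 * a) / 2 + Φ (2 * b) / 2 := by
  have := h.conv.2 (mem_Ici.2 (show 0 ≤ 2 * a by positivity))
    (mem_Ici.2 (show 0 ≤ 2 * b by positivity)) (show (0 : ℝ) ≤ 1 / 2 by norm_num)
    (show (0 : ℝ) ≤ 1 / 2 by norm_num) (by norm_num)
  simp only [smul_eq_mul] at this
  calc Φ (a + b) = Φ (1 / 2 * (2 * a) + 1 / 2 * (2 * b)) := by ring_nf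
    _ ≤ _ := by linarith

/-- If `b ≤ l a` with `l` small, then `a + b ≤ (1 - l) a + l (2a)`, and convexity with doubling
costs only the factor `1 + lk ≤ 1 + η`. Otherwise `a ≤ b / l` and doubling absorbs everything into
`C Φ(b)`. -/
theorem exists_add_le_close (h : YoungFn Φ) {η : ℝ} (hη : 0 < η) :
    ∃ C : ℝ, 0 ≤ C ∧ ∀ a b, 0 ≤ a → 0 ≤ b → Φ (a + b) ≤ (1 + η) * Φ a + C * Φ b := by
  obtain ⟨k, hk0, hk⟩ := h.double
  set l : ℝ := min 1 (η / (k + 1)) with hl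
  have hl0 : 0 < l := by positivity
  have hl1 : l ≤ 1 := min_le_left _ _
  have hlk : l * k ≤ η := by
    have : l ≤ η / (k + 1) := min_le_right _ _
    calc l * k ≤ η / (k + 1) * (k + 1) := by gcongr; linarith
      _ = η := by field_simp
  obtain ⟨C, hC0, hC⟩ := h.exists_mul_le (1 + 1 / l)
  refine ⟨C, hC0, fun a b ha hb => ?_⟩
  by_cases hab : b ≤ l * a
  · have h1 : Φ (a + b) ≤ Φ ((1 - l) * a + l * (2 * a)) :=
      h.mono (by positivity) (by linarith)
    have h2 := h.conv.2 (mem_Ici.2 ha) (mem_Ici.2 (show 0 ≤ 2 * a by positivity))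
      (sub_nonneg.2 hl1) hl0.le (by ring)
    simp only [smul_eq_mul] at h2
    have h3 := mul_le_mul_of_nonneg_left (hk a ha) hl0.le
    have h4 := h.nonneg a ha
    have h5 : l * k * Φ a ≤ η * Φ a := mul_le_mul_of_nonneg_right hlk h4
    have h6 := mul_nonneg hC0 (h.nonneg b hb)
    have h7 := mul_nonneg hl0.le h4
    nlinarith
  · push Not at hab
    have h1 : a ≤ 1 / l * b := by
      rw [one_div, inv_mul_eq_div, le_div_iff₀ hl0]; linarith
    have h2 : Φ (a + b) ≤ Φ ((1 + 1 / l) * b) := h.mono (by positivity) (by linarith)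
    have h3 := hC b hb (by positivity)
    have h4 := mul_nonneg (show 0 ≤ 1 + η by positivity) (h.nonneg a ha)
    linarith

/-- This makes `∫ Φ(|u|)` continuous for modular convergence: the first term is small relative to a
bounded modular, the second is the modular of the difference. -/
theorem exists_abs_sub_le (h : YoungFn Φ) {η : ℝ} (hη : 0 < η) :
    ∃ C : ℝ, 0 ≤ C ∧ ∀ a b, 0 ≤ a → 0 ≤ b → |Φ a - Φ b| ≤ η * Φ a + C * Φ |a - b| := by
  obtain ⟨C, hC0, hC⟩ := h.exists_add_le_close hη
  refine ⟨C, hC0, fun a b ha hb => ?_⟩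
  have h1 : Φ b ≤ (1 + η) * Φ a + C * Φ |a - b| :=
    (h.mono hb (by linarith [neg_abs_le (a - b)])).trans (hC a |a - b| ha (abs_nonneg _))
  have h2 : Φ a ≤ (1 + η) * Φ b + C * Φ |a - b| :=
    (h.mono ha (by linarith [le_abs_self (a - b)])).trans (hC b |a - b| hb (abs_nonneg _))
  rw [abs_le]
  refine ⟨by linarith, ?_⟩
  -- The bound on `Φ a` carries `η Φ b`. It is at most `η Φ a` in the first case; in the second, `Φ
  -- a - Φ b` is negative.
  by_cases hab : Φ b ≤ Φ a
  · have := mul_le_mul_of_nonneg_left hab hη.le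
    linarith
  · have h3 := mul_nonneg hC0 (h.nonneg |a - b| (abs_nonneg _))
    have h4 := mul_nonneg hη.le (h.nonneg a ha)
    linarith

/-- `Φ` is controlled only on `[0,∞)`; truncating the argument gives a function continuous on the
whole line, usable for measurability and limits. -/
theorem continuous_max (h : YoungFn Φ) : Continuous fun t => Φ (max t 0) :=
  h.cont.comp_continuous (by fun_prop) fun t => mem_Ici.2 (le_max_right _ _)

theorem exists_pos_le (h : YoungFn Φ) {η : ℝ} (hη : 0 < η) : ∃ t : ℝ, 0 < t ∧ Φ t ≤ η := by
  have h1 := h.nonneg 1 zero_le_one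
  refine ⟨min 1 (η / (Φ 1 + 1)), by positivity, ?_⟩
  have h2 := h.smul_le (s := min 1 (η / (Φ 1 + 1))) (t := 1) (by positivity) (min_le_left _ _)
    zero_le_one
  rw [mul_one] at h2
  refine h2.trans ?_
  calc min 1 (η / (Φ 1 + 1)) * Φ 1 ≤ η / (Φ 1 + 1) * (Φ 1 + 1) := by
        gcongr
        · exact min_le_right _ _
        · linarith
    _ = η := by field_simp

theorem aestronglyMeasurable_comp (h : YoungFn Φ) {α : Type*} [MeasurableSpace α] {m : Measure α}
    {g : α → ℝ} (hg : AEStronglyMeasurable g m) (hg0 : ∀ a, 0 ≤ g a) :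
    AEStronglyMeasurable (fun a => Φ (g a)) m := by
  have := h.continuous_max.comp_aestronglyMeasurable hg
  refine this.congr (Eventually.of_forall fun a => ?_)
  simp [max_eq_left (hg0 a)]

theorem aemeasurable_ofReal (h : YoungFn Φ) {α : Type*} [MeasurableSpace α] {m : Measure α}
    {g : α → ℝ} (hg : AEStronglyMeasurable g m) (hg0 : ∀ a, 0 ≤ g a) :
    AEMeasurable (fun a => ENNReal.ofReal (Φ (g a))) m :=
  (h.aestronglyMeasurable_comp hg hg0).aemeasurable.ennreal_ofReal

end YoungFn

/-! ### N-functions of class `Δ'` and their conjugates -/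

section Conj

variable {Φ : ℝ → ℝ}

theorem IsNFunction.map_zero (h : IsNFunction Φ) : Φ 0 = 0 := by
  have h1 : Tendsto Φ (𝓝[>] 0) (𝓝 (Φ 0)) :=
    (h.continuousOn 0 (mem_Ici.2 le_rfl)).mono_left (nhdsWithin_mono _ Ioi_subset_Ici_self)
  have h2 : Tendsto (fun t => Φ t / t * t) (𝓝[>] 0) (𝓝 (0 * 0)) :=
    h.tendsto_zero.mul (tendsto_id.mono_left nhdsWithin_le_nhds)
  have h3 : Tendsto Φ (𝓝[>] 0) (𝓝 (0 * 0)) := by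
    refine h2.congr' ?_
    filter_upwards [self_mem_nhdsWithin] with t ht
    exact div_mul_cancel₀ _ (ne_of_gt ht)
  simpa using tendsto_nhds_unique h1 h3

theorem IsNFunction.nonneg (h : IsNFunction Φ) (t : ℝ) (ht : 0 ≤ t) : 0 ≤ Φ t := by
  rcases ht.eq_or_lt with rfl | ht
  · rw [h.map_zero]
  · exact (h.pos t ht).le

/-- `Δ'` with one factor equal to `2` gives doubling on all of `[0,∞)`, small arguments included,
with constant `β Φ(2)`. -/
theorem IsNFunction.youngFn (h : IsNFunction Φ) (h' : DeltaPrime Φ) : YoungFn Φ := by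
  obtain ⟨β, hβ, hΦ⟩ := h'
  refine ⟨h.continuousOn, h.convexOn, h.map_zero, h.nonneg, β * Φ 2, ?_, fun t ht => ?_⟩
  · exact mul_nonneg hβ.le (h.nonneg 2 (by norm_num))
  · exact hΦ 2 t (by norm_num) ht

theorem IsNFunction.bddAbove (h : IsNFunction Φ) (t : ℝ) :
    BddAbove ((fun s => s * t - Φ s) '' Ici 0) := by
  obtain ⟨N, hN⟩ := (tendsto_atTop_atTop.1 h.tendsto_atTop) (|t|)
  have hN' : ∀ s, max N 1 ≤ s → s * t - Φ s ≤ 0 := fun s hs => by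
    have hs0 : 0 < s := lt_of_lt_of_le one_pos ((le_max_right _ _).trans hs)
    have h1 := hN s ((le_max_left _ _).trans hs)
    rw [le_div_iff₀ hs0] at h1
    have h2 := mul_le_mul_of_nonneg_right (le_abs_self t) hs0.le
    linarith
  refine ⟨max N 1 * |t|, ?_⟩
  rintro _ ⟨s, hs, rfl⟩
  have hs : 0 ≤ s := hs
  have hM : 0 ≤ max N 1 := zero_le_one.trans (le_max_right _ _)
  by_cases hsN : max N 1 ≤ s
  · exact (hN' s hsN).trans (by positivity)
  · push Not at hsN
    have h1 : s * t ≤ s * |t| := mul_le_mul_of_nonneg_left (le_abs_self t) hs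
    have h2 : s * |t| ≤ max N 1 * |t| := mul_le_mul_of_nonneg_right hsN.le (abs_nonneg t)
    have h3 := h.nonneg s hs
    dsimp only
    linarith

theorem IsNFunction.le_conj (h : IsNFunction Φ) (t : ℝ) {s : ℝ} (hs : 0 ≤ s) :
    s * t - Φ s ≤ conj Φ t :=
  le_csSup (h.bddAbove t) ⟨s, hs, rfl⟩

theorem conj_le {t c : ℝ} (h : ∀ s, 0 ≤ s → s * t - Φ s ≤ c) : conj Φ t ≤ c := by
  refine csSup_le (Set.image_nonempty.2 ⟨0, mem_Ici.2 le_rfl⟩) ?_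
  rintro _ ⟨s, hs, rfl⟩
  exact h s hs

theorem IsNFunction.convexOn_conj (h : IsNFunction Φ) : ConvexOn ℝ univ (conj Φ) := by
  refine ⟨convex_univ, fun x _ y _ a b ha hb hab => conj_le fun s hs => ?_⟩
  have h1 := mul_le_mul_of_nonneg_left (h.le_conj x hs) ha
  have h2 := mul_le_mul_of_nonneg_left (h.le_conj y hs) hb
  simp only [smul_eq_mul]
  have h3 : Φ s = a * Φ s + b * Φ s := by rw [← add_mul, hab, one_mul]
  nlinarith

/-- Doubling of the conjugate is dual to a contraction property of `Φ`. As `Φ(t)/t → 0` at zero,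
some `l` has `β Φ(l) ≤ l/2`, so `Δ'` yields `Φ(ls) ≤ (l/2) Φ(s)`. Substituting `ls` in the supremum
turns this into doubling with constant `2/l`. -/
theorem IsNFunction.youngFn_conj (h : IsNFunction Φ) (h' : DeltaPrime Φ) : YoungFn (conj Φ) := by
  refine ⟨?_, h.convexOn_conj.subset (subset_univ _) (convex_Ici 0), ?_, fun t _ => ?_, ?_⟩
  · exact (h.convexOn_conj.continuousOn isOpen_univ).mono (subset_univ _)
  · refine le_antisymm (conj_le fun s hs => ?_) ?_
    · have := h.nonneg s hs; linarith
    · have := h.le_conj 0 (le_refl (0 : ℝ)); simpa [h.map_zero] using this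
  · have := h.le_conj t (le_refl (0 : ℝ)); simpa [h.map_zero] using this
  · obtain ⟨β, hβ, hΦ⟩ := h'
    have h1 : ∀ᶠ t in 𝓝[>] (0 : ℝ), Φ t / t < 1 / (2 * β) :=
      h.tendsto_zero.eventually (gt_mem_nhds (by positivity))
    obtain ⟨l, hl, hl0⟩ := (h1.and self_mem_nhdsWithin).exists
    have hl0 : 0 < l := hl0
    rw [div_lt_div_iff₀ hl0 (by positivity)] at hl
    have key : ∀ s, 0 ≤ s → Φ (l * s) ≤ l / 2 * Φ s := fun s hs =>
      (hΦ l s hl0.le hs).trans (mul_le_mul_of_nonneg_right (by linarith) (h.nonneg s hs))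
    refine ⟨2 / l, by positivity, fun t ht => conj_le fun s hs => ?_⟩
    have h2 := mul_le_mul_of_nonneg_left (h.le_conj t (mul_nonneg hl0.le hs))
      (show 0 ≤ 2 / l by positivity)
    have h3 := mul_le_mul_of_nonneg_left (key s hs) (show 0 ≤ 2 / l by positivity)
    have h4 : 2 / l * (l * s * t - Φ (l * s)) = s * (2 * t) - 2 / l * Φ (l * s) := by
      field_simp
    have h5 : 2 / l * (l / 2 * Φ s) = Φ s := by field_simp
    linarith

theorem IsNFunction.isYoungPair (h : IsNFunction Φ) (h' : DeltaPrime Φ) :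
    IsYoungPair Φ (conj Φ) :=
  ⟨h.youngFn h', h.youngFn_conj h', fun a b ha _ => by linarith [h.le_conj b ha]⟩

end Conj

/-! ### Scales -/

/-- In logarithmic coordinates a scale is an additive map `g` of `ℝ`. It is positive on positive
numbers, since otherwise `e(exp(-ns)) ≥ 1` for all `n`, against the limit zero. Hence `g` is
monotone, so measurable, so continuous, so linear. -/
theorem IsScale.exists_rpow {e : ℝ → ℝ} (he : IsScale e) :
    ∃ a : ℝ, 0 < a ∧ ∀ ε, 0 < ε → e ε = ε ^ a := by
  let g : ℝ →+ ℝ :=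
    { toFun := fun s => Real.log (e (Real.exp s))
      map_zero' := by
        have h := he.map_mul 1 1 one_pos one_pos
        have h1 := he.pos 1 one_pos
        rw [mul_one] at h
        have h2 : e 1 = 1 := by
          have := mul_right_cancel₀ h1.ne' (show 1 * e 1 = e 1 * e 1 by rw [one_mul]; exact h)
          exact this.symm
        simp [h2]
      map_add' := fun s t => by
        rw [Real.exp_add, he.map_mul _ _ (Real.exp_pos s) (Real.exp_pos t),
          Real.log_mul (he.pos _ (Real.exp_pos s)).ne' (he.pos _ (Real.exp_pos t)).ne'] }
  have hg : ∀ s, g s = Real.log (e (Real.exp s)) := fun s => rfl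
  have hpos : ∀ s, 0 < s → 0 < g s := by
    intro s hs
    by_contra! hneg
    have hlim : Tendsto (fun n : ℕ => e (Real.exp (-(n * s)))) atTop (𝓝 0) := by
      refine he.tendsto_zero.comp (tendsto_nhdsWithin_iff.2 ⟨?_, Eventually.of_forall fun n =>
        mem_Ioi.2 (Real.exp_pos _)⟩)
      refine Real.tendsto_exp_neg_atTop_nhds_zero.comp ?_
      exact tendsto_natCast_atTop_atTop.atTop_mul_const hs
    have hge : ∀ n : ℕ, 1 ≤ e (Real.exp (-(n * s))) := by
      intro n
      have h1 : g (-(n * s)) = -(n * g s) := by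
        rw [map_neg, ← nsmul_eq_mul, map_nsmul, nsmul_eq_mul]
      have h2 : 0 ≤ g (-(n * s)) := by
        rw [h1]
        have : (n : ℝ) * g s ≤ 0 := mul_nonpos_of_nonneg_of_nonpos n.cast_nonneg hneg
        linarith
      rw [hg] at h2
      by_contra! hlt
      exact absurd h2 (not_le.2 (Real.log_neg (he.pos _ (Real.exp_pos _)) hlt))
    have := ge_of_tendsto' hlim hge
    linarith
  have hmono : Monotone g := by
    intro s t hst
    rcases hst.eq_or_lt with rfl | h
    · exact le_rfl
    · have := hpos (t - s) (sub_pos.2 h)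
      rw [map_sub] at this
      linarith
  have hcont : Continuous g := MeasureTheory.Measure.AddMonoidHom.continuous_of_measurable g hmono.measurable
  refine ⟨g 1, hpos 1 one_pos, fun ε hε => ?_⟩
  have h1 : g (Real.log ε) = Real.log ε * g 1 := by
    have := map_real_smul g hcont (Real.log ε) 1
    simpa using this
  rw [hg, Real.exp_log hε] at h1
  rw [Real.rpow_def_of_pos hε, ← h1, Real.exp_log (he.pos ε hε)]

/-- Links the supremum over `0 < ε ≤ 1` in the norm of `Ξ^Φ` to averages over all balls of radius at
least one. -/
theorem IsScale.exists_eq_inv {e : ℝ → ℝ} (he : IsScale e) {R : ℝ} (hR : 1 ≤ R) :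
    ∃ ε ∈ Ioc (0 : ℝ) 1, e ε = R⁻¹ := by
  obtain ⟨a, ha, h⟩ := he.exists_rpow
  have hR0 : 0 < R := by linarith
  refine ⟨R⁻¹ ^ (1 / a), ⟨by positivity, ?_⟩, ?_⟩
  · exact Real.rpow_le_one (by positivity) (inv_le_one_of_one_le₀ hR) (by positivity)
  · rw [h _ (by positivity), ← Real.rpow_mul (by positivity), one_div_mul_cancel ha.ne',
      Real.rpow_one]

/-- As `e` is a power, any positive quantity tending to zero is `e` of another one. The mean value
for `ε₁` can thus be read along `ε₂` and along `1/R`. -/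
theorem HasMeanValue.tendsto_scale {d : ℕ} {e : ℝ → ℝ} (he : IsScale e) {u : Rd d → ℂ} {m : ℂ}
    (h : HasMeanValue e u m) {φ : Rd d → ℂ} (hφ : Integrable φ) {ι : Type*} {l : Filter ι}
    {s : ι → ℝ} (hs : Tendsto s l (𝓝[>] 0)) :
    Tendsto (fun i => ∫ x, u ((s i)⁻¹ • x) * φ x) l (𝓝 (m * ∫ x, φ x)) := by
  obtain ⟨a, ha, hea⟩ := he.exists_rpow
  have h1 : Tendsto (fun i => s i ^ (1 / a)) l (𝓝[>] 0) := by
    have hs' := tendsto_nhdsWithin_iff.1 hs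
    refine tendsto_nhdsWithin_iff.2 ⟨?_, ?_⟩
    · have := hs'.1.rpow_const (p := 1 / a) (Or.inr (by positivity))
      rwa [Real.zero_rpow (by positivity)] at this
    · filter_upwards [hs'.2] with i hi
      exact Real.rpow_pos_of_pos hi _
  refine ((h φ hφ).comp h1).congr' ?_
  filter_upwards [(tendsto_nhdsWithin_iff.1 hs).2] with i hi
  have hi : 0 < s i := hi
  simp only [Function.comp]
  rw [hea _ (by positivity), ← Real.rpow_mul hi.le, one_div_mul_cancel ha.ne', Real.rpow_one]

/-! ### Normalized measures on balls -/

/-- The uniform probability measure on the ball of radius `R`. -/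
def ballMeas (d : ℕ) (R : ℝ) : Measure (Rd d) :=
  (volume (Metric.ball (0 : Rd d) R))⁻¹ • volume.restrict (Metric.ball (0 : Rd d) R)

section Ball

variable {d : ℕ}

theorem ballMeas_ac (R : ℝ) : ballMeas d R ≪ volume :=
  (Measure.smul_absolutelyContinuous).trans Measure.absolutelyContinuous_restrict

theorem isProbabilityMeasure_ballMeas {R : ℝ} (hR : 0 < R) :
    IsProbabilityMeasure (ballMeas d R) := by
  constructor
  rw [ballMeas, Measure.smul_apply, Measure.restrict_apply_univ, smul_eq_mul]
  exact ENNReal.inv_mul_cancel (Metric.measure_ball_pos volume _ hR).ne' measure_ball_lt_top.ne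

theorem setAverage_ball_eq {F : Type*} [NormedAddCommGroup F] [NormedSpace ℝ F] (u : Rd d → F)
    (R : ℝ) : ⨍ y in Metric.ball (0 : Rd d) R, u y = ∫ y, u y ∂(ballMeas d R) := by
  rw [average_eq', Measure.restrict_apply_univ, ballMeas]

theorem setLIntegral_ball_comp_smul (h : Rd d → ℝ≥0∞) {R : ℝ} (hR : 0 < R) (ρ : ℝ) :
    ∫⁻ x in Metric.ball (0 : Rd d) ρ, h (R • x) =
      ENNReal.ofReal (R ^ d)⁻¹ * ∫⁻ y in Metric.ball (0 : Rd d) (R * ρ), h y := by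
  have hemb : MeasurableEmbedding (fun x : Rd d => R • x) :=
    (Homeomorph.smulOfNeZero R hR.ne').measurableEmbedding
  have hpre : (fun x : Rd d => R • x) ⁻¹' Metric.ball 0 (R * ρ) = Metric.ball 0 ρ := by
    ext x
    simp [norm_smul, abs_of_pos hR, hR]
  have h1 := Measure.map_addHaar_smul (volume : Measure (Rd d)) hR.ne'
  rw [← hpre, ← hemb.lintegral_map, ← hemb.restrict_map, h1, Measure.restrict_smul,
    lintegral_smul_measure, smul_eq_mul]
  congr 2
  rw [finrank_euclideanSpace_fin, abs_of_pos (by positivity)]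

theorem volume_ball_mul {R : ℝ} (hR : 0 < R) (ρ : ℝ) :
    volume (Metric.ball (0 : Rd d) ρ) =
      ENNReal.ofReal (R ^ d)⁻¹ * volume (Metric.ball (0 : Rd d) (R * ρ)) := by
  have := setLIntegral_ball_comp_smul (d := d) (fun _ => 1) hR ρ
  simpa using this

/-- The normalization cancels the Jacobian, so dilations carry uniform measures on balls to uniform
measures on balls. -/
theorem lintegral_ballMeas_comp_smul (h : Rd d → ℝ≥0∞) {R : ℝ} (hR : 0 < R) (ρ : ℝ) :
    ∫⁻ x, h (R • x) ∂(ballMeas d ρ) = ∫⁻ y, h y ∂(ballMeas d (R * ρ)) := by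
  have hc0 : ENNReal.ofReal (R ^ d)⁻¹ ≠ 0 := by
    simp only [ne_eq, ENNReal.ofReal_eq_zero, not_le]; positivity
  rw [ballMeas, ballMeas, lintegral_smul_measure, lintegral_smul_measure,
    setLIntegral_ball_comp_smul h hR, volume_ball_mul hR ρ,
    ENNReal.mul_inv (Or.inl hc0) (Or.inl ENNReal.ofReal_ne_top), smul_eq_mul, smul_eq_mul]
  calc _ = ((ENNReal.ofReal (R ^ d)⁻¹)⁻¹ * ENNReal.ofReal (R ^ d)⁻¹) *
        ((volume (Metric.ball (0 : Rd d) (R * ρ)))⁻¹ *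
          ∫⁻ y in Metric.ball (0 : Rd d) (R * ρ), h y) := by ring
    _ = _ := by rw [ENNReal.inv_mul_cancel hc0 ENNReal.ofReal_ne_top, one_mul]

theorem integral_ballMeas_comp_smul {F : Type*} [NormedAddCommGroup F] [NormedSpace ℝ F]
    (h : Rd d → F) {R : ℝ} (hR : 0 < R) (ρ : ℝ) :
    ∫ x, h (R • x) ∂(ballMeas d ρ) = ∫ y, h y ∂(ballMeas d (R * ρ)) := by
  have hemb : MeasurableEmbedding (fun x : Rd d => R • x) :=
    (Homeomorph.smulOfNeZero R hR.ne').measurableEmbedding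
  have hmap : (ballMeas d ρ).map (fun x => R • x) = ballMeas d (R * ρ) := by
    ext s hs
    have h1 := lintegral_ballMeas_comp_smul (d := d) (s.indicator 1) hR ρ
    rw [lintegral_indicator_one hs] at h1
    rw [Measure.map_apply hemb.measurable hs, ← h1, ← lintegral_indicator_one (hemb.measurable hs)]
    rfl
  rw [← hmap, hemb.integral_map]

/-- `m` is the limit of the averages of `u` over large balls. -/
def HasBallMean {F : Type*} [NormedAddCommGroup F] [NormedSpace ℝ F] (u : Rd d → F) (m : F) :
    Prop :=
  Tendsto (fun R : ℝ => ∫ y, u y ∂(ballMeas d R)) atTop (𝓝 m)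

theorem HasBallMean.mean_eq {F : Type*} [NormedAddCommGroup F] [NormedSpace ℝ F] {u : Rd d → F}
    {m : F} (h : HasBallMean u m) : mean u = m := by
  have : Tendsto (fun r : ℝ => ⨍ y in Metric.ball (0 : Rd d) r, u y) atTop (𝓝 m) := by
    simp only [setAverage_ball_eq]
    exact h
  exact this.limUnder_eq

/-- Weak-* convergence is tested on the normalized indicator of the unit ball, along the scale
`1/R`. -/
theorem HasMeanValue.hasBallMean {e : ℝ → ℝ} (he : IsScale e) {u : Rd d → ℂ} {m : ℂ}
    (h : HasMeanValue e u m) : HasBallMean u m := by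
  set B := Metric.ball (0 : Rd d) 1 with hB
  have hvol : volume B ≠ 0 := (Metric.measure_ball_pos volume _ one_pos).ne'
  have hvol' : volume B ≠ ∞ := measure_ball_lt_top.ne
  have hreal : volume.real B ≠ 0 := (ENNReal.toReal_pos hvol hvol').ne'
  have h1 := h.tendsto_scale he (φ := B.indicator fun _ => ((volume.real B)⁻¹ : ℂ))
    ((integrable_indicator_iff measurableSet_ball).2 (integrableOn_const hvol' (by simp))) (s := fun R : ℝ => R⁻¹) tendsto_inv_atTop_nhdsGT_zero
  rw [integral_indicator measurableSet_ball, setIntegral_const, Complex.real_smul,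
    mul_inv_cancel₀ (by exact_mod_cast hreal), mul_one] at h1
  refine h1.congr' ?_
  filter_upwards [eventually_gt_atTop 0] with R hR
  have h2 := integral_ballMeas_comp_smul (d := d) u hR 1
  rw [mul_one] at h2
  rw [← h2, ballMeas, integral_smul_measure, ← integral_indicator measurableSet_ball, inv_inv,
    ENNReal.toReal_inv, ← integral_smul]
  refine integral_congr_ae (Eventually.of_forall fun x => ?_)
  by_cases hx : x ∈ Metric.ball (0 : Rd d) 1
  · simp only [hB, indicator_of_mem hx, Complex.real_smul, Complex.ofReal_inv]
    rw [mul_comm]; rfl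
  · simp only [hB, indicator_of_notMem hx, mul_zero, smul_zero]

/-- Cauchy's criterion for the averages as `R → ∞`. It carries the existence of means from `A` to
functions approximated by `A`, with no prior candidate for the limit. -/
theorem exists_hasBallMean_of_approx {F : Type*} [NormedAddCommGroup F] [NormedSpace ℝ F]
    [CompleteSpace F] {h : Rd d → F}
    (H : ∀ η : ℝ, 0 < η → ∃ (h' : Rd d → F) (m' : F), HasBallMean h' m' ∧ ∀ᶠ R in atTop,
      ‖∫ y, h y ∂(ballMeas d R) - ∫ y, h' y ∂(ballMeas d R)‖ ≤ η) :
    ∃ m, HasBallMean h m := by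
  refine cauchy_map_iff_exists_tendsto.1 (Metric.cauchy_iff.2 ⟨inferInstance, fun η hη => ?_⟩)
  obtain ⟨h', m', hm, hh⟩ := H (η / 4) (by positivity)
  have h1 : ∀ᶠ R in atTop, dist (∫ y, h' y ∂(ballMeas d R)) m' < η / 4 :=
    (Metric.tendsto_nhds.1 hm) _ (by positivity)
  refine ⟨_, image_mem_map (h1.and hh), ?_⟩
  rintro _ ⟨R, ⟨hR1, hR2⟩, rfl⟩ _ ⟨S, ⟨hS1, hS2⟩, rfl⟩
  rw [← dist_eq_norm] at hR2 hS2
  have := dist_triangle4 (∫ y, h y ∂(ballMeas d R)) (∫ y, h' y ∂(ballMeas d R))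
    (∫ y, h' y ∂(ballMeas d S)) (∫ y, h y ∂(ballMeas d S))
  have h3 := dist_triangle_right (∫ y, h' y ∂(ballMeas d R)) (∫ y, h' y ∂(ballMeas d S)) m'
  rw [dist_comm (∫ y, h' y ∂(ballMeas d S)) (∫ y, h y ∂(ballMeas d S))] at this
  linarith

theorem norm_integral_sub_le_of_lintegral {α F : Type*} [MeasurableSpace α] {m : Measure α}
    [NormedAddCommGroup F] [NormedSpace ℝ F] {f g : α → F} (hf : Integrable f m)
    (hg : Integrable g m) {η : ℝ} (hη : 0 ≤ η)
    (h : ∫⁻ a, ‖f a - g a‖ₑ ∂m ≤ ENNReal.ofReal η) :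
    ‖∫ a, f a ∂m - ∫ a, g a ∂m‖ ≤ η := by
  rw [← integral_sub hf hg]
  have h1 := (enorm_integral_le_lintegral_enorm (μ := m) (fun a => f a - g a)).trans h
  rw [← ofReal_norm] at h1
  exact (ENNReal.ofReal_le_ofReal_iff hη).1 h1

end Ball

/-! ### Supralgebras -/

section Supralgebra

variable {d : ℕ} {e : ℝ → ℝ} {A : StarSubalgebra ℂ (Rd d →ᵇ ℂ)}

theorem IsHSupralgebra.exists_hasBallMean (hA : IsHSupralgebra e A) (he : IsScale e)
    {w : Rd d →ᵇ ℂ} (hw : w ∈ A) : ∃ m, HasBallMean (w : Rd d → ℂ) m := by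
  obtain ⟨m, hm⟩ := hA.2 w hw
  exact ⟨m, hm.hasBallMean he⟩

/-- `G(|w|)` is a continuous function of `w w̄`, hence by Weierstrass a uniform limit of polynomials
in `w w̄`; these lie in `A`, which is closed. -/
theorem IsHSupralgebra.exists_comp_norm (hA : IsHSupralgebra e A) {w : Rd d →ᵇ ℂ} (hw : w ∈ A)
    {G : ℝ → ℝ} (hG : Continuous G) : ∃ v ∈ A, ∀ y, v y = (G ‖w y‖ : ℂ) := by
  have hbd : ∀ y, ‖w y‖ ≤ ‖w‖ := w.norm_coe_le_norm
  obtain ⟨C, hC⟩ := (isCompact_Icc (a := (0 : ℝ)) (b := ‖w‖)).exists_bound_of_continuousOn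
    hG.continuousOn
  let v : Rd d →ᵇ ℂ := BoundedContinuousFunction.ofNormedAddCommGroup (fun y => (G ‖w y‖ : ℂ))
    (by fun_prop) C (fun y => by
      rw [Complex.norm_real]; exact hC _ ⟨norm_nonneg _, hbd y⟩)
  refine ⟨v, ?_, fun y => rfl⟩
  have hcl : closure (A : Set (Rd d →ᵇ ℂ)) = A := hA.1.closure_eq
  rw [← SetLike.mem_coe, ← hcl, Metric.mem_closure_iff]
  intro η hη
  obtain ⟨p, hp⟩ := exists_polynomial_near_of_continuousOn 0 (‖w‖ ^ 2) (fun t => G (√t))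
    (by fun_prop) (η / 2) (by positivity)
  refine ⟨Polynomial.aeval (w * star w) p, ?_, ?_⟩
  · have h1 : w * star w ∈ A := mul_mem hw (star_mem hw)
    have h2 : Polynomial.aeval (w * star w) p =
        Polynomial.aeval (w * star w) (p.map (algebraMap ℝ ℂ)) := by
      rw [Polynomial.aeval_map_algebraMap]
    rw [h2]
    exact Algebra.adjoin_le (S := A.toSubalgebra) (singleton_subset_iff.2 h1)
      (Polynomial.aeval_mem_adjoin_singleton ℂ _)
  · refine lt_of_le_of_lt ((BoundedContinuousFunction.dist_le (by positivity)).2 fun y => ?_)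
      (half_lt_self hη)
    have h3 : (Polynomial.aeval (w * star w) p) y = ((p.eval (‖w y‖ ^ 2) : ℝ) : ℂ) := by
      -- Evaluation at `y` is an algebra homomorphism over `ℝ`, so it commutes with the real
      -- polynomial `p`.
      let ev : (Rd d →ᵇ ℂ) →ₐ[ℝ] ℂ :=
        { toFun := fun f => f y
          map_one' := rfl
          map_mul' := fun _ _ => rfl
          map_zero' := rfl
          map_add' := fun _ _ => rfl
          commutes' := fun _ => rfl }
      have h4 : ev (Polynomial.aeval (w * star w) p) = Polynomial.aeval (ev (w * star w)) p :=
        (Polynomial.aeval_algHom_apply ev _ p).symm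
      have h5 : ev (w * star w) = ((‖w y‖ ^ 2 : ℝ) : ℂ) := by
        change w y * (starRingEnd ℂ) (w y) = _
        rw [Complex.mul_conj']
        simp
      change ev _ = _
      rw [h4, h5]
      have h6 := Polynomial.aeval_algebraMap_apply ℂ (‖w y‖ ^ 2) p
      simpa using h6
    rw [h3]
    change dist ((G ‖w y‖ : ℝ) : ℂ) _ ≤ _
    rw [Complex.dist_eq, ← Complex.ofReal_sub, Complex.norm_real, Real.norm_eq_abs, abs_sub_comm]
    have h7 := hp (‖w y‖ ^ 2) ⟨by positivity, by gcongr; exact hbd y⟩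
    rw [Real.sqrt_sq (norm_nonneg _)] at h7
    exact h7.le

theorem IsHSupralgebra.exists_hasBallMean_comp_norm (hA : IsHSupralgebra e A) (he : IsScale e)
    {w : Rd d →ᵇ ℂ} (hw : w ∈ A) {G : ℝ → ℝ} (hG : Continuous G) :
    ∃ m, HasBallMean (fun y => G ‖w y‖) m := by
  obtain ⟨v, hv, hvG⟩ := hA.exists_comp_norm hw hG
  obtain ⟨m, hm⟩ := hA.exists_hasBallMean he hv
  refine ⟨m.re, ?_⟩
  have h1 := (Complex.continuous_re.tendsto m).comp hm
  refine h1.congr fun R => ?_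
  simp only [Function.comp, hvG]
  exact congrArg Complex.re (integral_ofReal (𝕜 := ℂ))

end Supralgebra

/-! ### Modulars and Young's inequality -/

/-- The strict inequality provides an admissible `δ' < δ`, so whether the infimum is attained does
not matter. -/
theorem lintegral_luxNorm_le {α F : Type*} [MeasurableSpace α] [NormedAddCommGroup F]
    {Φ : ℝ → ℝ} (hΦ : YoungFn Φ) {m : Measure α} {f : α → F} {δ : ℝ} (hδ : 0 < δ)
    (h : luxNorm Φ m f < ENNReal.ofReal δ) :
    ∫⁻ a, ENNReal.ofReal (Φ (‖f a‖ / δ)) ∂m ≤ 1 := by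
  simp only [luxNorm, iInf_lt_iff] at h
  obtain ⟨δ', hδ', h1, h2⟩ := h
  have hlt : δ' < δ := (ENNReal.ofReal_lt_ofReal_iff hδ).1 h2
  refine (lintegral_mono fun a => ENNReal.ofReal_le_ofReal (hΦ.mono (by positivity) ?_)).trans h1
  gcongr

theorem YoungFn.lintegral_smul_le {Φ : ℝ → ℝ} (hΦ : YoungFn Φ) {α : Type*} [MeasurableSpace α]
    {m : Measure α} {g : α → ℝ} (hg : ∀ a, 0 ≤ g a) {s : ℝ} (hs : 0 ≤ s) (hs1 : s ≤ 1) :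
    ∫⁻ a, ENNReal.ofReal (Φ (s * g a)) ∂m ≤ ENNReal.ofReal s * ∫⁻ a, ENNReal.ofReal (Φ (g a)) ∂m := by
  rw [← lintegral_const_mul' _ _ ENNReal.ofReal_ne_top]
  refine lintegral_mono fun a => ?_
  dsimp only
  rw [← ENNReal.ofReal_mul hs]
  exact ENNReal.ofReal_le_ofReal (hΦ.smul_le hs hs1 (hg a))

/-- The parameter `c` is chosen small to shrink the term of a bounded factor; the other factor is
then approximated at the fixed parameter `c⁻¹`. -/
theorem IsYoungPair.enorm_mul_le {Φ Ψ : ℝ → ℝ} (h : IsYoungPair Φ Ψ) {c : ℝ} (hc : 0 < c)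
    (z w : ℂ) :
    ‖z * w‖ₑ ≤ ENNReal.ofReal (Φ (c * ‖z‖)) + ENNReal.ofReal (Ψ (c⁻¹ * ‖w‖)) := by
  rw [← ENNReal.ofReal_add (h.left.nonneg _ (by positivity)) (h.right.nonneg _ (by positivity)),
    ← ofReal_norm, norm_mul]
  refine ENNReal.ofReal_le_ofReal ?_
  have := h.young (c * ‖z‖) (c⁻¹ * ‖w‖) (by positivity) (by positivity)
  calc ‖z‖ * ‖w‖ = c * ‖z‖ * (c⁻¹ * ‖w‖) := by field_simp
    _ ≤ _ := this

theorem IsYoungPair.lintegral_mul_le {Φ Ψ : ℝ → ℝ} (h : IsYoungPair Φ Ψ) {α : Type*}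
    [MeasurableSpace α] {m : Measure α} {u f : α → ℂ} (hu : AEStronglyMeasurable u m) {c : ℝ}
    (hc : 0 < c) :
    ∫⁻ a, ‖u a * f a‖ₑ ∂m ≤ ∫⁻ a, ENNReal.ofReal (Φ (c * ‖u a‖)) ∂m +
      ∫⁻ a, ENNReal.ofReal (Ψ (c⁻¹ * ‖f a‖)) ∂m := by
  rw [← lintegral_add_left' (h.left.aemeasurable_ofReal (hu.norm.const_mul c)
    fun a => by positivity)]
  exact lintegral_mono fun a => h.enorm_mul_le hc _ _

/-- A version of membership in the closure of `A` in terms of averages over balls. -/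
structure MX {d : ℕ} (Φ : ℝ → ℝ) (A : StarSubalgebra ℂ (Rd d →ᵇ ℂ)) (u : Rd d → ℂ) : Prop where
  meas : AEStronglyMeasurable u volume
  approx : ∀ κ c : ℝ, 0 < κ → 0 < c → ∃ w ∈ A, ∀ R, 1 ≤ R →
    ∫⁻ y, ENNReal.ofReal (Φ (c * ‖u y - w y‖)) ∂(ballMeas d R) ≤ ENNReal.ofReal κ

/-! ### Mean values on the closure of the supralgebra -/

section MX

variable {d : ℕ} {A : StarSubalgebra ℂ (Rd d →ᵇ ℂ)} {Φ Ψ : ℝ → ℝ} {u f : Rd d → ℂ}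

/-- The average over the ball of radius `R` is the normalized integral over the unit ball at the `ε`
with `e(ε) = 1/R`; one `w` close in `Ξ^Φ` therefore serves all `R ≥ 1`. -/
theorem MemX.mx {e : ℝ → ℝ} (he : IsScale e) (hΦ : YoungFn Φ) (h : MemX Φ e A u) : MX Φ A u := by
  refine ⟨h.1, fun κ c hκ hc => ?_⟩
  have hvol : volume (Metric.ball (0 : Rd d) 1) ≠ 0 := (Metric.measure_ball_pos volume _ one_pos).ne'
  have hvol' : volume (Metric.ball (0 : Rd d) 1) ≠ ∞ := measure_ball_lt_top.ne
  set b := volume.real (Metric.ball (0 : Rd d) 1) with hb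
  have hb0 : 0 < b := ENNReal.toReal_pos hvol hvol'
  -- By convexity the modular at parameter `c` is at most `s` times the modular at `c/s`, which is
  -- at most one; dividing by the volume `b` leaves `κ`.
  set s : ℝ := min 1 (κ * b) with hs
  have hs0 : 0 < s := by positivity
  -- Half of `s/c`, so that the Luxemburg norm is strictly below `s/c`.
  obtain ⟨w, hw, hx⟩ := h.2 (s / c / 2) (by positivity)
  refine ⟨w, hw, fun R hR => ?_⟩
  have hR0 : 0 < R := by linarith
  obtain ⟨ε, hε, heε⟩ := he.exists_eq_inv hR
  have h1 : luxNorm Φ (volume.restrict (Metric.ball (0 : Rd d) 1))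
      (fun x => u (R • x) - w (R • x)) < ENNReal.ofReal (s / c) := by
    refine lt_of_le_of_lt ?_ ((ENNReal.ofReal_lt_ofReal_iff (by positivity)).2
      (half_lt_self (show 0 < s / c by positivity)))
    refine le_trans ?_ hx
    have := le_iSup₂ (f := fun ε (_ : ε ∈ Ioc (0 : ℝ) 1) =>
      luxNorm Φ (volume.restrict (Metric.ball (0 : Rd d) 1))
        (fun x => (fun y => u y - w y) ((e ε)⁻¹ • x))) ε hε
    simpa only [heε, inv_inv, xiNorm] using this
  have h2 := lintegral_luxNorm_le hΦ (by positivity) h1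
  have h3 := hΦ.lintegral_smul_le (m := volume.restrict (Metric.ball (0 : Rd d) 1))
    (g := fun x => ‖u (R • x) - w (R • x)‖ / (s / c)) (fun x => by positivity) hs0.le
    (min_le_left _ _)
  have h4 := lintegral_ballMeas_comp_smul (d := d)
    (fun y => ENNReal.ofReal (Φ (c * ‖u y - w y‖))) hR0 1
  rw [mul_one] at h4
  rw [← h4, ballMeas, lintegral_smul_measure, smul_eq_mul]
  have h5 : ∫⁻ x in Metric.ball (0 : Rd d) 1, ENNReal.ofReal (Φ (c * ‖u (R • x) - w (R • x)‖)) ≤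
      ENNReal.ofReal s := by
    calc _ = ∫⁻ x in Metric.ball (0 : Rd d) 1,
          ENNReal.ofReal (Φ (s * (‖u (R • x) - w (R • x)‖ / (s / c)))) := by
          refine lintegral_congr fun x => ?_
          congr 2; field_simp
      _ ≤ ENNReal.ofReal s * 1 := h3.trans (by gcongr)
      _ = _ := mul_one _
  calc _ ≤ (volume (Metric.ball (0 : Rd d) 1))⁻¹ * ENNReal.ofReal (κ * b) := by
        gcongr
        exact h5.trans (ENNReal.ofReal_le_ofReal (min_le_right _ _))
    _ = _ := by
      rw [ENNReal.ofReal_mul hκ.le, hb, Measure.real, ENNReal.ofReal_toReal hvol', mul_comm,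
        mul_assoc, ENNReal.mul_inv_cancel hvol hvol', mul_one]

theorem MX.of_mem (hΦ : YoungFn Φ) {w : Rd d →ᵇ ℂ} (hw : w ∈ A) : MX Φ A w :=
  ⟨w.continuous.aestronglyMeasurable, fun κ c _ _ => ⟨w, hw, fun R _ => by simp [hΦ.zero]⟩⟩

theorem MX.congr (h : MX Φ A u) (huf : u =ᵐ[volume] f) : MX Φ A f := by
  refine ⟨h.meas.congr huf, fun κ c hκ hc => ?_⟩
  obtain ⟨w, hw, hR⟩ := h.approx κ c hκ hc
  refine ⟨w, hw, fun R h1 => le_trans (le_of_eq ?_) (hR R h1)⟩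
  refine lintegral_congr_ae ((ballMeas_ac R).ae_le ?_)
  filter_upwards [huf] with y hy
  rw [hy]

theorem MX.sub_mem (h : MX Φ A u) {v : Rd d →ᵇ ℂ} (hv : v ∈ A) : MX Φ A (fun y => u y - v y) := by
  refine ⟨h.meas.sub v.continuous.aestronglyMeasurable, fun κ c hκ hc => ?_⟩
  obtain ⟨w, hw, hR⟩ := h.approx κ c hκ hc
  exact ⟨w - v, _root_.sub_mem hw hv, by simpa using hR⟩

theorem MX.const_mul (hΦ : YoungFn Φ) (h : MX Φ A u) (a : ℂ) : MX Φ A (fun y => a * u y) := by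
  refine ⟨h.meas.const_mul a, fun κ c hκ hc => ?_⟩
  obtain ⟨w, hw, hR⟩ := h.approx κ (c * (‖a‖ + 1)) hκ (by positivity)
  refine ⟨a • w, A.smul_mem hw a, fun R h1 => (lintegral_mono fun y => ?_).trans (hR R h1)⟩
  refine ENNReal.ofReal_le_ofReal (hΦ.mono (by positivity) ?_)
  simp only [BoundedContinuousFunction.coe_smul, smul_eq_mul]
  rw [← mul_sub, norm_mul, mul_assoc]
  gcongr
  linarith

theorem MX.aemeasurable (h : MX Φ A u) (hΦ : YoungFn Φ) {c : ℝ} (hc : 0 ≤ c) (R : ℝ) :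
    AEMeasurable (fun y => ENNReal.ofReal (Φ (c * ‖u y‖))) (ballMeas d R) :=
  (hΦ.aemeasurable_ofReal (h.meas.norm.const_mul c) fun a => by positivity).mono_ac
    (ballMeas_ac R)

theorem MX.exists_bound (h : MX Φ A u) (hΦ : YoungFn Φ) {c : ℝ} (hc : 0 < c) :
    ∃ K : ℝ, 0 ≤ K ∧ ∀ R, 1 ≤ R →
      ∫⁻ y, ENNReal.ofReal (Φ (c * ‖u y‖)) ∂(ballMeas d R) ≤ ENNReal.ofReal K := by
  obtain ⟨w, hw, hR⟩ := h.approx 1 (2 * c) one_pos (by positivity)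
  have hw0 := hΦ.nonneg (2 * c * ‖w‖) (by positivity)
  refine ⟨1 + Φ (2 * c * ‖w‖), by positivity, fun R h1 => ?_⟩
  have := isProbabilityMeasure_ballMeas (d := d) (show 0 < R by linarith)
  rw [ENNReal.ofReal_add zero_le_one hw0]
  have h2 : ∫⁻ _, ENNReal.ofReal (Φ (2 * c * ‖w‖)) ∂(ballMeas d R) =
    ENNReal.ofReal (Φ (2 * c * ‖w‖)) := by simp
  rw [← h2]
  refine le_trans ?_ (add_le_add_left (hR R h1) _)
  rw [← lintegral_add_right _ measurable_const]
  refine lintegral_mono fun y => ?_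
  have h3 := hΦ.nonneg (2 * c * ‖u y - w y‖) (by positivity)
  rw [← ENNReal.ofReal_add h3 hw0]
  refine ENNReal.ofReal_le_ofReal ?_
  have h4 : Φ (c * ‖u y‖) ≤ Φ (c * ‖u y - w y‖ + c * ‖w‖) := by
    refine hΦ.mono (by positivity) ?_
    rw [← mul_add]
    gcongr
    calc ‖u y‖ = ‖(u y - w y) + w y‖ := by ring_nf
      _ ≤ ‖u y - w y‖ + ‖w y‖ := norm_add_le _ _
      _ ≤ _ := by gcongr; exact w.norm_coe_le_norm y
  have h5 := hΦ.add_le_half (a := c * ‖u y - w y‖) (b := c * ‖w‖) (by positivity) (by positivity)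
  rw [← mul_assoc, ← mul_assoc] at h5
  linarith

theorem MX.exists_small (h : MX Φ A u) (hΦ : YoungFn Φ) {κ : ℝ} (hκ : 0 < κ) :
    ∃ c : ℝ, 0 < c ∧ ∀ R, 1 ≤ R →
      ∫⁻ y, ENNReal.ofReal (Φ (c * ‖u y‖)) ∂(ballMeas d R) ≤ ENNReal.ofReal κ := by
  obtain ⟨K, hK0, hK⟩ := h.exists_bound hΦ one_pos
  refine ⟨min 1 (κ / (K + 1)), by positivity, fun R hR => ?_⟩
  have h1 := hΦ.lintegral_smul_le (m := ballMeas d R) (g := fun y => 1 * ‖u y‖)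
    (fun y => by positivity) (s := min 1 (κ / (K + 1))) (by positivity) (min_le_left _ _)
  simp only [one_mul] at h1 hK
  refine h1.trans ?_
  calc _ ≤ ENNReal.ofReal (κ / (K + 1)) * ENNReal.ofReal (K + 1) := by
        gcongr
        · exact min_le_right _ _
        · exact (hK R hR).trans (ENNReal.ofReal_le_ofReal (by linarith))
    _ = _ := by
      rw [← ENNReal.ofReal_mul (by positivity)]
      congr 1; field_simp

theorem MX.integrable_phi (h : MX Φ A u) (hΦ : YoungFn Φ) {c : ℝ} (hc : 0 < c) {R : ℝ}
    (hR : 1 ≤ R) : Integrable (fun y => Φ (c * ‖u y‖)) (ballMeas d R) := by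
  obtain ⟨K, hK0, hK⟩ := h.exists_bound hΦ hc
  refine ⟨(hΦ.aestronglyMeasurable_comp (h.meas.norm.const_mul c)
    fun a => by positivity).mono_ac (ballMeas_ac R), ?_⟩
  rw [hasFiniteIntegral_iff_ofReal (Eventually.of_forall fun y => hΦ.nonneg _ (by positivity))]
  exact (hK R hR).trans_lt ENNReal.ofReal_lt_top

theorem MX.integrable_mul (hP : IsYoungPair Φ Ψ) (hu : MX Φ A u) (hf : MX Ψ A f) {R : ℝ}
    (hR : 1 ≤ R) : Integrable (fun y => u y * f y) (ballMeas d R) := by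
  obtain ⟨K, hK0, hK⟩ := hu.exists_bound hP.left one_pos
  obtain ⟨L, hL0, hL⟩ := hf.exists_bound hP.right one_pos
  refine ⟨(hu.meas.mul hf.meas).mono_ac (ballMeas_ac R), ?_⟩
  refine (hP.lintegral_mul_le (hu.meas.mono_ac (ballMeas_ac R)) one_pos).trans_lt ?_
  rw [inv_one]
  exact ENNReal.add_lt_top.2 ⟨(hK R hR).trans_lt ENNReal.ofReal_lt_top,
    (hL R hR).trans_lt ENNReal.ofReal_lt_top⟩

variable {e : ℝ → ℝ}

/-- The averages of `u f` are approximated by those of `w v` with `w, v ∈ A`, through `u f - w v =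
(u - w) f + w (f - v)`; the product `w v` lies in `A` and has a mean. -/
theorem MX.exists_mean_mul (hA : IsHSupralgebra e A) (he : IsScale e) (hP : IsYoungPair Φ Ψ)
    (hu : MX Φ A u) (hf : MX Ψ A f) : ∃ m, HasBallMean (fun y => u y * f y) m := by
  refine exists_hasBallMean_of_approx fun η hη => ?_
  -- The order matters: `c` depends on `f`, then `w` is chosen at `c⁻¹`, then `c'` depends on `w`,
  -- then `v` is chosen at `c'⁻¹`.
  obtain ⟨c, hc, h1⟩ := hf.exists_small hP.right (κ := η / 4) (by positivity)
  obtain ⟨w, hw, h2⟩ := hu.approx (η / 4) c⁻¹ (by positivity) (by positivity)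
  obtain ⟨c', hc', h3⟩ := (MX.of_mem (A := A) hP.left hw).exists_small hP.left
    (κ := η / 4) (by positivity)
  obtain ⟨v, hv, h4⟩ := hf.approx (η / 4) c'⁻¹ (by positivity) (by positivity)
  obtain ⟨m, hm⟩ := hA.exists_hasBallMean he (mul_mem hw hv)
  refine ⟨_, m, hm, ?_⟩
  filter_upwards [eventually_ge_atTop 1] with R hR
  refine norm_integral_sub_le_of_lintegral (hu.integrable_mul hP hf hR)
    ((MX.of_mem hP.left hw).integrable_mul hP (MX.of_mem hP.right hv) hR) hη.le ?_
  have hmw : AEStronglyMeasurable (fun y => u y - w y) (ballMeas d R) :=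
    (hu.sub_mem hw).meas.mono_ac (ballMeas_ac R)
  have hww : AEStronglyMeasurable w (ballMeas d R) := w.continuous.aestronglyMeasurable
  calc ∫⁻ y, ‖u y * f y - (w * v) y‖ₑ ∂(ballMeas d R)
      ≤ ∫⁻ y, (‖(u y - w y) * f y‖ₑ + ‖w y * (f y - v y)‖ₑ) ∂(ballMeas d R) := by
        refine lintegral_mono fun y => le_trans (le_of_eq ?_) (enorm_add_le _ _)
        congr 1
        simp only [BoundedContinuousFunction.coe_mul, Pi.mul_apply]
        ring
    _ = ∫⁻ y, ‖(u y - w y) * f y‖ₑ ∂(ballMeas d R) +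
          ∫⁻ y, ‖w y * (f y - v y)‖ₑ ∂(ballMeas d R) :=
        lintegral_add_left' (hmw.mul (hf.meas.mono_ac (ballMeas_ac R))).enorm _
    _ ≤ (ENNReal.ofReal (η / 4) + ENNReal.ofReal (η / 4)) +
          (ENNReal.ofReal (η / 4) + ENNReal.ofReal (η / 4)) := by
        gcongr
        · refine (hP.lintegral_mul_le hmw (c := c⁻¹) (by positivity)).trans ?_
          rw [inv_inv]
          exact add_le_add (h2 R hR) (h1 R hR)
        · exact (hP.lintegral_mul_le hww hc').trans (add_le_add (h3 R hR) (h4 R hR))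
    _ = ENNReal.ofReal η := by
        rw [← ENNReal.ofReal_add (by positivity) (by positivity),
          ← ENNReal.ofReal_add (by positivity) (by positivity)]
        congr 1; ring

/-- For `w ∈ A` the function `Φ(c|w|)` is continuous in `|w|`, hence has a mean; modular continuity
of `Φ` extends this to the closure. -/
theorem MX.exists_mean_phi (hA : IsHSupralgebra e A) (he : IsScale e) (hΦ : YoungFn Φ)
    (hu : MX Φ A u) {c : ℝ} (hc : 0 < c) :
    ∃ m, 0 ≤ m ∧ HasBallMean (fun y => Φ (c * ‖u y‖)) m := by
  suffices h : ∃ m, HasBallMean (fun y => Φ (c * ‖u y‖)) m by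
    obtain ⟨m, hm⟩ := h
    exact ⟨m, ge_of_tendsto' hm fun R => integral_nonneg fun y => hΦ.nonneg _ (by positivity), hm⟩
  refine exists_hasBallMean_of_approx fun η hη => ?_
  obtain ⟨K, hK0, hK⟩ := hu.exists_bound hΦ hc
  -- `K` bounds the modular of `u` uniformly in `R`, so the relative error contributes at most
  -- `η/2`; then `w` is chosen according to `C`.
  obtain ⟨C, hC0, hC⟩ := hΦ.exists_abs_sub_le (η := η / 2 / (K + 1)) (by positivity)
  obtain ⟨w, hw, h2⟩ := hu.approx (η / 2 / (C + 1)) c (by positivity) hc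
  obtain ⟨m, hm⟩ := hA.exists_hasBallMean_comp_norm he hw
    (hΦ.continuous_max.comp (continuous_const_mul c))
  have heq : ∀ y, Φ (max (c * ‖w y‖) 0) = Φ (c * ‖w y‖) := fun y => by
    rw [max_eq_left (by positivity)]
  simp only [Function.comp, heq] at hm
  refine ⟨_, m, hm, ?_⟩
  filter_upwards [eventually_ge_atTop 1] with R hR
  refine norm_integral_sub_le_of_lintegral (hu.integrable_phi hΦ hc hR)
    ((MX.of_mem hΦ hw).integrable_phi hΦ hc hR) hη.le ?_
  calc ∫⁻ y, ‖Φ (c * ‖u y‖) - Φ (c * ‖w y‖)‖ₑ ∂(ballMeas d R)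
      ≤ ∫⁻ y, (ENNReal.ofReal (η / 2 / (K + 1)) * ENNReal.ofReal (Φ (c * ‖u y‖)) +
          ENNReal.ofReal C * ENNReal.ofReal (Φ (c * ‖u y - w y‖))) ∂(ballMeas d R) := by
        refine lintegral_mono fun y => ?_
        rw [← ENNReal.ofReal_mul (by positivity), ← ENNReal.ofReal_mul hC0,
          ← ENNReal.ofReal_add (mul_nonneg (by positivity) (hΦ.nonneg _ (by positivity)))
            (mul_nonneg hC0 (hΦ.nonneg _ (by positivity))), ← ofReal_norm, Real.norm_eq_abs]
        refine ENNReal.ofReal_le_ofReal ((hC _ _ (by positivity) (by positivity)).trans ?_)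
        gcongr
        refine hΦ.mono (abs_nonneg _) ?_
        rw [← mul_sub, abs_mul, abs_of_pos hc]
        gcongr
        exact abs_norm_sub_norm_le _ _
    _ = ENNReal.ofReal (η / 2 / (K + 1)) * ∫⁻ y, ENNReal.ofReal (Φ (c * ‖u y‖)) ∂(ballMeas d R) +
          ENNReal.ofReal C * ∫⁻ y, ENNReal.ofReal (Φ (c * ‖u y - w y‖)) ∂(ballMeas d R) := by
        rw [lintegral_add_left' ((hu.aemeasurable hΦ hc.le R).const_mul _),
          lintegral_const_mul' _ _ ENNReal.ofReal_ne_top,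
          lintegral_const_mul' _ _ ENNReal.ofReal_ne_top]
    _ ≤ ENNReal.ofReal (η / 2 / (K + 1)) * ENNReal.ofReal (K + 1) +
          ENNReal.ofReal (C + 1) * ENNReal.ofReal (η / 2 / (C + 1)) := by
        gcongr
        · exact (hK R hR).trans (ENNReal.ofReal_le_ofReal (by linarith))
        · linarith
        · exact h2 R hR
    _ = ENNReal.ofReal η := by
        rw [← ENNReal.ofReal_mul (by positivity), ← ENNReal.ofReal_mul (by positivity),
          ← ENNReal.ofReal_add (by positivity) (by positivity)]
        congr 1; field_simp; ring

theorem MX.hasBallMean_mul (hA : IsHSupralgebra e A) (he : IsScale e) (hP : IsYoungPair Φ Ψ)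
    (hu : MX Φ A u) (hf : MX Ψ A f) :
    HasBallMean (fun y => u y * f y) (mean fun y => u y * f y) := by
  obtain ⟨m, hm⟩ := hu.exists_mean_mul hA he hP hf
  rwa [hm.mean_eq]

theorem MX.hasBallMean_phi (hA : IsHSupralgebra e A) (he : IsScale e) (hΦ : YoungFn Φ)
    (hu : MX Φ A u) {c : ℝ} (hc : 0 < c) :
    HasBallMean (fun y => Φ (c * ‖u y‖)) (mean fun y => Φ (c * ‖u y‖)) := by
  obtain ⟨m, -, hm⟩ := hu.exists_mean_phi hA he hΦ hc
  rwa [hm.mean_eq]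

theorem MX.mean_phi_nonneg (hA : IsHSupralgebra e A) (he : IsScale e) (hΦ : YoungFn Φ)
    (hu : MX Φ A u) {c : ℝ} (hc : 0 < c) : 0 ≤ mean fun y => Φ (c * ‖u y‖) := by
  obtain ⟨m, h0, hm⟩ := hu.exists_mean_phi hA he hΦ hc
  rwa [hm.mean_eq]

/-- Young's inequality for mean values. -/
theorem MX.norm_mean_mul_sub_le (hA : IsHSupralgebra e A) (he : IsScale e) (hP : IsYoungPair Φ Ψ)
    (hu : MX Φ A u) {g : Rd d → ℂ} (hf : MX Ψ A f) (hg : MX Ψ A g) {c κ : ℝ} (hc : 0 < c)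
    (hκ : 0 ≤ κ) (h : ∀ᶠ R in atTop,
      ∫⁻ y, ENNReal.ofReal (Ψ (c⁻¹ * ‖f y - g y‖)) ∂(ballMeas d R) ≤ ENNReal.ofReal κ) :
    ‖(mean fun y => u y * f y) - mean fun y => u y * g y‖ ≤
      (mean fun y => Φ (c * ‖u y‖)) + κ := by
  have h1 := (hu.hasBallMean_mul hA he hP hf).sub (hu.hasBallMean_mul hA he hP hg)
  have h2 := (hu.hasBallMean_phi hA he hP.left hc).add_const κ
  refine le_of_tendsto_of_tendsto h1.norm h2 ?_
  filter_upwards [h, eventually_ge_atTop 1] with R hRκ hR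
  have hint := hu.integrable_phi hP.left hc hR
  have hnn : 0 ≤ ∫ y, Φ (c * ‖u y‖) ∂(ballMeas d R) :=
    integral_nonneg fun y => hP.left.nonneg _ (by positivity)
  refine norm_integral_sub_le_of_lintegral (hu.integrable_mul hP hf hR)
    (hu.integrable_mul hP hg hR) (by positivity) ?_
  rw [ENNReal.ofReal_add hnn hκ, ofReal_integral_eq_lintegral_ofReal hint
    (Eventually.of_forall fun y => hP.left.nonneg _ (by positivity))]
  simp only [← mul_sub]
  refine (hP.lintegral_mul_le (hu.meas.mono_ac (ballMeas_ac R)) hc).trans ?_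
  gcongr

theorem MX.tendsto_mean_phi_zero (hA : IsHSupralgebra e A) (he : IsScale e) (hΦ : YoungFn Φ)
    {z : ℕ → Rd d → ℂ} (hz : ∀ n, MX Φ A (z n))
    (h : Tendsto (fun n => meanLuxNorm Φ (z n)) atTop (𝓝 0)) {c : ℝ} (hc : 0 < c) :
    Tendsto (fun n => mean fun y => Φ (c * ‖z n y‖)) atTop (𝓝 0) := by
  rw [Metric.tendsto_nhds]
  intro η hη
  -- A seminorm below `s/c` yields `δ` with `c ≤ s/δ` and `M(Φ(|z|/δ)) ≤ 1`; convexity then bounds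
  -- `M(Φ(c|z|))` by `s`.
  set s : ℝ := min 1 (η / 2) with hs
  have hs0 : 0 < s := by positivity
  filter_upwards [h.eventually (gt_mem_nhds (show 0 < ENNReal.ofReal (s / c) by
    rw [ENNReal.ofReal_pos]; positivity))] with n hn
  simp only [meanLuxNorm, iInf_lt_iff] at hn
  obtain ⟨δ, hδ, h1, h2⟩ := hn
  have hlt : δ < s / c := (ENNReal.ofReal_lt_ofReal_iff (by positivity)).1 h2
  have h3 := (hz n).hasBallMean_phi hA he hΦ hc
  have h4 := (hz n).hasBallMean_phi hA he hΦ (c := δ⁻¹) (by positivity)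
  have heq : (fun y => Φ (δ⁻¹ * ‖z n y‖)) = fun y => Φ (‖z n y‖ / δ) := by
    ext y; rw [div_eq_inv_mul]
  rw [heq] at h4
  have h5 : (mean fun y => Φ (c * ‖z n y‖)) ≤ s * mean fun y => Φ (‖z n y‖ / δ) := by
    refine le_of_tendsto_of_tendsto h3 (h4.const_mul s) ?_
    filter_upwards [eventually_ge_atTop 1] with R hR
    rw [← integral_const_mul]
    refine integral_mono ((hz n).integrable_phi hΦ hc hR) ?_ fun y => ?_
    · have h6 := ((hz n).integrable_phi hΦ (c := δ⁻¹) (by positivity) hR).const_mul s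
      simpa only [div_eq_inv_mul] using h6
    · refine le_trans (hΦ.mono (by positivity) ?_) (hΦ.smul_le hs0.le (min_le_left _ _)
        (by positivity))
      have : c ≤ s / δ := by
        rw [le_div_iff₀ hδ]; rw [lt_div_iff₀ hc] at hlt; linarith
      calc c * ‖z n y‖ ≤ s / δ * ‖z n y‖ := by gcongr
        _ = _ := by ring
  rw [Real.dist_0_eq_abs, abs_of_nonneg ((hz n).mean_phi_nonneg hA he hΦ hc)]
  calc _ ≤ s * mean fun y => Φ (‖z n y‖ / δ) := h5
    _ ≤ s * 1 := by gcongr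
    _ ≤ η / 2 := by rw [mul_one]; exact min_le_right _ _
    _ < η := half_lt_self hη

theorem MX.tendsto_mean_phi (hA : IsHSupralgebra e A) (he : IsScale e) (hΦ : YoungFn Φ)
    (hu : MX Φ A u) {s : ℕ → Rd d →ᵇ ℂ} (hs : ∀ n, s n ∈ A)
    (h : Tendsto (fun n => meanLuxNorm Φ (fun y => u y - s n y)) atTop (𝓝 0)) {c : ℝ}
    (hc : 0 < c) :
    Tendsto (fun n => mean fun y => Φ (c * ‖s n y‖)) atTop (𝓝 (mean fun y => Φ (c * ‖u y‖))) := by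
  have h0 := MX.tendsto_mean_phi_zero hA he hΦ (fun n => hu.sub_mem (hs n)) h hc
  have hm0 := hu.mean_phi_nonneg hA he hΦ hc
  set m := mean fun y => Φ (c * ‖u y‖) with hm
  rw [Metric.tendsto_nhds]
  intro η hη
  obtain ⟨C, hC0, hC⟩ := hΦ.exists_abs_sub_le (η := η / 2 / (m + 1)) (by positivity)
  filter_upwards [h0.eventually (gt_mem_nhds (show 0 < η / 2 / (C + 1) by positivity))] with n hn
  have h1 := hu.hasBallMean_phi hA he hΦ hc
  have h2 := (MX.of_mem hΦ (hs n)).hasBallMean_phi hA he hΦ hc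
  have h3 := (hu.sub_mem (hs n)).hasBallMean_phi hA he hΦ hc
  have h4 : |m - mean fun y => Φ (c * ‖s n y‖)| ≤
      η / 2 / (m + 1) * m + C * mean fun y => Φ (c * ‖u y - s n y‖) := by
    refine le_of_tendsto_of_tendsto (h1.sub h2).abs ((h1.const_mul _).add (h3.const_mul C)) ?_
    filter_upwards [eventually_ge_atTop 1] with R hR
    have i1 := hu.integrable_phi hΦ hc hR
    have i2 := (MX.of_mem hΦ (hs n)).integrable_phi hΦ hc hR
    have i3 := (hu.sub_mem (hs n)).integrable_phi hΦ hc hR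
    rw [← integral_sub i1 i2, ← integral_const_mul, ← integral_const_mul,
      ← integral_add (i1.const_mul _) (i3.const_mul _)]
    refine (abs_integral_le_integral_abs).trans (integral_mono (i1.sub i2).abs
      ((i1.const_mul _).add (i3.const_mul _)) fun y => ?_)
    refine (hC _ _ (by positivity) (by positivity)).trans ?_
    gcongr
    refine hΦ.mono (abs_nonneg _) ?_
    rw [← mul_sub, abs_mul, abs_of_pos hc]
    gcongr
    exact abs_norm_sub_norm_le _ _
  rw [dist_comm, Real.dist_eq]
  have h5 : η / 2 / (m + 1) * m ≤ η / 2 := by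
    calc _ ≤ η / 2 / (m + 1) * (m + 1) := by gcongr; linarith
      _ = _ := by field_simp
  have h6 : C * (mean fun y => Φ (c * ‖u y - s n y‖)) < η / 2 := by
    have h7 := (hu.sub_mem (hs n)).mean_phi_nonneg hA he hΦ hc
    calc _ ≤ (C + 1) * (mean fun y => Φ (c * ‖u y - s n y‖)) := by gcongr; linarith
      _ < (C + 1) * (η / 2 / (C + 1)) := by gcongr
      _ = _ := by field_simp
  linarith

theorem MX.tendsto_mean_mul (hA : IsHSupralgebra e A) (he : IsScale e) (hP : IsYoungPair Φ Ψ)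
    (hu : MX Φ A u) {s : ℕ → Rd d →ᵇ ℂ} (hs : ∀ n, s n ∈ A)
    (h : Tendsto (fun n => meanLuxNorm Φ (fun y => u y - s n y)) atTop (𝓝 0)) (hf : MX Ψ A f) :
    Tendsto (fun n => mean fun y => s n y * f y) atTop (𝓝 (mean fun y => u y * f y)) := by
  rw [Metric.tendsto_nhds]
  intro η hη
  obtain ⟨c, hc, h1⟩ := hf.exists_small hP.right (κ := η / 2) (by positivity)
  have h0 := MX.tendsto_mean_phi_zero hA he hP.left (fun n => hu.sub_mem (hs n)) h
    (c := c⁻¹) (by positivity)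
  filter_upwards [h0.eventually (gt_mem_nhds (show 0 < η / 2 by positivity))] with n hn
  have hsn := MX.of_mem hP.left (hs n)
  -- Comparing `f` with the zero function bounds the mean of `(u - sₙ) f` itself.
  have h3 := (hu.sub_mem (hs n)).norm_mean_mul_sub_le hA he hP (g := fun _ => 0) hf
    (MX.of_mem (w := 0) hP.right (zero_mem A)) (c := c⁻¹) (κ := η / 2) (by positivity)
    (by positivity) (by
      filter_upwards [eventually_ge_atTop 1] with R hR
      simpa using h1 R hR)
  have h4 : (mean fun y => (u y - s n y) * f y) =
      (mean fun y => u y * f y) - mean fun y => s n y * f y := by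
    refine HasBallMean.mean_eq ?_
    refine ((hu.hasBallMean_mul hA he hP hf).sub (hsn.hasBallMean_mul hA he hP hf)).congr' ?_
    filter_upwards [eventually_ge_atTop 1] with R hR
    rw [← integral_sub (hu.integrable_mul hP hf hR) (hsn.integrable_mul hP hf hR)]
    simp only [sub_mul]
  have h5 : (mean fun y => (u y - s n y) * (0 : ℂ)) = 0 := by
    refine HasBallMean.mean_eq ?_
    simp [HasBallMean]
  rw [h4, h5, sub_zero] at h3
  rw [dist_comm, dist_eq_norm]
  linarith

end MX

/-! ### Measurability of mean values in `(x, ω)` -/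

section Measurability

variable {d : ℕ} {A : StarSubalgebra ℂ (Rd d →ᵇ ℂ)} {Φ Ψ : ℝ → ℝ} {e : ℝ → ℝ}
  {Ω : Type*} [MeasurableSpace Ω] {μ : Measure Ω} {Q : Set (Rd d)} {u : Rd d → Ω → Rd d → ℂ}

/-- Along the approximating `A`-valued simple functions the mean takes finitely many values, and it
converges almost everywhere because it is continuous for the seminorm. -/
theorem MemOrliczX.aestronglyMeasurable_mean_mul (hA : IsHSupralgebra e A) (he : IsScale e)
    (hP : IsYoungPair Φ Ψ) (hu : MemOrliczX Q μ Φ e A u) {f : Rd d → ℂ} (hf : MX Ψ A f) :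
    AEStronglyMeasurable (fun p : Rd d × Ω => mean fun y => u p.1 p.2 y * f y) (measQ Q μ) := by
  obtain ⟨s, hs, hlim⟩ := hu.measurable
  refine aestronglyMeasurable_of_tendsto_ae atTop
    (f := fun n p => (s n).map (fun w : Rd d →ᵇ ℂ => mean fun y => w y * f y) p)
    (fun n => (SimpleFunc.stronglyMeasurable _).aestronglyMeasurable) ?_
  filter_upwards [hlim, hu.mem] with p hp hm
  exact (hm.mx he hP.left).tendsto_mean_mul hA he hP (fun n => hs n p) hp hf

theorem MemOrliczX.aestronglyMeasurable_mean_phi (hA : IsHSupralgebra e A) (he : IsScale e)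
    (hΦ : YoungFn Φ) (hu : MemOrliczX Q μ Φ e A u) {c : ℝ} (hc : 0 < c) :
    AEStronglyMeasurable (fun p : Rd d × Ω => mean fun y => Φ (c * ‖u p.1 p.2 y‖))
      (measQ Q μ) := by
  obtain ⟨s, hs, hlim⟩ := hu.measurable
  refine aestronglyMeasurable_of_tendsto_ae atTop
    (f := fun n p => (s n).map (fun w : Rd d →ᵇ ℂ => mean fun y => Φ (c * ‖w y‖)) p)
    (fun n => (SimpleFunc.stronglyMeasurable _).aestronglyMeasurable) ?_
  filter_upwards [hlim, hu.mem] with p hp hm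
  exact (hm.mx he hΦ).tendsto_mean_phi hA he hΦ (fun n => hs n p) hp hc

end Measurability

/-! ### The measure-preserving shift `(x, ω) ↦ (x, T(rx)ω)` -/

section Shift

variable {d : ℕ} {Ω : Type*} [MeasurableSpace Ω] {μ : Measure Ω}

/-- The transformation `(x, ω) ↦ (x, T(r x) ω)`. -/
def DynSystem.shift (T : DynSystem d μ) (r : ℝ) (p : Rd d × Ω) : Rd d × Ω :=
  (p.1, T.toFun (r • p.1) p.2)

/-- The action is jointly measurable only for the Lebesgue `σ`-algebra, hence null measurability.
Since `r ≠ 0`, the dilation pulls null sets back to null sets. -/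
theorem nullMeasurable_dynSystem [SFinite μ] (T : DynSystem d μ) {r : ℝ} (hr : r ≠ 0)
    (Q : Set (Rd d)) :
    NullMeasurable (fun p : Rd d × Ω => T.toFun (r • p.1) p.2) (measQ Q μ) := by
  have h1 : @Measurable (NullMeasurableSpace (Rd d × Ω) (measQ Q μ))
      (NullMeasurableSpace (Rd d) (volume : Measure (Rd d)) × Ω) _ _
      (fun p : Rd d × Ω => (r • p.1, p.2)) := by
    refine Measurable.prodMk (fun s hs => ?_) (fun s hs => ?_)
    · have hs' : @NullMeasurableSet (Rd d) _ s volume := hs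
      have h2 : NullMeasurableSet ((fun x : Rd d => r • x) ⁻¹' s) volume :=
        hs'.preimage (Measure.quasiMeasurePreserving_smul volume hr)
      exact (h2.mono_ac (Measure.absolutelyContinuous_restrict (s := Q))).preimage
        Measure.quasiMeasurePreserving_fst
    · exact NullMeasurableSet.preimage (μa := measQ Q μ) (μb := μ)
        hs.nullMeasurableSet Measure.quasiMeasurePreserving_snd
  exact T.measurable_joint.comp h1

theorem DynSystem.nullMeasurable_shift [SFinite μ] (T : DynSystem d μ) {r : ℝ} (hr : r ≠ 0)
    (Q : Set (Rd d)) : NullMeasurable (T.shift r) (measQ Q μ) := by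
  have h1 := (nullMeasurable_dynSystem T hr Q).measurable'
  have h2 : NullMeasurable (Prod.fst : Rd d × Ω → Rd d) (measQ Q μ) :=
    measurable_fst.nullMeasurable
  exact Measurable.prodMk h2.measurable' h1

theorem aemeasurable_of_nullMeasurable_comp {α β : Type*} [MeasurableSpace α] [MeasurableSpace β]
    {m : Measure α} {S : α → β} (hS : NullMeasurable S m) {h : β → ℝ≥0∞} (hh : Measurable h) :
    AEMeasurable (fun a => h (S a)) m :=
  ((aestronglyMeasurable_iff_nullMeasurable_separable (f := h ∘ S)).2
    ⟨hh.comp_nullMeasurable hS, univ, TopologicalSpace.IsSeparable.of_separableSpace _,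
      by simp⟩).aemeasurable

/-- By Fubini: the shift fixes `x`, and on the slice over `x` it is `T(rx)`, which preserves `μ`. -/
theorem DynSystem.measure_preimage_shift [SFinite μ] (T : DynSystem d μ) {r : ℝ} (hr : r ≠ 0)
    (Q : Set (Rd d)) {B : Set (Rd d × Ω)} (hB : MeasurableSet B) :
    measQ Q μ (T.shift r ⁻¹' B) = measQ Q μ B := by
  have h1 : NullMeasurableSet (T.shift r ⁻¹' B) (measQ Q μ) := T.nullMeasurable_shift hr Q hB
  have h0 : AEMeasurable ((T.shift r ⁻¹' B).indicator (1 : Rd d × Ω → ℝ≥0∞)) (measQ Q μ) :=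
    aemeasurable_one.indicator₀ h1
  rw [← lintegral_indicator_one₀ h1, lintegral_prod _ h0,
    Measure.prod_apply hB]
  refine lintegral_congr fun x => ?_
  have h2 : ∀ ω, (T.shift r ⁻¹' B).indicator (1 : Rd d × Ω → ℝ≥0∞) (x, ω) =
      (T.toFun (r • x) ⁻¹' (Prod.mk x ⁻¹' B)).indicator 1 ω := fun ω => rfl
  simp only [h2]
  have h3 := (T.measurePreserving (r • x)).measurable (measurable_prodMk_left (x := x) hB)
  rw [lintegral_indicator_one h3,
    (T.measurePreserving (r • x)).measure_preimage (measurable_prodMk_left hB).nullMeasurableSet]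

theorem DynSystem.ae_shift [SFinite μ] (T : DynSystem d μ) {r : ℝ} (hr : r ≠ 0)
    {Q : Set (Rd d)} {P : Rd d × Ω → Prop} (h : ∀ᵐ p ∂(measQ Q μ), P p) :
    ∀ᵐ p ∂(measQ Q μ), P (T.shift r p) := by
  have h1 : measQ Q μ (toMeasurable (measQ Q μ) {p | ¬ P p}) = 0 := by
    rw [measure_toMeasurable]; exact h
  rw [← T.measure_preimage_shift hr Q (measurableSet_toMeasurable _ _)] at h1
  refine measure_mono_null (fun p hp => ?_) h1
  exact subset_toMeasurable (measQ Q μ) {p | ¬ P p} (show ¬ P (T.shift r p) from hp)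

/-- The shift being only null measurable, the identity is built up from indicators by additivity and
monotone limits. -/
theorem DynSystem.lintegral_shift_of_measurable [SFinite μ] (T : DynSystem d μ) {r : ℝ}
    (hr : r ≠ 0) (Q : Set (Rd d)) {h : Rd d × Ω → ℝ≥0∞} (hh : Measurable h) :
    ∫⁻ p, h (T.shift r p) ∂(measQ Q μ) = ∫⁻ p, h p ∂(measQ Q μ) := by
  have hS := T.nullMeasurable_shift hr Q
  refine Measurable.ennreal_induction (motive := fun h =>
    ∫⁻ p, h (T.shift r p) ∂(measQ Q μ) = ∫⁻ p, h p ∂(measQ Q μ)) ?_ ?_ ?_ hh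
  · intro c s hs
    rw [lintegral_indicator_const hs, ← T.measure_preimage_shift hr Q hs,
      ← lintegral_indicator_const₀ (hS hs)]
    rfl
  · intro f g _ hf hg hf' hg'
    simp only [Pi.add_apply]
    rw [lintegral_add_left' (aemeasurable_of_nullMeasurable_comp hS hf), lintegral_add_left hf,
      hf', hg']
  · intro f hf hmono ih
    dsimp only
    rw [lintegral_iSup' (fun n => aemeasurable_of_nullMeasurable_comp hS (hf n))
      (Eventually.of_forall fun p i j hij => hmono hij _), lintegral_iSup hf hmono]
    simp only [ih]

theorem DynSystem.aemeasurable_shift [SFinite μ] (T : DynSystem d μ) {r : ℝ} (hr : r ≠ 0)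
    {Q : Set (Rd d)} {h : Rd d × Ω → ℝ≥0∞} (hh : AEMeasurable h (measQ Q μ)) :
    AEMeasurable (fun p => h (T.shift r p)) (measQ Q μ) :=
  (aemeasurable_of_nullMeasurable_comp (T.nullMeasurable_shift hr Q) hh.measurable_mk).congr
    (T.ae_shift hr hh.ae_eq_mk.symm)

theorem DynSystem.lintegral_shift [SFinite μ] (T : DynSystem d μ) {r : ℝ} (hr : r ≠ 0)
    {Q : Set (Rd d)} {h : Rd d × Ω → ℝ≥0∞} (hh : AEMeasurable h (measQ Q μ)) :
    ∫⁻ p, h (T.shift r p) ∂(measQ Q μ) = ∫⁻ p, h p ∂(measQ Q μ) := by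
  rw [lintegral_congr_ae hh.ae_eq_mk, lintegral_congr_ae (T.ae_shift hr hh.ae_eq_mk),
    T.lintegral_shift_of_measurable hr Q hh.measurable_mk]

theorem DynSystem.aestronglyMeasurable_shift [SFinite μ] (T : DynSystem d μ) {r : ℝ} (hr : r ≠ 0)
    {Q : Set (Rd d)} {g : Rd d × Ω → ℂ} (hg : AEStronglyMeasurable g (measQ Q μ)) :
    AEStronglyMeasurable (fun p => g (T.shift r p)) (measQ Q μ) := by
  refine AEStronglyMeasurable.congr (f := fun p => hg.mk g (T.shift r p)) ?_
    (T.ae_shift hr hg.ae_eq_mk.symm)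
  exact aestronglyMeasurable_iff_nullMeasurable_separable.2
    ⟨hg.stronglyMeasurable_mk.measurable.comp_nullMeasurable (T.nullMeasurable_shift hr Q), univ,
      TopologicalSpace.IsSeparable.of_separableSpace _, by simp⟩

theorem DynSystem.nullMeasurable_orbit (T : DynSystem d μ) (ω : Ω) :
    NullMeasurable (fun x => T.toFun x ω) (volume : Measure (Rd d)) :=
  T.measurable_joint.comp (measurable_prodMk_right (y := ω))

end Shift

/-! ### Point values of classes of bounded functions -/

section PointValue

variable {d : ℕ}

theorem tendsto_pointValue_of_exists {v : Rd d → ℂ} {y : Rd d}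
    (h : ∃ c, Tendsto (fun r : ℝ => ⨍ z in Metric.ball y r, v z) (𝓝[>] 0) (𝓝 c)) :
    Tendsto (fun r : ℝ => ⨍ z in Metric.ball y r, v z) (𝓝[>] 0) (𝓝 (pointValue v y)) :=
  tendsto_nhds_limUnder h

theorem ae_tendsto_average_ball {v : Rd d → ℂ} (hv : LocallyIntegrable v volume) :
    ∀ᵐ y, Tendsto (fun r : ℝ => ⨍ z in Metric.ball y r, v z) (𝓝[>] 0) (𝓝 (v y)) := by
  filter_upwards [IsUnifLocDoublingMeasure.ae_tendsto_average volume hv 1] with y hy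
  have h1 := hy (l := 𝓝[>] (0 : ℝ)) (fun _ => y) (fun r => r) tendsto_id (by
    filter_upwards [self_mem_nhdsWithin] with r hr
    have hr : 0 < r := hr
    simpa using hr.le)
  refine h1.congr' ?_
  filter_upwards [self_mem_nhdsWithin] with r hr
  have hr : 0 < r := hr
  refine setAverage_congr ?_
  -- The differentiation theorem concerns closed balls; spheres are null, so open balls give the
  -- same averages.
  refine (Metric.ball_subset_closedBall.eventuallyLE.antisymm ?_).symm
  refine ae_le_set.2 ?_
  rw [Metric.closedBall_sdiff_ball]
  exact Measure.addHaar_sphere_of_ne_zero _ _ hr.ne'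

theorem pointValue_ae_eq {v : Rd d → ℂ} (hv : LocallyIntegrable v volume) :
    pointValue v =ᵐ[volume] v := by
  filter_upwards [ae_tendsto_average_ball hv] with y hy
  exact hy.limUnder_eq

theorem Lp.ae_norm_sub_le (v w : Lp ℂ ∞ (volume : Measure (Rd d))) :
    ∀ᵐ y, ‖(v : Rd d → ℂ) y - (w : Rd d → ℂ) y‖ ≤ ‖v - w‖ := by
  filter_upwards [Lp.coeFn_sub v w,
    ae_le_eLpNormEssSup (f := ((v - w : Lp ℂ ∞ (volume : Measure (Rd d))) : Rd d → ℂ))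
      (μ := volume)] with y h1 h2
  rw [Pi.sub_apply] at h1
  rw [← h1, ← toReal_enorm, Lp.norm_def, eLpNorm_exponent_top]
  refine ENNReal.toReal_mono ?_ h2
  rw [← eLpNorm_exponent_top]
  exact Lp.eLpNorm_ne_top _

theorem Lp.locallyIntegrable_top (v : Lp ℂ ∞ (volume : Measure (Rd d))) :
    LocallyIntegrable (v : Rd d → ℂ) volume :=
  (Lp.memLp v).locallyIntegrable le_top

theorem norm_average_ball_sub_le (v w : Lp ℂ ∞ (volume : Measure (Rd d))) (y : Rd d) {r : ℝ}
    (hr : 0 < r) :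
    ‖(⨍ z in Metric.ball y r, (v : Rd d → ℂ) z) - ⨍ z in Metric.ball y r, (w : Rd d → ℂ) z‖ ≤
      ‖v - w‖ := by
  have hvol : volume (Metric.ball y r) ≠ 0 := (Metric.measure_ball_pos volume y hr).ne'
  have hvol' : volume (Metric.ball y r) ≠ ∞ := measure_ball_lt_top.ne
  rw [setAverage_eq, setAverage_eq, ← smul_sub, ← integral_sub
    ((Lp.locallyIntegrable_top v).integrableOn_isCompact (isCompact_closedBall y r) |>.mono_set
      Metric.ball_subset_closedBall)
    ((Lp.locallyIntegrable_top w).integrableOn_isCompact (isCompact_closedBall y r) |>.mono_set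
      Metric.ball_subset_closedBall), norm_smul]
  have h1 := norm_setIntegral_le_of_norm_le_const_ae (s := Metric.ball y r)
    measure_ball_lt_top (ae_restrict_of_ae (Lp.ae_norm_sub_le v w))
  have hpos : 0 < volume.real (Metric.ball y r) := ENNReal.toReal_pos hvol hvol'
  calc _ ≤ ‖(volume.real (Metric.ball y r))⁻¹‖ *
        (‖v - w‖ * volume.real (Metric.ball y r)) := by gcongr
    _ = ‖v - w‖ := by
      rw [norm_inv, Real.norm_of_nonneg hpos.le]; field_simp

/-- One null set serves the whole family `S`, possibly uncountable. Off it, the averages of a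
countable dense family converge; averaging is a contraction for the `L^∞` norm, so the averages of
every member of `S` are Cauchy. A trace needs this, because both the function evaluated and the
point depend on `x`. -/
theorem ae_forall_norm_pointValue_sub_le {S : Set (Lp ℂ ∞ (volume : Measure (Rd d)))}
    (hS : TopologicalSpace.IsSeparable S) :
    ∀ᵐ y, ∀ v ∈ S, ∀ w ∈ S, ‖pointValue v y - pointValue w y‖ ≤ ‖v - w‖ := by
  obtain ⟨D, hD, hSD⟩ := hS
  have h1 : ∀ᵐ y, ∀ v ∈ D, Tendsto (fun r : ℝ => ⨍ z in Metric.ball y r, (v : Rd d → ℂ) z)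
      (𝓝[>] 0) (𝓝 ((v : Rd d → ℂ) y)) :=
    (ae_ball_iff hD).2 fun v _ => ae_tendsto_average_ball (Lp.locallyIntegrable_top v)
  filter_upwards [h1] with y hy
  have hlim : ∀ v ∈ S, Tendsto (fun r : ℝ => ⨍ z in Metric.ball y r, (v : Rd d → ℂ) z)
      (𝓝[>] 0) (𝓝 (pointValue v y)) := by
    intro v hv
    refine tendsto_pointValue_of_exists (cauchy_map_iff_exists_tendsto.1
      (Metric.cauchy_iff.2 ⟨inferInstance, fun η hη => ?_⟩))
    obtain ⟨w, hw, hvw⟩ := Metric.mem_closure_iff.1 (hSD hv) (η / 4) (by positivity)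
    rw [dist_eq_norm] at hvw
    have h2 : ∀ᶠ r in 𝓝[>] (0 : ℝ), dist (⨍ z in Metric.ball y r, (w : Rd d → ℂ) z)
        ((w : Rd d → ℂ) y) < η / 4 := (Metric.tendsto_nhds.1 (hy w hw)) _ (by positivity)
    have h3 : ∀ᶠ r in 𝓝[>] (0 : ℝ), dist (⨍ z in Metric.ball y r, (v : Rd d → ℂ) z)
        ((w : Rd d → ℂ) y) < η / 2 := by
      filter_upwards [h2, self_mem_nhdsWithin] with r hr hr0
      have h4 := norm_average_ball_sub_le v w y hr0
      rw [← dist_eq_norm] at h4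
      have := dist_triangle (⨍ z in Metric.ball y r, (v : Rd d → ℂ) z)
        (⨍ z in Metric.ball y r, (w : Rd d → ℂ) z) ((w : Rd d → ℂ) y)
      linarith
    refine ⟨_, image_mem_map h3, ?_⟩
    rintro _ ⟨r, hr, rfl⟩ _ ⟨s, hs, rfl⟩
    have hr : dist (⨍ z in Metric.ball y r, (v : Rd d → ℂ) z) ((w : Rd d → ℂ) y) < η / 2 := hr
    have hs : dist (⨍ z in Metric.ball y s, (v : Rd d → ℂ) z) ((w : Rd d → ℂ) y) < η / 2 := hs
    have := dist_triangle_right (⨍ z in Metric.ball y r, (v : Rd d → ℂ) z)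
      (⨍ z in Metric.ball y s, (v : Rd d → ℂ) z) ((w : Rd d → ℂ) y)
    linarith
  intro v hv w hw
  refine le_of_tendsto ((hlim v hv).sub (hlim w hw)).norm ?_
  filter_upwards [self_mem_nhdsWithin] with r hr
  exact norm_average_ball_sub_le v w y hr

theorem pointValue_zero (y : Rd d) : pointValue (fun _ => 0) y = 0 :=
  pointValue_of_continuous _ continuous_const y

theorem pointValue_congr {v w : Rd d → ℂ} (h : v =ᵐ[volume] w) (y : Rd d) :
    pointValue v y = pointValue w y := by
  unfold pointValue
  congr 1
  ext1 r
  exact average_congr (ae_restrict_of_ae h)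

theorem ae_smul_fst {Ω : Type*} [MeasurableSpace Ω] {μ : Measure Ω} [SFinite μ] {Q : Set (Rd d)}
    {r : ℝ} (hr : r ≠ 0) {P : Rd d → Prop} (h : ∀ᵐ y, P y) :
    ∀ᵐ p ∂(measQ Q μ), P (r • p.1) := by
  have h1 := (Measure.quasiMeasurePreserving_smul (volume : Measure (Rd d)) hr).ae h
  exact Measure.quasiMeasurePreserving_fst.ae (ae_restrict_of_ae h1)

end PointValue

/-! ### Smooth approximation of indicators on `Ω` and on `Q` -/

section Smoothing

variable {d : ℕ}

/-- Smooth compactly supported real functions. -/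
@[ext]
structure Kern (d : ℕ) : Type where
  toFun : Rd d → ℝ
  contDiff : ContDiff ℝ ((⊤ : ℕ∞) : WithTop ℕ∞) toFun
  hasCompactSupport : HasCompactSupport toFun

namespace Kern

/-- The partial derivative. -/
def partialDeriv (i : Fin d) (k : Kern d) : Kern d :=
  ⟨fun y => fderiv ℝ k.toFun y (EuclideanSpace.single i 1),
    (k.contDiff.fderiv_right (m := ((⊤ : ℕ∞) : WithTop ℕ∞)) (by simp)).clm_apply contDiff_const,
    k.hasCompactSupport.fderiv_apply (𝕜 := ℝ) _⟩

theorem differentiable (k : Kern d) : Differentiable ℝ k.toFun := k.contDiff.differentiable (by simp)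

/-- Symmetry of the second derivative. It makes iterated derivatives independent of the order, so
that a multi-index can be folded as a multiset. -/
theorem partialDeriv_comm (i j : Fin d) (k : Kern d) :
    partialDeriv i (partialDeriv j k) = partialDeriv j (partialDeriv i k) := by
  apply Kern.ext
  funext y
  have hd : DifferentiableAt ℝ (fderiv ℝ k.toFun) y :=
    (k.contDiff.fderiv_right (m := 1) (by norm_cast)).differentiable one_ne_zero y
  have h1 : ∀ v w : Rd d, fderiv ℝ (fun z => fderiv ℝ k.toFun z v) y w =
      fderiv ℝ (fderiv ℝ k.toFun) y w v := by
    intro v w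
    rw [fderiv_clm_apply hd (differentiableAt_const _)]
    simp
  have h2 : IsSymmSndFDerivAt ℝ k.toFun y :=
    ContDiffAt.isSymmSndFDerivAt (n := 2)
      (k.contDiff.contDiffAt.of_le (by norm_cast)) (by simp)
  change fderiv ℝ (fun z => fderiv ℝ k.toFun z _) y _ = fderiv ℝ (fun z => fderiv ℝ k.toFun z _) y _
  rw [h1, h1]
  exact h2.eq _ _

instance : LeftCommutative (partialDeriv (d := d)) := ⟨partialDeriv_comm⟩

/-- Partial derivatives of arbitrary order. -/
def multiDeriv (α : Fin d → ℕ) (k : Kern d) : Kern d :=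
  (∑ i, Multiset.replicate (α i) i).foldr partialDeriv k

theorem multiDeriv_zero (k : Kern d) : multiDeriv 0 k = k := by
  simp [multiDeriv]

theorem multiDeriv_add_single (α : Fin d → ℕ) (i : Fin d) (k : Kern d) :
    multiDeriv (α + Pi.single i 1) k = partialDeriv i (multiDeriv α k) := by
  have h : ∑ j, Multiset.replicate ((α + Pi.single i 1 : Fin d → ℕ) j) j =
      i ::ₘ ∑ j, Multiset.replicate (α j) j := by
    simp only [Pi.add_apply, Multiset.replicate_add, Finset.sum_add_distrib]
    have h1 : ∑ j, Multiset.replicate ((Pi.single i 1 : Fin d → ℕ) j) j = {i} := by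
      rw [Finset.sum_eq_single i]
      · simp
      · intro j _ hj; simp [Pi.single_eq_of_ne hj]
      · simp
    rw [h1, add_comm, Multiset.singleton_add]
  rw [multiDeriv, h, Multiset.foldr_cons, multiDeriv]

theorem continuous (k : Kern d) : Continuous k.toFun := k.contDiff.continuous

theorem integrable (k : Kern d) : Integrable k.toFun volume :=
  k.continuous.integrable_of_hasCompactSupport k.hasCompactSupport

/-- Convergence of difference quotients in `L¹` of the kernel gives convergence of the
regularizations in `L^∞(Ω)`, since the integrated indicator is at most one. The domination uses the
Lipschitz constant on the closed 1-thickening of the support. -/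
theorem tendsto_integral_slope (k : Kern d) (i : Fin d) :
    Tendsto (fun h : ℝ => ∫ t, ‖h⁻¹ * (k.toFun (t + EuclideanSpace.single i h) - k.toFun t) -
      (partialDeriv i k).toFun t‖) (𝓝[≠] 0) (𝓝 0) := by
  obtain ⟨C, hC⟩ := ContDiff.lipschitzWith_of_hasCompactSupport k.hasCompactSupport k.contDiff (by simp)
  set K := Metric.cthickening 1 (tsupport k.toFun) with hK
  have hKc : IsCompact K := k.hasCompactSupport.cthickening
  have hsingle : ∀ h : ℝ, EuclideanSpace.single i h = h • (EuclideanSpace.single i 1 : Rd d) := by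
    intro h; ext j; by_cases hj : j = i <;> simp [hj]
  have hlim0 : ∫ _ : Rd d, (0 : ℝ) = 0 := by simp
  rw [show (𝓝 (0 : ℝ)) = 𝓝 (∫ _ : Rd d, (0 : ℝ)) by rw [hlim0]]
  refine tendsto_integral_filter_of_dominated_convergence
    (fun t => K.indicator (fun _ => (C : ℝ)) t + ‖(partialDeriv i k).toFun t‖) ?_ ?_ ?_ ?_
  · refine Eventually.of_forall fun h => Continuous.aestronglyMeasurable ?_
    have h1 := k.continuous
    have h2 := (partialDeriv i k).continuous
    fun_prop
  · have h1 : ∀ᶠ h in 𝓝[≠] (0 : ℝ), |h| < 1 :=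
      nhdsWithin_le_nhds ((continuous_abs.tendsto' (0 : ℝ) 0 abs_zero).eventually (gt_mem_nhds one_pos))
    filter_upwards [h1, self_mem_nhdsWithin] with h hh hh0
    have hh0 : h ≠ 0 := hh0
    refine Eventually.of_forall fun t => ?_
    rw [norm_norm]
    refine (norm_sub_le _ _).trans ?_
    gcongr
    by_cases ht : t ∈ K
    · rw [indicator_of_mem ht, norm_mul, norm_inv]
      have h3 := hC.dist_le_mul (t + EuclideanSpace.single i h) t
      rw [dist_eq_norm, dist_eq_norm, add_sub_cancel_left, PiLp.norm_single] at h3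
      calc ‖h‖⁻¹ * ‖k.toFun (t + EuclideanSpace.single i h) - k.toFun t‖ ≤ ‖h‖⁻¹ * (C * ‖h‖) := by gcongr
        _ = C := by
          have : ‖h‖ ≠ 0 := norm_ne_zero_iff.2 hh0
          field_simp
    · rw [indicator_of_notMem ht]
      have h4 : k.toFun t = 0 := by
        by_contra h0
        exact ht (Metric.self_subset_cthickening _ (subset_tsupport _ h0))
      have h5 : k.toFun (t + EuclideanSpace.single i h) = 0 := by
        by_contra h0
        refine ht (Metric.mem_cthickening_of_dist_le t _ 1 _ (subset_tsupport _ h0) ?_)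
        rw [dist_eq_norm, sub_add_cancel_left, norm_neg, PiLp.norm_single]
        exact hh.le
      rw [h4, h5]; simp
  · exact ((integrable_indicator_iff hKc.measurableSet).2
      (integrableOn_const hKc.measure_lt_top.ne (by simp))).add (partialDeriv i k).integrable.norm
  · refine Eventually.of_forall fun t => ?_
    have h1 := ((k.differentiable t).hasFDerivAt.hasLineDerivAt
      (EuclideanSpace.single i 1)).tendsto_slope_zero
    have h2 := (h1.sub_const ((partialDeriv i k).toFun t)).norm
    have h3 : fderiv ℝ k.toFun t (EuclideanSpace.single i 1) - (partialDeriv i k).toFun t = 0 := sub_self _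
    rw [h3, norm_zero] at h2
    refine h2.congr fun h => ?_
    rw [hsingle h, smul_eq_mul]

end Kern

variable {Ω : Type*} [MeasurableSpace Ω] {μ : Measure Ω} (T : DynSystem d μ) (B : Set Ω)

/-- The function `y ↦ 1_B(T(y) ω)`. -/
def orbitIndicator (y : Rd d) (ω : Ω) : ℂ := B.indicator 1 (T.toFun y ω)

/-- The regularization of the indicator function of `B` by the kernel `k`. -/
def mollify (k : Kern d) (ω : Ω) : ℂ := ∫ t, k.toFun t • orbitIndicator T B (-t) ω

variable {T B}

theorem norm_orbitIndicator_le (y : Rd d) (ω : Ω) : ‖orbitIndicator T B y ω‖ ≤ 1 := by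
  unfold orbitIndicator
  by_cases h : T.toFun y ω ∈ B
  · simp [indicator_of_mem h]
  · simp [indicator_of_notMem h]

theorem aestronglyMeasurable_orbitIndicator (hB : MeasurableSet B) (ω : Ω) :
    AEStronglyMeasurable (fun y => orbitIndicator T B y ω) volume := by
  refine aestronglyMeasurable_iff_nullMeasurable_separable.2
    ⟨?_, univ, TopologicalSpace.IsSeparable.of_separableSpace _, by simp⟩
  exact (measurable_one.indicator hB : Measurable (B.indicator (1 : Ω → ℂ))).comp_nullMeasurable
    (T.nullMeasurable_orbit ω)

theorem integrable_kern_mul (hB : MeasurableSet B) {g : Rd d → ℝ} (hg : Integrable g volume)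
    (ω : Ω) : Integrable (fun t => g t • orbitIndicator T B (-t) ω) volume := by
  have h1 : AEStronglyMeasurable (fun t => orbitIndicator T B (-t) ω) volume :=
    (aestronglyMeasurable_orbitIndicator hB ω).comp_measurePreserving
      (Measure.measurePreserving_neg volume)
  refine hg.norm.mono' (hg.aestronglyMeasurable.smul h1) (Eventually.of_forall fun t => ?_)
  rw [norm_smul]
  exact mul_le_of_le_one_right (norm_nonneg _) (norm_orbitIndicator_le _ _)

theorem norm_integral_kern_mul_le {g : Rd d → ℝ} (hg : Integrable g volume) (ω : Ω) :
    ‖∫ t, g t • orbitIndicator T B (-t) ω‖ ≤ ∫ t, ‖g t‖ := by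
  refine norm_integral_le_of_norm_le hg.norm (Eventually.of_forall fun t => ?_)
  rw [norm_smul]
  exact mul_le_of_le_one_right (norm_nonneg _) (norm_orbitIndicator_le _ _)

/-- By the group law, translation along the orbit moves onto the kernel; stochastic derivatives
become ordinary derivatives of `k`. -/
theorem mollify_shift (k : Kern d) (s : Rd d) (ω : Ω) :
    mollify T B k (T.toFun s ω) = ∫ t, k.toFun (t + s) • orbitIndicator T B (-t) ω := by
  rw [mollify, ← integral_add_right_eq_self _ s]
  refine integral_congr_ae (Eventually.of_forall fun t => ?_)
  simp only [orbitIndicator]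
  congr 2
  have := congrFun (T.map_add (-(t + s)) s) ω
  rw [neg_add, neg_add_cancel_right] at this
  rw [this, neg_add]
  rfl

theorem aestronglyMeasurable_mollify [SFinite μ] (hB : MeasurableSet B) (k : Kern d) :
    AEStronglyMeasurable (mollify T B k) μ := by
  have h1 : AEStronglyMeasurable (fun p : Rd d × Ω => B.indicator (1 : Ω → ℂ) p.2)
      (measQ univ μ) :=
    ((measurable_one.indicator hB).comp measurable_snd).aestronglyMeasurable
  have h2 := T.aestronglyMeasurable_shift (r := -1) (by norm_num) h1
  have h3 : AEStronglyMeasurable (fun p : Rd d × Ω => k.toFun p.1 • orbitIndicator T B (-p.1) p.2)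
      ((volume : Measure (Rd d)).prod μ) := by
    rw [measQ, Measure.restrict_univ] at h2
    have h4 : AEStronglyMeasurable (fun p : Rd d × Ω => orbitIndicator T B (-p.1) p.2)
        ((volume : Measure (Rd d)).prod μ) :=
      h2.congr (Eventually.of_forall fun p => by simp [DynSystem.shift, orbitIndicator])
    exact (k.continuous.measurable.comp measurable_fst).aestronglyMeasurable.smul h4
  exact h3.prod_swap.integral_prod_right'

theorem hasStochDeriv_mollify (hB : MeasurableSet B) (k : Kern d) (i : Fin d) :
    HasStochDeriv T i (mollify T B k) (mollify T B (k.partialDeriv i)) := by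
  have h1 := (ENNReal.continuous_ofReal.tendsto 0).comp (k.tendsto_integral_slope i)
  rw [ENNReal.ofReal_zero] at h1
  refine tendsto_of_tendsto_of_tendsto_of_le_of_le tendsto_const_nhds h1 (fun _ => zero_le) ?_
  intro h
  simp only [eLpNorm_exponent_top, Function.comp]
  refine eLpNormEssSup_le_of_ae_bound (Eventually.of_forall fun ω => ?_)
  have hk : Integrable (fun t => k.toFun (t + EuclideanSpace.single i h)) volume :=
    k.integrable.comp_add_right _
  have hint : Integrable (fun t => h⁻¹ * (k.toFun (t + EuclideanSpace.single i h) - k.toFun t) -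
      (k.partialDeriv i).toFun t) volume :=
    ((hk.sub k.integrable).const_mul _).sub (k.partialDeriv i).integrable
  have h2 : (h : ℂ)⁻¹ * (mollify T B k (T.toFun (EuclideanSpace.single i h) ω) -
      mollify T B k ω) - mollify T B (k.partialDeriv i) ω =
      ∫ t, (h⁻¹ * (k.toFun (t + EuclideanSpace.single i h) - k.toFun t) -
        (k.partialDeriv i).toFun t) • orbitIndicator T B (-t) ω := by
    have i1 := integrable_kern_mul (T := T) hB hk ω
    have i2 := integrable_kern_mul (T := T) hB k.integrable ω
    have i3 := integrable_kern_mul (T := T) hB (k.partialDeriv i).integrable ω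
    have i4 : Integrable (fun t => (h : ℂ)⁻¹ * (k.toFun (t + EuclideanSpace.single i h) •
        orbitIndicator T B (-t) ω - k.toFun t • orbitIndicator T B (-t) ω)) volume :=
      (i1.sub i2).const_mul _
    rw [mollify_shift, mollify, mollify, ← integral_sub i1 i2, ← integral_const_mul,
      ← integral_sub i4 i3]
    refine integral_congr_ae (Eventually.of_forall fun t => ?_)
    simp only [Complex.real_smul]
    push_cast
    ring
  rw [h2]
  exact norm_integral_kern_mul_le hint ω

theorem isStochSmooth_mollify [SFinite μ] (hB : MeasurableSet B) (k : Kern d) :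
    IsStochSmooth T (mollify T B k) := by
  refine ⟨fun α => mollify T B (k.multiDeriv α), by simp only [Kern.multiDeriv_zero], fun α => ?_,
    fun α i => ?_⟩
  · exact memLp_top_of_bound (aestronglyMeasurable_mollify hB _) _
      (Eventually.of_forall fun ω => norm_integral_kern_mul_le (Kern.integrable _) ω)
  · simp only [Kern.multiDeriv_add_single]
    exact hasStochDeriv_mollify hB _ i

/-- On each orbit the regularization is an ordinary convolution of a bounded function, so it
converges almost everywhere in `z`. Invariance of `μ` rewrites the `L¹(Ω)` error as its average over
`T(z)ω`, `z` in the unit ball, and dominated convergence applies twice. -/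
theorem exists_isStochSmooth_approx [IsProbabilityMeasure μ] (T : DynSystem d μ) {B : Set Ω}
    (hB : MeasurableSet B) {η : ℝ} (hη : 0 < η) :
    ∃ ψ : Ω → ℂ, IsStochSmooth T ψ ∧ (∀ ω, ‖ψ ω‖ ≤ 1) ∧
      ∫⁻ ω, ‖B.indicator 1 ω - ψ ω‖ₑ ∂μ ≤ ENNReal.ofReal η := by
  -- The outer radius stays twice the inner one, as the almost everywhere convergence of
  -- convolutions requires a bounded ratio.
  let φ : ℕ → ContDiffBump (0 : Rd d) := fun n =>
    ⟨1 / (n + 1), 2 / (n + 1), by positivity, by gcongr; norm_num⟩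
  let k : ℕ → Kern d := fun n => ⟨(φ n).normed volume, (φ n).contDiff_normed,
    (φ n).hasCompactSupport_normed⟩
  have hknorm : ∀ n, ∫ t, ‖(k n).toFun t‖ = 1 := fun n => by
    rw [← (φ n).integral_normed (μ := (volume : Measure (Rd d)))]
    refine integral_congr_ae (Eventually.of_forall fun t => ?_)
    exact Real.norm_of_nonneg ((φ n).nonneg_normed t)
  have hle : ∀ n ω, ‖mollify T B (k n) ω‖ ≤ 1 := fun n ω => by
    rw [← hknorm n]; exact norm_integral_kern_mul_le (k n).integrable ω
  set U := Metric.ball (0 : Rd d) 1 with hU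
  have hU0 : volume U ≠ 0 := (Metric.measure_ball_pos volume _ one_pos).ne'
  have hU1 : volume U ≠ ∞ := measure_ball_lt_top.ne
  let H : ℕ → Ω → ℝ≥0∞ := fun n ω => ‖B.indicator 1 ω - mollify T B (k n) ω‖ₑ
  have hH : ∀ n, AEMeasurable (H n) μ := fun n =>
    ((measurable_one.indicator hB).aestronglyMeasurable.sub
      (aestronglyMeasurable_mollify hB (k n))).enorm
  have hH2 : ∀ n ω, H n ω ≤ 2 := fun n ω => by
    refine (enorm_sub_le).trans ?_
    have h1 : ‖(B.indicator 1 ω : ℂ)‖ₑ ≤ 1 := by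
      by_cases h : ω ∈ B
      · simp [indicator_of_mem h]
      · simp [indicator_of_notMem h]
    have h2 : ‖mollify T B (k n) ω‖ₑ ≤ 1 := by
      rw [← ofReal_norm]; exact ENNReal.ofReal_le_one.2 (hle n ω)
    calc _ ≤ (1 : ℝ≥0∞) + 1 := add_le_add h1 h2
      _ = 2 := one_add_one_eq_two
  have hHp : ∀ n, AEMeasurable (fun p : Rd d × Ω => H n p.2) (measQ U μ) := fun n =>
    (hH n).comp_quasiMeasurePreserving Measure.quasiMeasurePreserving_snd
  have hHs : ∀ n, AEMeasurable (fun p : Rd d × Ω => H n (T.shift 1 p).2) (measQ U μ) := fun n =>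
    T.aemeasurable_shift one_ne_zero (hHp n)
  -- The shift with `r = 1`, followed by an exchange of the order of integration.
  have key : ∀ n, volume U * ∫⁻ ω, H n ω ∂μ =
      ∫⁻ ω, (∫⁻ z in U, H n (T.toFun z ω)) ∂μ := by
    intro n
    have h1 := T.lintegral_shift one_ne_zero (hHp n)
    rw [lintegral_prod_symm _ (hHs n), lintegral_prod _ (hHp n)] at h1
    simp only [lintegral_const, Measure.restrict_apply_univ, DynSystem.shift, one_smul] at h1
    rw [h1, mul_comm]
  have hinner : ∀ ω, Tendsto (fun n => ∫⁻ z in U, H n (T.toFun z ω)) atTop (𝓝 0) := by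
    intro ω
    have hF := aestronglyMeasurable_orbitIndicator (T := T) hB ω
    have hloc : LocallyIntegrable (fun y => orbitIndicator T B y ω) volume :=
      (memLp_top_of_bound hF 1 (Eventually.of_forall fun y =>
        norm_orbitIndicator_le y ω)).locallyIntegrable le_top
    have hconv : ∀ n z, mollify T B (k n) (T.toFun z ω) = (convolution ((φ n).normed volume)
        (fun y => orbitIndicator T B y ω) (ContinuousLinearMap.lsmul ℝ ℝ) volume) z := by
      intro n z
      rw [mollify, convolution]
      refine integral_congr_ae (Eventually.of_forall fun t => ?_)
      simp only [orbitIndicator, ContinuousLinearMap.lsmul_apply]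
      have := congrFun (T.map_add (-t) z) ω
      rw [show z - t = -t + z by abel, this]
      rfl
    have hconvc : ∀ n, Continuous (fun z => mollify T B (k n) (T.toFun z ω)) := fun n => by
      simp only [hconv]
      exact (k n).hasCompactSupport.continuous_convolution_left _ (k n).continuous hloc
    have hae := ContDiffBump.ae_convolution_tendsto_right_of_locallyIntegrable (φ := φ)
      (l := atTop) (K := 2) (μ := volume) (by
        have h1 : Tendsto (fun n : ℕ => 2 * (1 / ((n : ℝ) + 1))) atTop (𝓝 (2 * 0)) :=
          tendsto_one_div_add_atTop_nhds_zero_nat.const_mul 2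
        rw [mul_zero] at h1
        refine h1.congr fun n => ?_
        simp only [φ]; ring)
      (Eventually.of_forall fun n => le_of_eq (by simp only [φ]; ring)) hloc
    have hz : ∫⁻ _ in U, (0 : ℝ≥0∞) = 0 := by simp
    rw [← hz]
    refine tendsto_lintegral_of_dominated_convergence' (fun _ => 2) (fun n => ?_)
      (fun n => Eventually.of_forall fun z => hH2 n _) ?_ ?_
    · exact (hF.sub (hconvc n).aestronglyMeasurable).enorm.restrict
    · rw [setLIntegral_const]; exact ENNReal.mul_ne_top (by simp) hU1
    · refine ae_restrict_of_ae ?_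
      filter_upwards [hae] with z hz'
      have h1 : Tendsto (fun n => ‖orbitIndicator T B z ω -
          mollify T B (k n) (T.toFun z ω)‖ₑ) atTop
          (𝓝 ‖orbitIndicator T B z ω - orbitIndicator T B z ω‖ₑ) := by
        simp only [hconv]
        exact (tendsto_const_nhds.sub hz').enorm
      rw [sub_self, enorm_zero] at h1
      exact h1
  have hlim : Tendsto (fun n => volume U * ∫⁻ ω, H n ω ∂μ) atTop (𝓝 0) := by
    simp only [key]
    have hz : ∫⁻ _ : Ω, (0 : ℝ≥0∞) ∂μ = 0 := by simp
    rw [← hz]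
    refine tendsto_lintegral_of_dominated_convergence' (fun _ => 2 * volume U) (fun n => ?_)
      (fun n => Eventually.of_forall fun ω => ?_) ?_ (Eventually.of_forall hinner)
    · have := (hHs n).lintegral_prod_left'
      simpa only [DynSystem.shift, one_smul] using this
    · calc _ ≤ ∫⁻ _ in U, (2 : ℝ≥0∞) := lintegral_mono fun z => hH2 n _
        _ = _ := setLIntegral_const _ _
    · rw [lintegral_const, measure_univ, mul_one]
      exact ENNReal.mul_ne_top (by simp) hU1
  have hη' : 0 < volume U * ENNReal.ofReal η :=
    ENNReal.mul_pos hU0 (by simpa using hη)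
  obtain ⟨n, hn⟩ := (hlim.eventually (gt_mem_nhds hη')).exists
  exact ⟨mollify T B (k n), isStochSmooth_mollify hB (k n), hle n,
    ((ENNReal.mul_lt_mul_iff_right hU0 hU1).1 hn).le⟩

-- Take `F ⊆ D` compact with `D \ F` small, an open `U ⊇ F` with `U \ F` small, and a smooth cutoff
-- equal to one on `F` and supported in a compact subset of `U ∩ Q`. The error is at most one and
-- lives on `(D \ F) ∪ (U \ F)`.
open scoped Manifold in
theorem exists_contDiff_approx {Q D K : Set (Rd d)} (hQ : IsOpen Q) (hK : IsCompact K)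
    (hKQ : K ⊆ Q) (hDK : D ⊆ K) (hD : MeasurableSet D) {η : ℝ} (hη : 0 < η) :
    ∃ φ : Rd d → ℂ, ContDiff ℝ ((⊤ : ℕ∞) : WithTop ℕ∞) φ ∧ HasCompactSupport φ ∧ tsupport φ ⊆ Q ∧
      (∀ x, ‖φ x‖ ≤ 1) ∧ ∫⁻ x, ‖D.indicator 1 x - φ x‖ₑ ≤ ENNReal.ofReal η := by
  have hDfin : volume D ≠ ∞ := ((measure_mono hDK).trans_lt hK.measure_lt_top).ne
  have hη2 : ENNReal.ofReal (η / 2) ≠ 0 := by simpa using hη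
  obtain ⟨F, hFD, hF, hF2⟩ := hD.exists_isCompact_sdiff_lt hDfin hη2
  obtain ⟨U, hFU, hU, hU1, hU2⟩ := hF.measurableSet.exists_isOpen_sdiff_lt
    (μ := (volume : Measure (Rd d))) hF.measure_lt_top.ne hη2
  obtain ⟨L, hL, hFL, hLU⟩ := exists_compact_between hF (hU.inter hQ)
    (subset_inter hFU (hFD.trans (hDK.trans hKQ)))
  obtain ⟨f, hf0, hf1, hf⟩ := exists_contMDiffMap_zero_one_of_isClosed (n := ⊤) 𝓘(ℝ, Rd d)
    (isOpen_interior (s := L)).isClosed_compl hF.isClosed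
    (disjoint_compl_left_iff_subset.2 hFL)
  have hsupp : Function.support (fun x => (f x : ℂ)) ⊆ L := by
    intro x hx
    by_contra hxL
    exact hx (by simpa using hf0 (show x ∈ (interior L)ᶜ from fun h => hxL (interior_subset h)))
  have htsupp : tsupport (fun x => (f x : ℂ)) ⊆ L := closure_minimal hsupp hL.isClosed
  have hnorm : ∀ x, ‖(f x : ℂ)‖ ≤ 1 := fun x => by
    rw [Complex.norm_real, Real.norm_of_nonneg (hf x).1]; exact (hf x).2
  refine ⟨fun x => (f x : ℂ), ?_, ?_, ?_, hnorm, ?_⟩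
  · exact Complex.ofRealCLM.contDiff.comp f.contMDiff.contDiff
  · exact hL.of_isClosed_subset (isClosed_tsupport _) htsupp
  · exact htsupp.trans (hLU.trans inter_subset_right)
  · have hbound : ∀ x, ‖D.indicator (1 : Rd d → ℂ) x - f x‖ₑ ≤
        (D \ F).indicator 1 x + (U \ F).indicator 1 x := by
      intro x
      by_cases hxF : x ∈ F
      · have : f x = 1 := hf1 hxF
        simp [this, hFD hxF, hxF]
      · by_cases hxL : x ∈ L
        · have h1 : x ∈ U \ F := ⟨(hLU hxL).1, hxF⟩
          refine le_add_left ?_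
          rw [indicator_of_mem h1, Pi.one_apply, ← ofReal_norm, ENNReal.ofReal_le_one]
          by_cases hxD : x ∈ D
          · rw [indicator_of_mem hxD, Pi.one_apply, ← Complex.ofReal_one, ← Complex.ofReal_sub,
              Complex.norm_real, Real.norm_of_nonneg (sub_nonneg.2 (hf x).2)]
            linarith [(hf x).1]
          · rw [indicator_of_notMem hxD, zero_sub, norm_neg]; exact hnorm x
        · have h1 : f x = 0 := hf0 (show x ∈ (interior L)ᶜ from fun h => hxL (interior_subset h))
          refine le_add_right ?_
          by_cases hxD : x ∈ D
          · simp [h1, hxD, hxF]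
          · simp [h1, hxD]
    calc _ ≤ ∫⁻ x, ((D \ F).indicator 1 x + (U \ F).indicator 1 x) := lintegral_mono hbound
      _ = volume (D \ F) + volume (U \ F) := by
        rw [lintegral_add_left (measurable_one.indicator (hD.diff hF.measurableSet)),
          lintegral_indicator_one (hD.diff hF.measurableSet),
          lintegral_indicator_one (hU.measurableSet.diff hF.measurableSet)]
      _ ≤ ENNReal.ofReal (η / 2) + ENNReal.ofReal (η / 2) := add_le_add hF2.le hU2.le
      _ = _ := by
        rw [← ENNReal.ofReal_add (by positivity) (by positivity)]; congr 1; ring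

end Smoothing

/-! ### Pairable functions and their stability under approximation -/

section Core

variable {d : ℕ} {Ω : Type*} [MeasurableSpace Ω] {μ : Measure Ω} [IsProbabilityMeasure μ]
  {T : DynSystem d μ} {Q : Set (Rd d)} {ε₁ ε₂ : ℝ → ℝ} {A : StarSubalgebra ℂ (Rd d →ᵇ ℂ)}
  {Φ Ψ : ℝ → ℝ} {E : Set ℝ} {u : ℝ → Rd d → Ω → ℂ} {u₀ F G : Rd d → Ω → Rd d → ℂ}

/-- A family which is bounded in `L^Φ` and converges to `u₀` when paired with test functions. -/
structure PairingData (Q : Set (Rd d)) (T : DynSystem d μ) (ε₁ ε₂ : ℝ → ℝ)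
    (A : StarSubalgebra ℂ (Rd d →ᵇ ℂ)) (Φ Ψ : ℝ → ℝ) (E : Set ℝ)
    (u : ℝ → Rd d → Ω → ℂ) (u₀ : Rd d → Ω → Rd d → ℂ) : Prop where
  isOpen : IsOpen Q
  scale₁ : IsScale ε₁
  scale₂ : IsScale ε₂
  supralgebra : IsHSupralgebra ε₁ A
  youngPair : IsYoungPair Φ Ψ
  subset : E ⊆ Ioi 0
  meas : ∀ ε ∈ E, AEStronglyMeasurable (fun p : Rd d × Ω => u ε p.1 p.2) (measQ Q μ)
  small : ∀ κ : ℝ, 0 < κ → ∃ c : ℝ, 0 < c ∧ ∀ ε ∈ E,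
    ∫⁻ p, ENNReal.ofReal (Φ (c * ‖u ε p.1 p.2‖)) ∂(measQ Q μ) ≤ ENNReal.ofReal κ
  limit_mem : MemOrliczX Q μ Φ ε₁ A u₀
  pairing : ∀ f, IsTestFunction Q T A f → PairingConverges Q T ε₁ ε₂ E u u₀ f

/-- The function `F` may be used as a test function for the family `u`. -/
structure IsPairable (Q : Set (Rd d)) (T : DynSystem d μ) (ε₁ ε₂ : ℝ → ℝ)
    (A : StarSubalgebra ℂ (Rd d →ᵇ ℂ)) (Ψ : ℝ → ℝ) (E : Set ℝ)
    (u : ℝ → Rd d → Ω → ℂ) (u₀ F : Rd d → Ω → Rd d → ℂ) : Prop where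
  trace_meas : ∀ ε, 0 < ε →
    AEStronglyMeasurable (fun p : Rd d × Ω => trace T ε₁ ε₂ F ε p.1 p.2) (measQ Q μ)
  integrable_trace : ∀ᶠ ε in 𝓝[E] 0,
    Integrable (fun p : Rd d × Ω => u ε p.1 p.2 * trace T ε₁ ε₂ F ε p.1 p.2) (measQ Q μ)
  mx : ∀ᵐ p ∂(measQ Q μ), MX Ψ A (F p.1 p.2)
  integrable_mean : Integrable (fun p : Rd d × Ω => mean fun y => u₀ p.1 p.2 y * F p.1 p.2 y)
    (measQ Q μ)
  converges : PairingConverges Q T ε₁ ε₂ E u u₀ F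

theorem PairingData.limit_mx (H : PairingData Q T ε₁ ε₂ A Φ Ψ E u u₀) :
    ∀ᵐ p ∂(measQ Q μ), MX Φ A (u₀ p.1 p.2) := by
  filter_upwards [H.limit_mem.mem] with p hp
  exact hp.mx H.scale₁ H.youngPair.left

theorem PairingData.eventually_mem (H : PairingData Q T ε₁ ε₂ A Φ Ψ E u u₀) :
    ∀ᶠ ε in 𝓝[E] (0 : ℝ), ε ∈ E ∧ 0 < ε := by
  filter_upwards [self_mem_nhdsWithin] with ε hε
  exact ⟨hε, H.subset hε⟩

/-- A single `c` serves the family and its limit, since the modulars only decrease when `c` does. -/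
theorem PairingData.exists_small (H : PairingData Q T ε₁ ε₂ A Φ Ψ E u u₀) {κ : ℝ} (hκ : 0 < κ) :
    ∃ c : ℝ, 0 < c ∧ (∀ ε ∈ E,
      ∫⁻ p, ENNReal.ofReal (Φ (c * ‖u ε p.1 p.2‖)) ∂(measQ Q μ) ≤ ENNReal.ofReal κ) ∧
      ∫⁻ p, ENNReal.ofReal (mean fun y => Φ (c * ‖u₀ p.1 p.2 y‖)) ∂(measQ Q μ) ≤
        ENNReal.ofReal κ := by
  obtain ⟨c₁, hc₁, h1⟩ := H.small κ hκ
  have h2 := H.limit_mem.modular.eventually (gt_mem_nhds (ENNReal.ofReal_pos.2 hκ))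
  obtain ⟨c, hc, hc0, hc1⟩ := (h2.and (Ioo_mem_nhdsGT hc₁)).exists
  refine ⟨c, hc0, fun ε hε => (lintegral_mono fun p => ?_).trans (h1 ε hε), hc.le⟩
  exact ENNReal.ofReal_le_ofReal (H.youngPair.left.mono (by positivity) (by gcongr))

/-- Young's inequality bounds both differences of pairings: the terms in `u` and `u₀` are small by
the choice of `c`, the terms in `F - G` by the choice of `G` at `c⁻¹`. The measurable majorant `h`
avoids discussing measurability of the mean modular of `F - G`. -/
theorem IsPairable.of_approx (H : PairingData Q T ε₁ ε₂ A Φ Ψ E u u₀)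
    (htr : ∀ ε, 0 < ε →
      AEStronglyMeasurable (fun p : Rd d × Ω => trace T ε₁ ε₂ F ε p.1 p.2) (measQ Q μ))
    (hmx : ∀ᵐ p ∂(measQ Q μ), MX Ψ A (F p.1 p.2))
    (happ : ∀ κ c : ℝ, 0 < κ → 0 < c → ∃ G, IsPairable Q T ε₁ ε₂ A Ψ E u u₀ G ∧
      (∀ᶠ ε in 𝓝[>] 0, ∫⁻ p, ENNReal.ofReal (Ψ (c * ‖trace T ε₁ ε₂ F ε p.1 p.2 -
        trace T ε₁ ε₂ G ε p.1 p.2‖)) ∂(measQ Q μ) ≤ ENNReal.ofReal κ) ∧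
      ∃ h : Rd d × Ω → ℝ, (∀ p, 0 ≤ h p) ∧ AEMeasurable h (measQ Q μ) ∧
        ∫⁻ p, ENNReal.ofReal (h p) ∂(measQ Q μ) ≤ ENNReal.ofReal κ ∧
        ∀ᵐ p ∂(measQ Q μ), ∀ᶠ R in atTop, ∫⁻ y, ENNReal.ofReal
          (Ψ (c * ‖F p.1 p.2 y - G p.1 p.2 y‖)) ∂(ballMeas d R) ≤ ENNReal.ofReal (h p)) :
    IsPairable Q T ε₁ ε₂ A Ψ E u u₀ F := by
  have hP := H.youngPair
  have hE : 𝓝[E] (0 : ℝ) ≤ 𝓝[>] 0 := nhdsWithin_mono _ H.subset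
  have key : ∀ κ : ℝ, 0 < κ → ∃ G, IsPairable Q T ε₁ ε₂ A Ψ E u u₀ G ∧
      (∀ᶠ ε in 𝓝[E] 0,
        Integrable (fun p : Rd d × Ω => u ε p.1 p.2 * trace T ε₁ ε₂ F ε p.1 p.2) (measQ Q μ) ∧
        ‖∫ p, u ε p.1 p.2 * trace T ε₁ ε₂ F ε p.1 p.2 ∂(measQ Q μ) -
          ∫ p, u ε p.1 p.2 * trace T ε₁ ε₂ G ε p.1 p.2 ∂(measQ Q μ)‖ ≤ κ) ∧
      ∃ b : Rd d × Ω → ℝ≥0∞, AEMeasurable b (measQ Q μ) ∧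
        ∫⁻ p, b p ∂(measQ Q μ) ≤ ENNReal.ofReal κ ∧
        ∀ᵐ p ∂(measQ Q μ), ‖(mean fun y => u₀ p.1 p.2 y * F p.1 p.2 y) -
          mean fun y => u₀ p.1 p.2 y * G p.1 p.2 y‖ₑ ≤ b p := by
    intro κ hκ
    have hκ2 : ENNReal.ofReal (κ / 2) + ENNReal.ofReal (κ / 2) = ENNReal.ofReal κ := by
      rw [← ENNReal.ofReal_add (by positivity) (by positivity), add_halves]
    obtain ⟨c, hc, h1, h2⟩ := H.exists_small (half_pos hκ)
    obtain ⟨G, hG, h3, h, hh0, hhm, hhκ, hhb⟩ := happ (κ / 2) c⁻¹ (half_pos hκ) (inv_pos.2 hc)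
    refine ⟨G, hG, ?_, fun p => ENNReal.ofReal (mean fun y => Φ (c * ‖u₀ p.1 p.2 y‖)) +
      ENNReal.ofReal (h p), ?_, ?_, ?_⟩
    · filter_upwards [hE h3, hG.integrable_trace, H.eventually_mem] with ε hε3 hint ⟨hεE, hε0⟩
      have h4 : ∫⁻ p, ‖u ε p.1 p.2 * (trace T ε₁ ε₂ F ε p.1 p.2 -
          trace T ε₁ ε₂ G ε p.1 p.2)‖ₑ ∂(measQ Q μ) ≤ ENNReal.ofReal κ := by
        rw [← hκ2]
        exact (hP.lintegral_mul_le (H.meas ε hεE) hc).trans (add_le_add (h1 ε hεE) hε3)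
      have h5 : Integrable (fun p : Rd d × Ω => u ε p.1 p.2 * (trace T ε₁ ε₂ F ε p.1 p.2 -
          trace T ε₁ ε₂ G ε p.1 p.2)) (measQ Q μ) :=
        ⟨(H.meas ε hεE).mul ((htr ε hε0).sub (hG.trace_meas ε hε0)),
          h4.trans_lt ENNReal.ofReal_lt_top⟩
      have h6 : Integrable (fun p : Rd d × Ω => u ε p.1 p.2 * trace T ε₁ ε₂ F ε p.1 p.2)
          (measQ Q μ) := by
        refine (h5.add hint).congr (Eventually.of_forall fun p => ?_)
        simp only [Pi.add_apply]; ring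
      refine ⟨h6, norm_integral_sub_le_of_lintegral h6 hint hκ.le ?_⟩
      simpa only [mul_sub] using h4
    · exact (H.limit_mem.aestronglyMeasurable_mean_phi H.supralgebra H.scale₁ hP.left
        hc).aemeasurable.ennreal_ofReal.add hhm.ennreal_ofReal
    · rw [lintegral_add_right' _ hhm.ennreal_ofReal, ← hκ2]
      exact add_le_add h2 hhκ
    · filter_upwards [hhb, H.limit_mx, hmx, hG.mx] with p hp1 hp2 hp3 hp4
      have h5 := hp2.norm_mean_mul_sub_le H.supralgebra H.scale₁ hP hp3 hp4 hc (hh0 p) hp1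
      rw [← ENNReal.ofReal_add (hp2.mean_phi_nonneg H.supralgebra H.scale₁ hP.left hc) (hh0 p),
        ← ofReal_norm]
      exact ENNReal.ofReal_le_ofReal h5
  -- Measurability of the mean for `F` is not given. Taking `κ = 2⁻ⁿ`, the error bounds have
  -- summable integrals, so they tend to zero almost everywhere and the mean is an almost everywhere
  -- limit of measurable means.
  have hmeas : AEStronglyMeasurable
      (fun p : Rd d × Ω => mean fun y => u₀ p.1 p.2 y * F p.1 p.2 y) (measQ Q μ) := by
    choose! G hG _ b hbm hbκ hbF using key
    have hpos : ∀ n : ℕ, (0 : ℝ) < (1 / 2) ^ n := fun n => by positivity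
    have hsum : ∫⁻ p, ∑' n : ℕ, b ((1 / 2) ^ n) p ∂(measQ Q μ) ≠ ∞ := by
      rw [lintegral_tsum fun n => hbm _ (hpos n)]
      refine ne_top_of_le_ne_top ?_ (ENNReal.tsum_le_tsum fun n => hbκ _ (hpos n))
      rw [← ENNReal.ofReal_tsum_of_nonneg (fun n => (hpos n).le) summable_geometric_two]
      exact ENNReal.ofReal_ne_top
    have hlim : ∀ᵐ p ∂(measQ Q μ), Tendsto (fun n : ℕ => b ((1 / 2) ^ n) p) atTop (𝓝 0) := by
      filter_upwards [ae_lt_top' (AEMeasurable.tsum fun n => hbm _ (hpos n)) hsum]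
        with p hp
      exact ENNReal.tendsto_atTop_zero_of_tsum_ne_top hp.ne
    refine aestronglyMeasurable_of_tendsto_ae atTop
      (f := fun (n : ℕ) (p : Rd d × Ω) => mean fun y => u₀ p.1 p.2 y * G ((1 / 2) ^ n) p.1 p.2 y)
      (fun n => (hG _ (hpos n)).integrable_mean.aestronglyMeasurable) ?_
    filter_upwards [hlim, ae_all_iff.2 fun n : ℕ => hbF _ (hpos n)] with p hp1 hp2
    rw [tendsto_iff_edist_tendsto_0]
    refine tendsto_of_tendsto_of_tendsto_of_le_of_le tendsto_const_nhds hp1 (fun _ => zero_le)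
      fun n => ?_
    dsimp only
    rw [edist_comm, edist_eq_enorm_sub]
    exact hp2 n
  have hint : ∀ κ : ℝ, 0 < κ → ∃ G, IsPairable Q T ε₁ ε₂ A Ψ E u u₀ G ∧
      (∀ᶠ ε in 𝓝[E] 0,
        Integrable (fun p : Rd d × Ω => u ε p.1 p.2 * trace T ε₁ ε₂ F ε p.1 p.2) (measQ Q μ) ∧
        ‖∫ p, u ε p.1 p.2 * trace T ε₁ ε₂ F ε p.1 p.2 ∂(measQ Q μ) -
          ∫ p, u ε p.1 p.2 * trace T ε₁ ε₂ G ε p.1 p.2 ∂(measQ Q μ)‖ ≤ κ) ∧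
      Integrable (fun p : Rd d × Ω => mean fun y => u₀ p.1 p.2 y * F p.1 p.2 y) (measQ Q μ) ∧
      ‖∫ p, (mean fun y => u₀ p.1 p.2 y * F p.1 p.2 y) ∂(measQ Q μ) -
        ∫ p, (mean fun y => u₀ p.1 p.2 y * G p.1 p.2 y) ∂(measQ Q μ)‖ ≤ κ := by
    intro κ hκ
    obtain ⟨G, hG, h1, b, hbm, hbκ, hb⟩ := key κ hκ
    have h2 : ∫⁻ p, ‖(mean fun y => u₀ p.1 p.2 y * F p.1 p.2 y) -
          mean fun y => u₀ p.1 p.2 y * G p.1 p.2 y‖ₑ ∂(measQ Q μ) ≤ ENNReal.ofReal κ :=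
      (lintegral_mono_ae hb).trans hbκ
    have h3 : Integrable (fun p : Rd d × Ω => (mean fun y => u₀ p.1 p.2 y * F p.1 p.2 y) -
        mean fun y => u₀ p.1 p.2 y * G p.1 p.2 y) (measQ Q μ) :=
      ⟨hmeas.sub hG.integrable_mean.aestronglyMeasurable, h2.trans_lt ENNReal.ofReal_lt_top⟩
    have h4 : Integrable (fun p : Rd d × Ω => mean fun y => u₀ p.1 p.2 y * F p.1 p.2 y)
        (measQ Q μ) := by
      refine (h3.add hG.integrable_mean).congr (Eventually.of_forall fun p => ?_)
      simp only [Pi.add_apply, sub_add_cancel]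
    exact ⟨G, hG, h1, h4, norm_integral_sub_le_of_lintegral h4 hG.integrable_mean hκ.le h2⟩
  obtain ⟨G₁, -, hG₁, hG₁', -⟩ := hint 1 one_pos
  refine ⟨htr, hG₁.mono fun ε h => h.1, hmx, hG₁', ?_⟩
  rw [PairingConverges, Metric.tendsto_nhds]
  intro η hη
  obtain ⟨G, hG, h1, -, h2⟩ := hint (η / 4) (by positivity)
  filter_upwards [h1, (Metric.tendsto_nhds.1 hG.converges) (η / 4) (by positivity)]
    with ε hε1 hε2
  have h3 := hε1.2
  rw [← dist_eq_norm] at h2 h3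
  have h4 := dist_triangle4
    (∫ p, u ε p.1 p.2 * trace T ε₁ ε₂ F ε p.1 p.2 ∂(measQ Q μ))
    (∫ p, u ε p.1 p.2 * trace T ε₁ ε₂ G ε p.1 p.2 ∂(measQ Q μ))
    (∫ p, (mean fun y => u₀ p.1 p.2 y * G p.1 p.2 y) ∂(measQ Q μ))
    (∫ p, (mean fun y => u₀ p.1 p.2 y * F p.1 p.2 y) ∂(measQ Q μ))
  rw [dist_comm (∫ p, (mean fun y => u₀ p.1 p.2 y * G p.1 p.2 y) ∂(measQ Q μ))] at h4
  linarith

theorem lintegral_ballMeas_le {h : Rd d → ℝ≥0∞} {C : ℝ≥0∞} (hh : ∀ᵐ y, h y ≤ C) {R : ℝ}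
    (hR : 0 < R) : ∫⁻ y, h y ∂(ballMeas d R) ≤ C := by
  have := isProbabilityMeasure_ballMeas (d := d) hR
  calc _ ≤ ∫⁻ _, C ∂(ballMeas d R) := lintegral_mono_ae ((ballMeas_ac R).ae_le hh)
    _ = C := by simp

/-- When the error is bounded by `h(x, ω)` uniformly in `y`, the trace error is bounded by `h`
composed with the shift, whose modular is that of `h` for every `ε`. -/
theorem IsPairable.of_sup_approx (H : PairingData Q T ε₁ ε₂ A Φ Ψ E u u₀)
    (htr : ∀ ε, 0 < ε →
      AEStronglyMeasurable (fun p : Rd d × Ω => trace T ε₁ ε₂ F ε p.1 p.2) (measQ Q μ))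
    (hmx : ∀ᵐ p ∂(measQ Q μ), MX Ψ A (F p.1 p.2))
    (happ : ∀ κ c : ℝ, 0 < κ → 0 < c → ∃ G, IsPairable Q T ε₁ ε₂ A Ψ E u u₀ G ∧
      ∃ h : Rd d × Ω → ℝ, (∀ p, 0 ≤ h p) ∧ AEStronglyMeasurable h (measQ Q μ) ∧
        ∫⁻ p, ENNReal.ofReal (Ψ (c * h p)) ∂(measQ Q μ) ≤ ENNReal.ofReal κ ∧
        (∀ᵐ p ∂(measQ Q μ), ∀ᵐ y, ‖F p.1 p.2 y - G p.1 p.2 y‖ ≤ h p) ∧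
        ∀ ε, 0 < ε → ∀ᵐ p ∂(measQ Q μ), ‖trace T ε₁ ε₂ F ε p.1 p.2 -
          trace T ε₁ ε₂ G ε p.1 p.2‖ ≤ h (T.shift (ε₁ ε)⁻¹ p)) :
    IsPairable Q T ε₁ ε₂ A Ψ E u u₀ F := by
  have hΨ := H.youngPair.right
  refine IsPairable.of_approx H htr hmx fun κ c hκ hc => ?_
  obtain ⟨G, hG, h, hh0, hhm, hhκ, hFG, hFGt⟩ := happ κ c hκ hc
  refine ⟨G, hG, ?_, fun p => Ψ (c * h p),
    fun p => hΨ.nonneg _ (mul_nonneg hc.le (hh0 p)), ?_, hhκ, ?_⟩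
  · filter_upwards [self_mem_nhdsWithin] with ε hε
    have hε : 0 < ε := hε
    have hr : (ε₁ ε)⁻¹ ≠ 0 := inv_ne_zero (H.scale₁.pos ε hε).ne'
    rw [← T.lintegral_shift hr (h := fun p => ENNReal.ofReal (Ψ (c * h p)))
      (hΨ.aemeasurable_ofReal (hhm.const_mul c)
      fun p => mul_nonneg hc.le (hh0 p))] at hhκ
    refine (lintegral_mono_ae ?_).trans hhκ
    filter_upwards [hFGt ε hε] with p hp
    exact ENNReal.ofReal_le_ofReal (hΨ.mono (by positivity) (by gcongr))
  · exact (hΨ.aestronglyMeasurable_comp (hhm.const_mul c)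
      fun p => mul_nonneg hc.le (hh0 p)).aemeasurable
  · filter_upwards [hFG] with p hp
    filter_upwards [eventually_gt_atTop 0] with R hR
    refine lintegral_ballMeas_le ?_ hR
    filter_upwards [hp] with y hy
    exact ENNReal.ofReal_le_ofReal (hΨ.mono (by positivity) (by gcongr))

/-- Additivity of traces is a hypothesis, because `pointValue` is a default value where averages do
not converge, and it need not be additive there. -/
theorem IsPairable.add_const_mul (H : PairingData Q T ε₁ ε₂ A Φ Ψ E u u₀)
    (hF : IsPairable Q T ε₁ ε₂ A Ψ E u u₀ F) (hG : IsPairable Q T ε₁ ε₂ A Ψ E u u₀ G) (s : ℂ)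
    (hFG : ∀ᵐ p ∂(measQ Q μ), MX Ψ A (fun y => F p.1 p.2 y + s * G p.1 p.2 y))
    (htr : ∀ ε, 0 < ε → ∀ x ω, trace T ε₁ ε₂ (fun x ω y => F x ω y + s * G x ω y) ε x ω =
      trace T ε₁ ε₂ F ε x ω + s * trace T ε₁ ε₂ G ε x ω) :
    IsPairable Q T ε₁ ε₂ A Ψ E u u₀ (fun x ω y => F x ω y + s * G x ω y) := by
  have hmean : ∀ᵐ p ∂(measQ Q μ), (mean fun y => u₀ p.1 p.2 y * F p.1 p.2 y) +
      s * (mean fun y => u₀ p.1 p.2 y * G p.1 p.2 y) =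
      mean fun y => u₀ p.1 p.2 y * (F p.1 p.2 y + s * G p.1 p.2 y) := by
    filter_upwards [H.limit_mx, hF.mx, hG.mx] with p h0 h1 h2
    refine (HasBallMean.mean_eq ?_).symm
    refine ((h0.hasBallMean_mul H.supralgebra H.scale₁ H.youngPair h1).add
      ((h0.hasBallMean_mul H.supralgebra H.scale₁ H.youngPair h2).const_mul s)).congr' ?_
    filter_upwards [eventually_ge_atTop 1] with R hR
    rw [← integral_const_mul, ← integral_add (h0.integrable_mul H.youngPair h1 hR)
      ((h0.integrable_mul H.youngPair h2 hR).const_mul s)]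
    refine integral_congr_ae (Eventually.of_forall fun y => ?_)
    dsimp only
    ring
  refine ⟨fun ε hε => ?_, ?_, hFG, ?_, ?_⟩
  · simp only [htr ε hε]
    exact (hF.trace_meas ε hε).add ((hG.trace_meas ε hε).const_mul s)
  · filter_upwards [hF.integrable_trace, hG.integrable_trace, H.eventually_mem]
      with ε h1 h2 ⟨_, hε⟩
    simp only [htr ε hε]
    refine (h1.add (h2.const_mul s)).congr (Eventually.of_forall fun p => ?_)
    simp only [Pi.add_apply]
    ring
  · exact (hF.integrable_mean.add (hG.integrable_mean.const_mul s)).congr hmean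
  · have h1 := hF.converges.add (hG.converges.const_mul s)
    rw [← integral_const_mul, ← integral_add hF.integrable_mean
      (hG.integrable_mean.const_mul s), integral_congr_ae hmean] at h1
    refine h1.congr' ?_
    filter_upwards [hF.integrable_trace, hG.integrable_trace, H.eventually_mem]
      with ε h1 h2 ⟨_, hε⟩
    rw [← integral_const_mul, ← integral_add h1 (h2.const_mul s)]
    refine integral_congr_ae (Eventually.of_forall fun p => ?_)
    simp only [htr ε hε]
    ring

theorem trace_congr (h : ∀ x ω, F x ω =ᵐ[volume] G x ω) (ε : ℝ) (x : Rd d) (ω : Ω) :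
    trace T ε₁ ε₂ F ε x ω = trace T ε₁ ε₂ G ε x ω :=
  pointValue_congr (h _ _) _

theorem mean_congr_ae {v w : Rd d → ℂ} (h : v =ᵐ[volume] w) : mean v = mean w := by
  unfold mean
  congr 1
  ext1 r
  exact average_congr (ae_restrict_of_ae h)

theorem IsPairable.congr (hF : IsPairable Q T ε₁ ε₂ A Ψ E u u₀ F)
    (h : ∀ x ω, F x ω =ᵐ[volume] G x ω) : IsPairable Q T ε₁ ε₂ A Ψ E u u₀ G := by
  have h1 : ∀ ε x ω, trace T ε₁ ε₂ G ε x ω = trace T ε₁ ε₂ F ε x ω := fun ε x ω =>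
    (trace_congr h ε x ω).symm
  have h2 : ∀ x ω, (mean fun y => u₀ x ω y * G x ω y) = mean fun y => u₀ x ω y * F x ω y := by
    intro x ω
    refine mean_congr_ae ?_
    filter_upwards [h x ω] with y hy
    rw [hy]
  refine ⟨?_, ?_, ?_, ?_, ?_⟩
  · simpa only [h1] using hF.trace_meas
  · simpa only [h1] using hF.integrable_trace
  · filter_upwards [hF.mx] with p hp
    exact hp.congr (h _ _)
  · simpa only [h2] using hF.integrable_mean
  · have := hF.converges
    unfold PairingConverges at this ⊢
    simpa only [h1, h2] using this

end Core

/-! ### Elementary tensors and indicators -/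

section Chain

variable {d : ℕ} {Ω : Type*} [MeasurableSpace Ω] {μ : Measure Ω} [IsProbabilityMeasure μ]
  {T : DynSystem d μ} {Q : Set (Rd d)} {ε₁ ε₂ : ℝ → ℝ} {A : StarSubalgebra ℂ (Rd d →ᵇ ℂ)}
  {Φ Ψ : ℝ → ℝ} {E : Set ℝ} {u : ℝ → Rd d → Ω → ℂ} {u₀ F G : Rd d → Ω → Rd d → ℂ}

theorem measQ_cylinder_le (Q K : Set (Rd d)) : measQ Q μ (K ×ˢ univ) ≤ volume K := by
  rw [Measure.prod_prod, measure_univ, mul_one]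
  exact Measure.restrict_apply_le Q K

theorem measQ_cylinder_lt_top (Q : Set (Rd d)) {K : Set (Rd d)} (hK : IsCompact K) :
    measQ Q μ (K ×ˢ univ) < ∞ :=
  (measQ_cylinder_le Q K).trans_lt hK.measure_lt_top

theorem YoungFn.lintegral_le_of_bounded (hΨ : YoungFn Ψ) {K : Set (Rd d)} (hK : IsCompact K)
    {v : Rd d × Ω → ℂ} {C c : ℝ} (hc : 0 ≤ c) (hC : ∀ᵐ p ∂(measQ Q μ), ‖v p‖ ≤ C)
    (hv : ∀ᵐ p ∂(measQ Q μ), p.1 ∉ K → v p = 0) :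
    ∫⁻ p, ENNReal.ofReal (Ψ (c * ‖v p‖)) ∂(measQ Q μ) ≤
      ENNReal.ofReal (Ψ (c * C)) * volume K := by
  have hKm : MeasurableSet (K ×ˢ (univ : Set Ω)) := hK.measurableSet.prod MeasurableSet.univ
  calc _ ≤ ∫⁻ p, (K ×ˢ (univ : Set Ω)).indicator (fun _ => ENNReal.ofReal (Ψ (c * C))) p
        ∂(measQ Q μ) := by
        refine lintegral_mono_ae ?_
        filter_upwards [hC, hv] with p h1 h2
        by_cases hp : p.1 ∈ K
        · rw [indicator_of_mem (by exact ⟨hp, mem_univ _⟩)]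
          exact ENNReal.ofReal_le_ofReal (hΨ.mono (by positivity) (by gcongr))
        · simp [h2 hp, hΨ.zero]
    _ = ENNReal.ofReal (Ψ (c * C)) * measQ Q μ (K ×ˢ univ) := lintegral_indicator_const hKm _
    _ ≤ _ := by gcongr; exact measQ_cylinder_le Q K

theorem trace_elementary (φ : Rd d → ℂ) (ψ : Ω → ℂ) (g : Rd d →ᵇ ℂ) (ε : ℝ) (x : Rd d) (ω : Ω) :
    trace T ε₁ ε₂ (fun x ω y => φ x * ψ ω * g y) ε x ω =
      φ x * ψ (T.toFun ((ε₁ ε)⁻¹ • x) ω) * g ((ε₂ ε)⁻¹ • x) :=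
  pointValue_of_continuous _ (continuous_const.mul g.continuous) _

theorem IsTestFunction.elementary {φ : Rd d → ℂ} {ψ : Ω → ℂ} {g : Rd d →ᵇ ℂ}
    (hφ : ContDiff ℝ ((⊤ : ℕ∞) : WithTop ℕ∞) φ) (hφc : HasCompactSupport φ) (hφQ : tsupport φ ⊆ Q)
    (hψ : IsStochSmooth T ψ) (hg : g ∈ A) :
    IsTestFunction Q T A (fun x ω y => φ x * ψ ω * g y) :=
  ⟨1, fun _ => φ, fun _ => ψ, fun _ => g, fun _ => ⟨hφ, hφc, hφQ⟩, fun _ => hψ, fun _ => hg,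
    by simp⟩

theorem IsStochSmooth.memLp {ψ : Ω → ℂ} (h : IsStochSmooth T ψ) : MemLp ψ ∞ μ := by
  obtain ⟨D, hD0, hD, -⟩ := h
  rw [← hD0]
  exact hD 0

theorem exists_ae_bound_of_memLp_top {α : Type*} [MeasurableSpace α] {m : Measure α} {ψ : α → ℂ}
    (h : MemLp ψ ∞ m) : ∃ C : ℝ, 0 ≤ C ∧ ∀ᵐ ω ∂m, ‖ψ ω‖ ≤ C := by
  refine ⟨(eLpNorm ψ ∞ m).toReal, ENNReal.toReal_nonneg, ?_⟩
  filter_upwards [ae_le_eLpNormEssSup (f := ψ) (μ := m)] with ω hω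
  rw [← toReal_enorm]
  exact ENNReal.toReal_mono h.2.ne (by rwa [eLpNorm_exponent_top])

theorem aestronglyMeasurable_trace_elementary {φ : Rd d → ℂ} (hφ : Continuous φ) {ψ : Ω → ℂ}
    (hψ : AEStronglyMeasurable ψ μ) (g : Rd d →ᵇ ℂ) {r s : ℝ} (hr : r ≠ 0) :
    AEStronglyMeasurable (fun p : Rd d × Ω => φ p.1 * ψ (T.toFun (r • p.1) p.2) * g (s • p.1))
      (measQ Q μ) := by
  have h1 : AEStronglyMeasurable (fun p : Rd d × Ω => φ p.1) (measQ Q μ) :=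
    (hφ.measurable.comp measurable_fst).aestronglyMeasurable
  have h2 : AEStronglyMeasurable (fun p : Rd d × Ω => ψ p.2) (measQ Q μ) :=
    hψ.comp_quasiMeasurePreserving Measure.quasiMeasurePreserving_snd
  have h3 : AEStronglyMeasurable (fun p : Rd d × Ω => g (s • p.1)) (measQ Q μ) :=
    ((g.continuous.comp (continuous_const_smul s)).measurable.comp
      measurable_fst).aestronglyMeasurable
  exact (h1.mul (T.aestronglyMeasurable_shift hr h2)).mul h3

theorem ae_snd {P : Ω → Prop} (h : ∀ᵐ ω ∂μ, P ω) : ∀ᵐ p ∂(measQ Q μ), P p.2 :=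
  Measure.quasiMeasurePreserving_snd.ae h

theorem exists_bound_elementary {φ : Rd d → ℂ} (hφ : Continuous φ) (hφc : HasCompactSupport φ)
    {ψ : Ω → ℂ} (hψ : MemLp ψ ∞ μ) (g : Rd d →ᵇ ℂ) :
    ∃ C : ℝ, 0 ≤ C ∧ ∀ᵐ p ∂(measQ Q μ), ∀ y, ‖φ p.1 * ψ p.2 * g y‖ ≤ C := by
  obtain ⟨C₁, hC₁⟩ := hφ.bounded_above_of_compact_support hφc
  obtain ⟨C₂, hC₂0, hC₂⟩ := exists_ae_bound_of_memLp_top hψ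
  have hC₁0 : 0 ≤ C₁ := (norm_nonneg _).trans (hC₁ 0)
  refine ⟨C₁ * C₂ * ‖g‖, by positivity, ?_⟩
  filter_upwards [ae_snd (Q := Q) hC₂] with p hp y
  rw [norm_mul, norm_mul]
  gcongr
  · exact hC₁ _
  · exact g.norm_coe_le_norm y

/-- Convergence is the hypothesis on test functions. What remains is integrability, which Young's
inequality reduces to boundedness and compact support. -/
theorem IsPairable.elementary (H : PairingData Q T ε₁ ε₂ A Φ Ψ E u u₀) {φ : Rd d → ℂ} {ψ : Ω → ℂ}
    {g : Rd d →ᵇ ℂ}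
    (hφ : ContDiff ℝ ((⊤ : ℕ∞) : WithTop ℕ∞) φ) (hφc : HasCompactSupport φ) (hφQ : tsupport φ ⊆ Q)
    (hψ : IsStochSmooth T ψ) (hg : g ∈ A) :
    IsPairable Q T ε₁ ε₂ A Ψ E u u₀ (fun x ω y => φ x * ψ ω * g y) := by
  have hP := H.youngPair
  have hgX : MX Ψ A g := MX.of_mem hP.right hg
  obtain ⟨C, hC0, hC⟩ := exists_bound_elementary (Q := Q) hφ.continuous hφc hψ.memLp g
  have hK : IsCompact (tsupport φ) := hφc
  obtain ⟨c, hc, hcu, hcu0⟩ := H.exists_small one_pos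
  have hmx : ∀ p : Rd d × Ω, MX Ψ A (fun y => φ p.1 * ψ p.2 * g y) := fun p =>
    hgX.const_mul hP.right _
  have hfin : ENNReal.ofReal (Ψ (c⁻¹ * C)) * volume (tsupport φ) < ∞ :=
    ENNReal.mul_lt_top ENNReal.ofReal_lt_top hK.measure_lt_top
  have htm : ∀ ε, 0 < ε → AEStronglyMeasurable (fun p : Rd d × Ω =>
      trace T ε₁ ε₂ (fun x ω y => φ x * ψ ω * g y) ε p.1 p.2) (measQ Q μ) := fun ε hε => by
    simp only [trace_elementary]
    exact aestronglyMeasurable_trace_elementary hφ.continuous hψ.memLp.1 g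
      (inv_ne_zero (H.scale₁.pos ε hε).ne')
  refine ⟨htm, ?_, Eventually.of_forall hmx, ?_, H.pairing _ (.elementary hφ hφc hφQ hψ hg)⟩
  · filter_upwards [H.eventually_mem] with ε ⟨hεE, hε⟩
    refine ⟨(H.meas ε hεE).mul (htm ε hε), ?_⟩
    refine (hP.lintegral_mul_le (H.meas ε hεE) hc).trans_lt (ENNReal.add_lt_top.2
      ⟨(hcu ε hεE).trans_lt ENNReal.ofReal_lt_top, ?_⟩)
    refine (hP.right.lintegral_le_of_bounded hK (inv_pos.2 hc).le (C := C) ?_ ?_).trans_lt hfin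
    · filter_upwards [T.ae_shift (inv_ne_zero (H.scale₁.pos ε hε).ne') hC] with p hp
      rw [trace_elementary]
      exact hp _
    · refine Eventually.of_forall fun p hp => ?_
      rw [trace_elementary, image_eq_zero_of_notMem_tsupport hp, zero_mul, zero_mul]
  · have hmean : ∀ᵐ p ∂(measQ Q μ), (mean fun y => u₀ p.1 p.2 y * (φ p.1 * ψ p.2 * g y)) =
        φ p.1 * ψ p.2 * mean fun y => u₀ p.1 p.2 y * g y := by
      filter_upwards [H.limit_mx] with p hp
      refine HasBallMean.mean_eq ?_
      refine ((hp.hasBallMean_mul H.supralgebra H.scale₁ hP hgX).const_mul _).congr fun R => ?_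
      rw [← integral_const_mul]
      refine integral_congr_ae (Eventually.of_forall fun y => ?_)
      dsimp only
      ring
    have h1 : AEStronglyMeasurable (fun p : Rd d × Ω => φ p.1) (measQ Q μ) :=
      (hφ.continuous.measurable.comp measurable_fst).aestronglyMeasurable
    have h2 : AEStronglyMeasurable (fun p : Rd d × Ω => ψ p.2) (measQ Q μ) :=
      hψ.memLp.1.comp_quasiMeasurePreserving Measure.quasiMeasurePreserving_snd
    have hm := ((h1.mul h2).mul (H.limit_mem.aestronglyMeasurable_mean_mul H.supralgebra H.scale₁
      hP hgX)).congr (hmean.mono fun p hp => hp.symm)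
    refine ⟨hm, ?_⟩
    -- Replacing `g(y)` by the constant `‖g‖` gives a majorant depending on `(x, ω)` only.
    have hv0 : ∀ p : Rd d × Ω, 0 ≤ Ψ (c⁻¹ * ‖φ p.1 * ψ p.2 * (‖g‖ : ℂ)‖) := fun p =>
      hP.right.nonneg _ (by positivity)
    have hbound : ∀ᵐ p ∂(measQ Q μ),
        ‖mean fun y => u₀ p.1 p.2 y * (φ p.1 * ψ p.2 * g y)‖ₑ ≤
          ENNReal.ofReal (mean fun y => Φ (c * ‖u₀ p.1 p.2 y‖)) +
          ENNReal.ofReal (Ψ (c⁻¹ * ‖φ p.1 * ψ p.2 * (‖g‖ : ℂ)‖)) := by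
      filter_upwards [H.limit_mx] with p hp
      have h3 := hp.norm_mean_mul_sub_le H.supralgebra H.scale₁ hP (hmx p)
        (MX.of_mem hP.right (zero_mem A)) hc (hv0 p) (by
          filter_upwards [eventually_gt_atTop 0] with R hR
          refine lintegral_ballMeas_le (Eventually.of_forall fun y => ?_) hR
          refine ENNReal.ofReal_le_ofReal (hP.right.mono (by positivity) ?_)
          simp only [BoundedContinuousFunction.coe_zero, Pi.zero_apply, sub_zero, norm_mul,
            Complex.norm_real, norm_norm]
          gcongr
          exact g.norm_coe_le_norm y)
      have h4 : (mean fun y => u₀ p.1 p.2 y * (0 : Rd d →ᵇ ℂ) y) = 0 := by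
        refine HasBallMean.mean_eq ?_
        simp [HasBallMean]
      rw [h4, sub_zero] at h3
      rw [← ENNReal.ofReal_add (hp.mean_phi_nonneg H.supralgebra H.scale₁ hP.left hc) (hv0 p),
        ← ofReal_norm]
      exact ENNReal.ofReal_le_ofReal h3
    refine (lintegral_mono_ae hbound).trans_lt ?_
    rw [lintegral_add_left' (H.limit_mem.aestronglyMeasurable_mean_phi H.supralgebra H.scale₁
      hP.left hc).aemeasurable.ennreal_ofReal]
    refine ENNReal.add_lt_top.2 ⟨hcu0.trans_lt ENNReal.ofReal_lt_top, ?_⟩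
    obtain ⟨C', hC'0, hC'⟩ := exists_bound_elementary (Q := Q) hφ.continuous hφc hψ.memLp
      (BoundedContinuousFunction.const (Rd d) (‖g‖ : ℂ))
    refine (hP.right.lintegral_le_of_bounded hK (inv_pos.2 hc).le (C := C') ?_ ?_).trans_lt
      (ENNReal.mul_lt_top ENNReal.ofReal_lt_top hK.measure_lt_top)
    · filter_upwards [hC'] with p hp
      exact hp 0
    · refine Eventually.of_forall fun p hp => ?_
      rw [image_eq_zero_of_notMem_tsupport hp, zero_mul, zero_mul]

/-- The function `(x, ω, y) ↦ 1_C(x, ω) w(y)`. -/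
def indMul (C : Set (Rd d × Ω)) (w : Rd d → ℂ) : Rd d → Ω → Rd d → ℂ :=
  fun x ω y => C.indicator 1 (x, ω) * w y

theorem trace_indMul (C : Set (Rd d × Ω)) (w : Rd d → ℂ) (ε : ℝ) (x : Rd d) (ω : Ω) :
    trace T ε₁ ε₂ (indMul C w) ε x ω =
      C.indicator 1 (T.shift (ε₁ ε)⁻¹ (x, ω)) * pointValue w ((ε₂ ε)⁻¹ • x) := by
  unfold trace indMul
  simp only [DynSystem.shift]
  by_cases h : (x, T.toFun ((ε₁ ε)⁻¹ • x) ω) ∈ C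
  · simp [indicator_of_mem h]
  · simp [indicator_of_notMem h, pointValue_zero]

theorem norm_indicator_one_le {α : Type*} (C : Set α) (p : α) :
    ‖(C.indicator 1 p : ℂ)‖ ≤ 1 := by
  by_cases h : p ∈ C
  · simp [indicator_of_mem h]
  · simp [indicator_of_notMem h]

theorem aestronglyMeasurable_trace_indMul (hε₁ : IsScale ε₁) (hε₂ : IsScale ε₂)
    {C : Set (Rd d × Ω)} (hC : MeasurableSet C) {w : Rd d → ℂ} (hw : LocallyIntegrable w volume)
    {ε : ℝ} (hε : 0 < ε) :
    AEStronglyMeasurable (fun p : Rd d × Ω => trace T ε₁ ε₂ (indMul C w) ε p.1 p.2)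
      (measQ Q μ) := by
  simp only [trace_indMul]
  have h1 : AEStronglyMeasurable (fun p : Rd d × Ω => (C.indicator 1 p : ℂ)) (measQ Q μ) :=
    (measurable_one.indicator hC).aestronglyMeasurable
  have hr₂ := inv_ne_zero (hε₂.pos ε hε).ne'
  have h2 : Measure.QuasiMeasurePreserving (fun p : Rd d × Ω => (ε₂ ε)⁻¹ • p.1) (measQ Q μ)
      volume :=
    (Measure.quasiMeasurePreserving_smul (volume : Measure (Rd d)) hr₂).comp
      (Measure.quasiMeasurePreserving_fst.mono_right Measure.absolutelyContinuous_restrict)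
  refine (T.aestronglyMeasurable_shift (inv_ne_zero (hε₁.pos ε hε).ne') h1).mul ?_
  exact (hw.aestronglyMeasurable.congr (pointValue_ae_eq hw).symm).comp_quasiMeasurePreserving h2

theorem MX.indMul (hΨ : YoungFn Ψ) {w : Rd d → ℂ} (hw : MX Ψ A w) (C : Set (Rd d × Ω)) (x : Rd d)
    (ω : Ω) : MX Ψ A (indMul C w x ω) :=
  hw.const_mul hΨ _

end Chain

/-! ### From rectangles to measurable sets, and from `A` to its closure -/

section Chain

variable {d : ℕ} {Ω : Type*} [MeasurableSpace Ω] {μ : Measure Ω} [IsProbabilityMeasure μ]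
  {T : DynSystem d μ} {Q : Set (Rd d)} {ε₁ ε₂ : ℝ → ℝ} {A : StarSubalgebra ℂ (Rd d →ᵇ ℂ)}
  {Φ Ψ : ℝ → ℝ} {E : Set ℝ} {u : ℝ → Rd d → Ω → ℂ} {u₀ F G : Rd d → Ω → Rd d → ℂ}

theorem locallyIntegrable_bcf (g : Rd d →ᵇ ℂ) : LocallyIntegrable g volume :=
  g.continuous.locallyIntegrable

/-- By convexity, `L¹` smallness of functions bounded by two gives modular smallness. -/
theorem YoungFn.lintegral_bounded_mul_le (hΨ : YoungFn Ψ) {α : Type*} [MeasurableSpace α]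
    {m : Measure α} {z : α → ℂ} (hz : ∀ a, ‖z a‖ ≤ 2) {c b : ℝ} (hc : 0 ≤ c) (hb : 0 ≤ b) :
    ∫⁻ a, ENNReal.ofReal (Ψ (c * (‖z a‖ * b))) ∂m ≤
      ENNReal.ofReal (Ψ (2 * c * b)) * ∫⁻ a, ‖z a‖ₑ ∂m := by
  rw [← lintegral_const_mul' _ _ ENNReal.ofReal_ne_top]
  refine lintegral_mono fun a => ?_
  dsimp only
  rw [← ofReal_norm, ← ENNReal.ofReal_mul (hΨ.nonneg _ (by positivity))]
  refine ENNReal.ofReal_le_ofReal ?_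
  have h1 := hΨ.smul_le (s := ‖z a‖ / 2) (t := 2 * c * b) (by positivity)
    (by linarith [hz a]) (by positivity)
  have h2 : ‖z a‖ / 2 * (2 * c * b) = c * (‖z a‖ * b) := by ring
  rw [h2] at h1
  refine h1.trans ?_
  rw [mul_comm]
  have h3 := hΨ.nonneg (2 * c * b) (by positivity)
  exact mul_le_mul_of_nonneg_left (by linarith [norm_nonneg (z a)]) h3

/-- From `1_D 1_B - φψ = 1_D (1_B - ψ) + (1_D - φ) ψ` and `|ψ| ≤ 1`. -/
theorem lintegral_rectangle_sub_le {D : Set (Rd d)} {B : Set Ω} (hD : MeasurableSet D)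
    (hB : MeasurableSet B) {φ : Rd d → ℂ} (hφ : Continuous φ) {ψ : Ω → ℂ}
    (hψm : AEStronglyMeasurable ψ μ) (hψ : ∀ ω, ‖ψ ω‖ ≤ 1) :
    ∫⁻ p, ‖(D ×ˢ B).indicator 1 p - φ p.1 * ψ p.2‖ₑ ∂(measQ Q μ) ≤
      volume D * ∫⁻ ω, ‖B.indicator 1 ω - ψ ω‖ₑ ∂μ + ∫⁻ x, ‖D.indicator 1 x - φ x‖ₑ := by
  have hDm : Measurable (D.indicator (1 : Rd d → ℂ)) := measurable_one.indicator hD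
  have h1 : ∀ p : Rd d × Ω, ‖((D ×ˢ B).indicator 1 p : ℂ) - φ p.1 * ψ p.2‖ₑ ≤
      ‖(D.indicator 1 p.1 : ℂ)‖ₑ * ‖B.indicator 1 p.2 - ψ p.2‖ₑ +
        ‖D.indicator 1 p.1 - φ p.1‖ₑ * 1 := by
    intro p
    have h2 : ((D ×ˢ B).indicator 1 p : ℂ) - φ p.1 * ψ p.2 =
        D.indicator 1 p.1 * (B.indicator 1 p.2 - ψ p.2) +
          (D.indicator 1 p.1 - φ p.1) * ψ p.2 := by
      have h3 : ((D ×ˢ B).indicator 1 p : ℂ) = D.indicator 1 p.1 * B.indicator 1 p.2 := by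
        by_cases h4 : p.1 ∈ D <;> by_cases h5 : p.2 ∈ B <;>
          simp [indicator, h4, h5, mem_prod]
      rw [h3]; ring
    rw [h2]
    refine (enorm_add_le _ _).trans ?_
    rw [enorm_mul, enorm_mul]
    gcongr
    rw [← ofReal_norm]
    exact ENNReal.ofReal_le_one.2 (hψ _)
  refine (lintegral_mono h1).trans ?_
  have hm1 : AEMeasurable (fun x => ‖D.indicator 1 x - φ x‖ₑ) (volume.restrict Q) :=
    (hDm.sub hφ.measurable).enorm.aemeasurable
  have hm2 : AEMeasurable (fun ω => ‖B.indicator 1 ω - ψ ω‖ₑ) μ :=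
    ((measurable_one.indicator hB).aestronglyMeasurable.sub hψm).enorm
  have hm3 : AEMeasurable (fun x => ‖(D.indicator 1 x : ℂ)‖ₑ) (volume.restrict Q) :=
    hDm.enorm.aemeasurable
  have hm4 : AEMeasurable (fun p : Rd d × Ω => ‖D.indicator 1 p.1 - φ p.1‖ₑ * 1) (measQ Q μ) :=
    (hm1.comp_quasiMeasurePreserving Measure.quasiMeasurePreserving_fst).mul_const 1
  rw [lintegral_add_right' _ hm4, lintegral_prod_mul hm3 hm2,
    lintegral_prod_mul hm1 (g := fun _ => (1 : ℝ≥0∞)) aemeasurable_const]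
  gcongr
  · refine (setLIntegral_le_lintegral _ _).trans ?_
    have h6 : ∀ x, ‖(D.indicator 1 x : ℂ)‖ₑ = D.indicator 1 x := fun x => by
      by_cases h : x ∈ D <;> simp [indicator, h]
    simp only [h6]
    rw [lintegral_indicator_one hD]
  · rw [lintegral_const, measure_univ, mul_one, mul_one]
    exact setLIntegral_le_lintegral _ _

theorem IsPairable.rectangle (H : PairingData Q T ε₁ ε₂ A Φ Ψ E u u₀) {K D : Set (Rd d)}
    (hK : IsCompact K) (hKQ : K ⊆ Q) (hDK : D ⊆ K) (hD : MeasurableSet D) {B : Set Ω}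
    (hB : MeasurableSet B) {g : Rd d →ᵇ ℂ} (hg : g ∈ A) :
    IsPairable Q T ε₁ ε₂ A Ψ E u u₀ (indMul (D ×ˢ B) g) := by
  have hΨ := H.youngPair.right
  have hDfin : volume D ≠ ∞ := ((measure_mono hDK).trans_lt hK.measure_lt_top).ne
  refine IsPairable.of_sup_approx H (fun ε hε => aestronglyMeasurable_trace_indMul H.scale₁
    H.scale₂ (hD.prod hB) (locallyIntegrable_bcf g) hε)
    (Eventually.of_forall fun p => (MX.of_mem hΨ hg).indMul hΨ _ _ _) fun κ c hκ hc => ?_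
  set M := Ψ (2 * c * ‖g‖) with hM
  have hM0 : 0 ≤ M := hΨ.nonneg _ (by positivity)
  set V := volume.real D with hV
  have hV0 : 0 ≤ V := measureReal_nonneg
  obtain ⟨φ, hφ, hφc, hφQ, hφ1, hφD⟩ := exists_contDiff_approx H.isOpen hK hKQ hDK hD
    (η := κ / (M + 1) / 2) (by positivity)
  -- The extra factor `V + 1` compensates the volume of `D` multiplying the error on `Ω`.
  obtain ⟨ψ, hψ, hψ1, hψB⟩ := exists_isStochSmooth_approx T hB (η := κ / (M + 1) / 2 / (V + 1))
    (by positivity)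
  have hz2 : ∀ p : Rd d × Ω, ‖((D ×ˢ B).indicator 1 p : ℂ) - φ p.1 * ψ p.2‖ ≤ 2 := by
    intro p
    refine (norm_sub_le _ _).trans ?_
    have h1 := norm_indicator_one_le (D ×ˢ B) p
    have h2 : ‖φ p.1 * ψ p.2‖ ≤ 1 := by
      rw [norm_mul]; exact mul_le_one₀ (hφ1 _) (norm_nonneg _) (hψ1 _)
    linarith
  refine ⟨_, IsPairable.elementary H hφ hφc hφQ hψ hg,
    fun p => ‖((D ×ˢ B).indicator 1 p : ℂ) - φ p.1 * ψ p.2‖ * ‖g‖, fun p => by positivity,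
    ?_, ?_, ?_, ?_⟩
  · have h1 : AEStronglyMeasurable (fun p : Rd d × Ω => φ p.1) (measQ Q μ) :=
      (hφ.continuous.measurable.comp measurable_fst).aestronglyMeasurable
    have h2 : AEStronglyMeasurable (fun p : Rd d × Ω => ψ p.2) (measQ Q μ) :=
      hψ.memLp.1.comp_quasiMeasurePreserving Measure.quasiMeasurePreserving_snd
    exact (((measurable_one.indicator (hD.prod hB)).aestronglyMeasurable.sub
      (h1.mul h2)).norm).mul_const _
  · refine (hΨ.lintegral_bounded_mul_le hz2 hc.le (norm_nonneg g)).trans ?_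
    have h3 := lintegral_rectangle_sub_le (Q := Q) hD hB hφ.continuous hψ.memLp.1 hψ1
    have h4 : volume D = ENNReal.ofReal V := (ENNReal.ofReal_toReal hDfin).symm
    calc _ ≤ ENNReal.ofReal M * (ENNReal.ofReal V *
          ENNReal.ofReal (κ / (M + 1) / 2 / (V + 1)) + ENNReal.ofReal (κ / (M + 1) / 2)) := by
          gcongr
          rw [← h4]
          exact h3.trans (by gcongr)
      _ = ENNReal.ofReal (M * (V * (κ / (M + 1) / 2 / (V + 1)) + κ / (M + 1) / 2)) := by
          rw [← ENNReal.ofReal_mul hV0, ← ENNReal.ofReal_add (by positivity) (by positivity),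
            ← ENNReal.ofReal_mul hM0]
      _ ≤ ENNReal.ofReal κ := by
          refine ENNReal.ofReal_le_ofReal ?_
          have h5 : V * (κ / (M + 1) / 2 / (V + 1)) ≤ κ / (M + 1) / 2 := by
            rw [mul_div_assoc', div_le_iff₀ (by positivity), mul_comm]
            gcongr; linarith
          calc _ ≤ (M + 1) * (κ / (M + 1) / 2 + κ / (M + 1) / 2) := by gcongr; linarith
            _ = κ := by field_simp; ring
  · refine Eventually.of_forall fun p => Eventually.of_forall fun y => ?_
    have h1 : indMul (D ×ˢ B) g p.1 p.2 y - φ p.1 * ψ p.2 * g y =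
        ((D ×ˢ B).indicator 1 p - φ p.1 * ψ p.2) * g y := by
      simp only [indMul]; ring
    rw [h1, norm_mul]
    exact mul_le_mul_of_nonneg_left (g.norm_coe_le_norm y) (norm_nonneg _)
  · refine fun ε hε => Eventually.of_forall fun p => ?_
    rw [trace_elementary, trace_indMul, pointValue_of_continuous _ g.continuous, ← sub_mul,
      norm_mul]
    exact mul_le_mul_of_nonneg_left (g.norm_coe_le_norm _) (norm_nonneg _)

theorem indMul_union {C C' : Set (Rd d × Ω)} (h : Disjoint C C') (w : Rd d → ℂ) :
    indMul (C ∪ C') w = fun x ω y => indMul C w x ω y + 1 * indMul C' w x ω y := by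
  funext x ω y
  simp only [indMul, indicator_union_of_disjoint h, one_mul]
  ring

theorem IsPairable.indMul_union (H : PairingData Q T ε₁ ε₂ A Φ Ψ E u u₀)
    {C C' : Set (Rd d × Ω)} (h : Disjoint C C') {w : Rd d → ℂ}
    (h1 : IsPairable Q T ε₁ ε₂ A Ψ E u u₀ (indMul C w))
    (h2 : IsPairable Q T ε₁ ε₂ A Ψ E u u₀ (indMul C' w)) (hw : MX Ψ A w) :
    IsPairable Q T ε₁ ε₂ A Ψ E u u₀ (indMul (C ∪ C') w) := by
  have h3 : ∀ x ω, MX Ψ A (indMul (C ∪ C') w x ω) := hw.indMul H.youngPair.right _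
  have h4 : ∀ ε x ω, trace T ε₁ ε₂ (indMul (C ∪ C') w) ε x ω =
      trace T ε₁ ε₂ (indMul C w) ε x ω + 1 * trace T ε₁ ε₂ (indMul C' w) ε x ω := by
    intro ε x ω
    simp only [trace_indMul, indicator_union_of_disjoint h]
    ring
  rw [StochSigma.indMul_union h] at h3 h4 ⊢
  exact h1.add_const_mul H h2 1 (Eventually.of_forall fun p => h3 p.1 p.2) fun ε _ => h4 ε

theorem IsPairable.indMul_diff (H : PairingData Q T ε₁ ε₂ A Φ Ψ E u u₀)
    {C C' : Set (Rd d × Ω)} (h : C' ⊆ C) {w : Rd d → ℂ}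
    (h1 : IsPairable Q T ε₁ ε₂ A Ψ E u u₀ (indMul C w))
    (h2 : IsPairable Q T ε₁ ε₂ A Ψ E u u₀ (indMul C' w)) (hw : MX Ψ A w) :
    IsPairable Q T ε₁ ε₂ A Ψ E u u₀ (indMul (C \ C') w) := by
  have h3 : ∀ x ω, MX Ψ A (indMul (C \ C') w x ω) := hw.indMul H.youngPair.right _
  have h5 : ∀ p, ((C \ C').indicator 1 p : ℂ) = C.indicator 1 p + (-1) * C'.indicator 1 p := by
    intro p
    rw [indicator_sdiff h, Pi.sub_apply]; ring
  have h6 : indMul (C \ C') w = fun x ω y => indMul C w x ω y + (-1) * indMul C' w x ω y := by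
    funext x ω y
    simp only [indMul, h5]
    ring
  have h4 : ∀ ε x ω, trace T ε₁ ε₂ (indMul (C \ C') w) ε x ω =
      trace T ε₁ ε₂ (indMul C w) ε x ω + (-1) * trace T ε₁ ε₂ (indMul C' w) ε x ω := by
    intro ε x ω
    simp only [trace_indMul, h5]
    ring
  rw [h6] at h3 h4 ⊢
  exact h1.add_const_mul H h2 (-1) (Eventually.of_forall fun p => h3 p.1 p.2) fun ε _ => h4 ε

theorem IsPairable.indMul_of_measure_approx (H : PairingData Q T ε₁ ε₂ A Φ Ψ E u u₀)
    {C : Set (Rd d × Ω)} (hC : MeasurableSet C) {g : Rd d →ᵇ ℂ} (hg : g ∈ A)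
    (happ : ∀ η : ℝ, 0 < η → ∃ C' ⊆ C, MeasurableSet C' ∧
      IsPairable Q T ε₁ ε₂ A Ψ E u u₀ (indMul C' g) ∧
      measQ Q μ (C \ C') ≤ ENNReal.ofReal η) :
    IsPairable Q T ε₁ ε₂ A Ψ E u u₀ (indMul C g) := by
  have hΨ := H.youngPair.right
  refine IsPairable.of_sup_approx H (fun ε hε => aestronglyMeasurable_trace_indMul H.scale₁
    H.scale₂ hC (locallyIntegrable_bcf g) hε)
    (Eventually.of_forall fun p => (MX.of_mem hΨ hg).indMul hΨ _ _ _) fun κ c hκ hc => ?_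
  set M := Ψ (2 * c * ‖g‖) with hM
  have hM0 : 0 ≤ M := hΨ.nonneg _ (by positivity)
  obtain ⟨C', hC'C, hC'm, hC', hη⟩ := happ (κ / (M + 1)) (by positivity)
  have h5 : ∀ p, (C.indicator 1 p : ℂ) - C'.indicator 1 p = (C \ C').indicator 1 p := by
    intro p
    rw [indicator_sdiff hC'C, Pi.sub_apply]
  refine ⟨_, hC', fun p => ‖((C \ C').indicator 1 p : ℂ)‖ * ‖g‖, fun p => by positivity,
    ?_, ?_, ?_, ?_⟩
  · exact ((measurable_one.indicator (hC.diff hC'm)).aestronglyMeasurable.norm).mul_const _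
  · refine (hΨ.lintegral_bounded_mul_le (fun p => (norm_indicator_one_le _ p).trans one_le_two)
      hc.le (norm_nonneg g)).trans ?_
    have h6 : ∀ p, ‖((C \ C').indicator 1 p : ℂ)‖ₑ = (C \ C').indicator 1 p := fun p => by
      by_cases h : p ∈ C \ C'
      · simp [indicator_of_mem h]
      · simp [indicator_of_notMem h]
    simp only [h6]
    rw [lintegral_indicator_one (hC.diff hC'm)]
    calc _ ≤ ENNReal.ofReal (M + 1) * ENNReal.ofReal (κ / (M + 1)) := by
          gcongr; linarith
      _ = ENNReal.ofReal κ := by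
          rw [← ENNReal.ofReal_mul (by positivity)]; congr 1; field_simp
  · refine Eventually.of_forall fun p => Eventually.of_forall fun y => ?_
    simp only [indMul]
    rw [← sub_mul, h5, norm_mul]
    exact mul_le_mul_of_nonneg_left (g.norm_coe_le_norm y) (norm_nonneg _)
  · refine fun ε hε => Eventually.of_forall fun p => ?_
    rw [trace_indMul, trace_indMul, ← sub_mul, pointValue_of_continuous _ g.continuous, h5,
      norm_mul]
    exact mul_le_mul_of_nonneg_left (g.norm_coe_le_norm _) (norm_nonneg _)

/-- A Dynkin argument starting from rectangles. Intersecting with `K ×ˢ univ` keeps measures finite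
and turns complements into proper differences. -/
theorem IsPairable.indMul_mem (H : PairingData Q T ε₁ ε₂ A Φ Ψ E u u₀) {K : Set (Rd d)}
    (hK : IsCompact K) (hKQ : K ⊆ Q) {g : Rd d →ᵇ ℂ} (hg : g ∈ A) {C : Set (Rd d × Ω)}
    (hC : MeasurableSet C) :
    IsPairable Q T ε₁ ε₂ A Ψ E u u₀ (indMul (C ∩ K ×ˢ univ) g) := by
  have hgX : MX Ψ A g := MX.of_mem H.youngPair.right hg
  have hKm : MeasurableSet (K ×ˢ (univ : Set Ω)) := hK.measurableSet.prod MeasurableSet.univ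
  have hempty : IsPairable Q T ε₁ ε₂ A Ψ E u u₀ (indMul (∅ : Set (Rd d × Ω)) g) := by
    have := IsPairable.rectangle H hK hKQ (empty_subset K) MeasurableSet.empty
      (MeasurableSet.empty (α := Ω)) hg
    rwa [empty_prod] at this
  induction C, hC using MeasurableSpace.induction_on_inter generateFrom_prod.symm
    isPiSystem_prod with
  | empty => rwa [empty_inter]
  | basic C hC =>
    obtain ⟨s, hs, t, ht, rfl⟩ := hC
    have hs : MeasurableSet s := hs
    have ht : MeasurableSet t := ht
    rw [prod_inter_prod, inter_univ]
    exact IsPairable.rectangle H hK hKQ inter_subset_right (hs.inter hK.measurableSet) ht hg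
  | compl C hC ih =>
    have h1 : Cᶜ ∩ K ×ˢ univ = (K ×ˢ (univ : Set Ω)) \ (C ∩ K ×ˢ univ) := by
      ext p; simp; tauto
    rw [h1]
    exact IsPairable.indMul_diff H inter_subset_right
      (IsPairable.rectangle H hK hKQ subset_rfl hK.measurableSet MeasurableSet.univ hg) ih hgX
  | iUnion f hd hf ih =>
    -- Partial unions are handled by disjoint additivity; what they omit decreases to the empty set
    -- inside a set of finite measure.
    have hacc : ∀ n, IsPairable Q T ε₁ ε₂ A Ψ E u u₀
        (indMul (Set.accumulate f n ∩ K ×ˢ univ) g) := by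
      intro n
      induction n with
      | zero => simpa [Set.accumulate_zero_nat] using ih 0
      | succ n hn =>
        rw [Set.accumulate_succ, union_inter_distrib_right]
        refine IsPairable.indMul_union H ?_ hn (ih (n + 1)) hgX
        exact (Set.disjoint_accumulate hd (Nat.lt_succ_self n)).mono inter_subset_left
          inter_subset_left
    have hm : ∀ n, MeasurableSet (Set.accumulate f n) := fun n =>
      MeasurableSet.biUnion (to_countable _) fun i _ => hf i
    refine IsPairable.indMul_of_measure_approx H ((MeasurableSet.iUnion hf).inter hKm) hg
      fun η hη => ?_
    have hfin : measQ Q μ ((⋃ n, f n) ∩ K ×ˢ univ) ≠ ∞ :=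
      ((measure_mono inter_subset_right).trans_lt (measQ_cylinder_lt_top Q hK)).ne
    have h1 : Tendsto (fun n => measQ Q μ (((⋃ n, f n) ∩ K ×ˢ univ) \
        (Set.accumulate f n ∩ K ×ˢ univ))) atTop (𝓝 0) := by
      have h2 := tendsto_measure_iInter_atTop (μ := measQ Q μ)
        (s := fun n => ((⋃ n, f n) ∩ K ×ˢ univ) \ (Set.accumulate f n ∩ K ×ˢ univ))
        (fun n => (((MeasurableSet.iUnion hf).inter hKm).diff
          ((hm n).inter hKm)).nullMeasurableSet)
        (fun m n hmn => sdiff_subset_sdiff_right (inter_subset_inter_left _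
          (Set.monotone_accumulate hmn)))
        ⟨0, ((measure_mono sdiff_subset).trans_lt hfin.lt_top).ne⟩
      have h3 : ⋂ n, (((⋃ n, f n) ∩ K ×ˢ (univ : Set Ω)) \ (Set.accumulate f n ∩ K ×ˢ univ)) =
          ∅ := by
        rw [eq_empty_iff_forall_notMem]
        intro p hp
        rw [mem_iInter] at hp
        obtain ⟨n, hn⟩ := mem_iUnion.1 (hp 0).1.1
        exact (hp n).2 ⟨Set.subset_accumulate hn, (hp 0).1.2⟩
      rwa [h3, measure_empty] at h2
    obtain ⟨n, hn⟩ := (h1.eventually (gt_mem_nhds (ENNReal.ofReal_pos.2 hη))).exists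
    exact ⟨_, inter_subset_inter_left _ (Set.accumulate_subset_iUnion n), (hm n).inter hKm,
      hacc n, hn.le⟩

/-- Here `w - g` is small only on average, so `of_sup_approx` does not apply. The trace modular is
at most an integral over a fixed ball of `Ψ(c|w - g|)` at `x/ε₂`, that is, a constant times an
average over a ball of radius `R₀/ε₂`. -/
theorem IsPairable.indMul_mx (H : PairingData Q T ε₁ ε₂ A Φ Ψ E u u₀) {K : Set (Rd d)}
    (hK : IsCompact K) (hKQ : K ⊆ Q) {w : Rd d → ℂ} (hw : MX Ψ A w)
    (hwl : LocallyIntegrable w volume) {C : Set (Rd d × Ω)} (hC : MeasurableSet C)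
    (hCK : C ⊆ K ×ˢ univ) :
    IsPairable Q T ε₁ ε₂ A Ψ E u u₀ (indMul C w) := by
  have hΨ := H.youngPair.right
  refine IsPairable.of_approx H (fun ε hε => aestronglyMeasurable_trace_indMul H.scale₁
    H.scale₂ hC hwl hε) (Eventually.of_forall fun p => hw.indMul hΨ _ _ _) fun κ c hκ hc => ?_
  obtain ⟨R₀, hR₀, hKR⟩ := hK.isBounded.subset_ball_lt 0 (0 : Rd d)
  set V := volume.real (Metric.ball (0 : Rd d) R₀) with hV
  have hV0 : 0 ≤ V := measureReal_nonneg
  have hVv : volume (Metric.ball (0 : Rd d) R₀) = ENNReal.ofReal V :=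
    (ENNReal.ofReal_toReal measure_ball_lt_top.ne).symm
  have hκV : ENNReal.ofReal V * ENNReal.ofReal (κ / (V + 1)) ≤ ENNReal.ofReal κ := by
    rw [← ENNReal.ofReal_mul hV0]
    refine ENNReal.ofReal_le_ofReal ?_
    calc _ ≤ (V + 1) * (κ / (V + 1)) := by gcongr; linarith
      _ = κ := by field_simp
  obtain ⟨g, hg, hgR⟩ := hw.approx (κ / (V + 1)) c (by positivity) hc
  have hCeq : C ∩ K ×ˢ univ = C := inter_eq_left.2 hCK
  have hKVol : volume K ≤ ENNReal.ofReal V := by rw [← hVv]; exact measure_mono hKR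
  refine ⟨indMul C g, by rw [← hCeq]; exact IsPairable.indMul_mem H hK hKQ hg hC, ?_,
    fun p => C.indicator (fun _ => κ / (V + 1)) p,
    fun p => indicator_nonneg (fun _ _ => by positivity) p,
    (measurable_const.indicator hC).aemeasurable, ?_, ?_⟩
  · have hlim : Tendsto (fun ε => (ε₂ ε)⁻¹ * R₀) (𝓝[>] 0) atTop := by
      refine Tendsto.atTop_mul_const hR₀ (tendsto_inv_nhdsGT_zero.comp ?_)
      refine tendsto_nhdsWithin_iff.2 ⟨H.scale₂.tendsto_zero, ?_⟩
      filter_upwards [self_mem_nhdsWithin] with ε hε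
      exact H.scale₂.pos ε hε
    filter_upwards [hlim.eventually_ge_atTop 1, self_mem_nhdsWithin] with ε hε1 hε
    have hε : 0 < ε := hε
    have hr₂ : 0 < (ε₂ ε)⁻¹ := inv_pos.2 (H.scale₂.pos ε hε)
    have hbound : ∀ᵐ p ∂(measQ Q μ), ENNReal.ofReal (Ψ (c * ‖trace T ε₁ ε₂ (indMul C w) ε p.1 p.2 -
        trace T ε₁ ε₂ (indMul C g) ε p.1 p.2‖)) ≤
        (Metric.ball (0 : Rd d) R₀).indicator (fun x => ENNReal.ofReal
          (Ψ (c * ‖w ((ε₂ ε)⁻¹ • x) - g ((ε₂ ε)⁻¹ • x)‖))) p.1 := by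
      filter_upwards [ae_smul_fst (μ := μ) (Q := Q) hr₂.ne' (pointValue_ae_eq hwl)] with p hp
      rw [trace_indMul, trace_indMul, hp, pointValue_of_continuous _ g.continuous, ← mul_sub]
      by_cases hpC : T.shift (ε₁ ε)⁻¹ (p.1, p.2) ∈ C
      · have h1 : p.1 ∈ Metric.ball (0 : Rd d) R₀ := hKR (hCK hpC).1
        rw [indicator_of_mem hpC, indicator_of_mem h1, Pi.one_apply, one_mul]
      · rw [indicator_of_notMem hpC, zero_mul, norm_zero, mul_zero, hΨ.zero, ENNReal.ofReal_zero]
        exact zero_le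
    have hgm : AEMeasurable (fun x => ENNReal.ofReal
          (Ψ (c * ‖w ((ε₂ ε)⁻¹ • x) - g ((ε₂ ε)⁻¹ • x)‖))) volume := by
      refine hΨ.aemeasurable_ofReal (((hw.sub_mem hg).meas.comp_quasiMeasurePreserving
        (Measure.quasiMeasurePreserving_smul volume hr₂.ne')).norm.const_mul c)
        fun x => by positivity
    calc _ ≤ ∫⁻ p, (Metric.ball (0 : Rd d) R₀).indicator (fun x => ENNReal.ofReal
          (Ψ (c * ‖w ((ε₂ ε)⁻¹ • x) - g ((ε₂ ε)⁻¹ • x)‖))) p.1 * 1 ∂(measQ Q μ) := by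
          simp only [mul_one]
          exact lintegral_mono_ae hbound
      _ = (∫⁻ x in Q, (Metric.ball (0 : Rd d) R₀).indicator (fun x => ENNReal.ofReal
          (Ψ (c * ‖w ((ε₂ ε)⁻¹ • x) - g ((ε₂ ε)⁻¹ • x)‖))) x) * ∫⁻ _, 1 ∂μ :=
          lintegral_prod_mul (hgm.indicator measurableSet_ball).restrict
            (g := fun _ => (1 : ℝ≥0∞)) aemeasurable_const
      _ ≤ ∫⁻ x in Metric.ball (0 : Rd d) R₀, ENNReal.ofReal
          (Ψ (c * ‖w ((ε₂ ε)⁻¹ • x) - g ((ε₂ ε)⁻¹ • x)‖)) := by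
          rw [lintegral_const, measure_univ, mul_one, mul_one,
            ← lintegral_indicator measurableSet_ball]
          exact setLIntegral_le_lintegral _ _
      _ = volume (Metric.ball (0 : Rd d) R₀) * ∫⁻ x, ENNReal.ofReal
          (Ψ (c * ‖w ((ε₂ ε)⁻¹ • x) - g ((ε₂ ε)⁻¹ • x)‖)) ∂(ballMeas d R₀) := by
          rw [ballMeas, lintegral_smul_measure, smul_eq_mul, ← mul_assoc,
            ENNReal.mul_inv_cancel (Metric.measure_ball_pos volume _ hR₀).ne'
              measure_ball_lt_top.ne, one_mul]
      _ ≤ ENNReal.ofReal V * ENNReal.ofReal (κ / (V + 1)) := by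
          rw [hVv]
          gcongr
          rw [lintegral_ballMeas_comp_smul
            (fun y => ENNReal.ofReal (Ψ (c * ‖w y - g y‖))) hr₂ R₀]
          exact hgR _ hε1
      _ ≤ _ := hκV
  · have h1 : ∀ p, ENNReal.ofReal (C.indicator (fun _ => κ / (V + 1)) p) =
        C.indicator (fun _ => ENNReal.ofReal (κ / (V + 1))) p := fun p => by
      by_cases h : p ∈ C <;> simp [indicator, h]
    simp only [h1]
    rw [lintegral_indicator_const hC, mul_comm]
    refine le_trans ?_ hκV
    gcongr
    exact (measure_mono hCK).trans ((measQ_cylinder_le Q K).trans hKVol)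
  · refine Eventually.of_forall fun p => ?_
    filter_upwards [eventually_ge_atTop 1] with R hR
    simp only [indMul, ← mul_sub]
    by_cases h : (p.1, p.2) ∈ C
    · simp only [indicator_of_mem h, Pi.one_apply, one_mul]
      exact hgR R hR
    · simp [indicator_of_notMem h, hΨ.zero]

end Chain

/-! ### Functions with values in `L^∞(ℝ^d)` -/

section LpValued

variable {d : ℕ} {Ω : Type*} [MeasurableSpace Ω] {μ : Measure Ω} [IsProbabilityMeasure μ]
  {T : DynSystem d μ} {Q : Set (Rd d)} {ε₁ ε₂ : ℝ → ℝ} {A : StarSubalgebra ℂ (Rd d →ᵇ ℂ)}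
  {Φ Ψ : ℝ → ℝ} {E : Set ℝ} {u : ℝ → Rd d → Ω → ℂ} {u₀ : Rd d → Ω → Rd d → ℂ}

theorem MX.zero (hΨ : YoungFn Ψ) : MX Ψ A (fun _ => 0) :=
  MX.of_mem hΨ (zero_mem A)

-- Induction over the values, adding one fibre at a time. The value zero is excluded, because its
-- fibre need not lie over `K`.
open Classical in
theorem IsPairable.simpleFunc_mem (H : PairingData Q T ε₁ ε₂ A Φ Ψ E u u₀) {K : Set (Rd d)}
    (hK : IsCompact K) (hKQ : K ⊆ Q)
    (t : SimpleFunc (Rd d × Ω) (Lp ℂ ∞ (volume : Measure (Rd d))))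
    (ht : ∀ p, MX Ψ A (t p)) (htK : ∀ p, t p ≠ 0 → p.1 ∈ K)
    (S : Finset (Lp ℂ ∞ (volume : Measure (Rd d)))) (hS : ∀ w ∈ S, w ≠ 0) :
    IsPairable Q T ε₁ ε₂ A Ψ E u u₀
      (fun x ω y => if t (x, ω) ∈ S then (t (x, ω) : Rd d → ℂ) y else 0) := by
  have hΨ := H.youngPair.right
  have hmx : ∀ (S : Finset (Lp ℂ ∞ (volume : Measure (Rd d)))) (p : Rd d × Ω),
      MX Ψ A (fun y => if t (p.1, p.2) ∈ S then (t (p.1, p.2) : Rd d → ℂ) y else 0) := by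
    intro S p
    by_cases h : t (p.1, p.2) ∈ S
    · simpa only [h, if_true] using ht _
    · simpa only [h, if_false] using MX.zero hΨ
  have htr : ∀ (S : Finset (Lp ℂ ∞ (volume : Measure (Rd d)))) (ε : ℝ) (x : Rd d) (ω : Ω),
      trace T ε₁ ε₂ (fun x ω y => if t (x, ω) ∈ S then (t (x, ω) : Rd d → ℂ) y else 0) ε x ω =
        if t (T.shift (ε₁ ε)⁻¹ (x, ω)) ∈ S then
          pointValue (t (T.shift (ε₁ ε)⁻¹ (x, ω))) ((ε₂ ε)⁻¹ • x) else 0 := by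
    intro S ε x ω
    unfold trace
    by_cases h : t (x, T.toFun ((ε₁ ε)⁻¹ • x) ω) ∈ S
    · simp [DynSystem.shift, h]
    · simp [DynSystem.shift, h, pointValue_zero]
  induction S using Finset.induction_on with
  | empty =>
    have h0 := IsPairable.indMul_mx H hK hKQ (MX.zero hΨ) locallyIntegrable_zero
      (C := (∅ : Set (Rd d × Ω))) MeasurableSet.empty (empty_subset _)
    refine h0.congr fun x ω => Eventually.of_forall fun y => ?_
    simp [indMul]
  | insert a S haS ih =>
    have ih := ih fun w hw => hS w (Finset.mem_insert_of_mem hw)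
    -- Only an attained value is known to satisfy `MX`; an unattained one changes nothing.
    by_cases hat : ∃ p, t p = a
    swap
    · refine ih.congr fun x ω => Eventually.of_forall fun y => ?_
      have : t (x, ω) ≠ a := fun h => hat ⟨_, h⟩
      simp [this]
    obtain ⟨p₀, hp₀⟩ := hat
    have h1 : IsPairable Q T ε₁ ε₂ A Ψ E u u₀ (indMul (t ⁻¹' {a}) a) := by
      refine IsPairable.indMul_mx H hK hKQ (hp₀ ▸ ht p₀) (Lp.locallyIntegrable_top a)
        (t.measurableSet_fiber a) fun p hp => ⟨htK p ?_, mem_univ _⟩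
      rw [show t p = a from hp]
      exact hS a (Finset.mem_insert_self _ _)
    have hF : (fun x ω y => if t (x, ω) ∈ insert a S then (t (x, ω) : Rd d → ℂ) y else 0) =
        fun x ω y => (if t (x, ω) ∈ S then (t (x, ω) : Rd d → ℂ) y else 0) +
          1 * indMul (t ⁻¹' {a}) a x ω y := by
      funext x ω y
      by_cases h : t (x, ω) = a
      · simp [indMul, h, haS]
      · simp [indMul, h]
    have hmx' := hmx (insert a S)
    have htr' := htr (insert a S)
    have h2 : ∀ p : Rd d × Ω, MX Ψ A (fun y =>
        (if t (p.1, p.2) ∈ S then (t (p.1, p.2) : Rd d → ℂ) y else 0) +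
          1 * indMul (t ⁻¹' {a}) a p.1 p.2 y) := by
      intro p
      have h3 := congrFun (congrFun hF p.1) p.2
      rw [← h3]
      exact hmx' p
    rw [hF] at htr' ⊢
    refine ih.add_const_mul H h1 1 (Eventually.of_forall h2) fun ε _ x ω => ?_
    rw [htr', htr, trace_indMul]
    by_cases h : t (T.shift (ε₁ ε)⁻¹ (x, ω)) = a
    · simp [h, haS]
    · simp [h]

theorem IsPairable.simpleFunc (H : PairingData Q T ε₁ ε₂ A Φ Ψ E u u₀) {K : Set (Rd d)}
    (hK : IsCompact K) (hKQ : K ⊆ Q)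
    (t : SimpleFunc (Rd d × Ω) (Lp ℂ ∞ (volume : Measure (Rd d))))
    (ht : ∀ p, MX Ψ A (t p)) (htK : ∀ p, t p ≠ 0 → p.1 ∈ K) :
    IsPairable Q T ε₁ ε₂ A Ψ E u u₀ (fun x ω => (t (x, ω) : Rd d → ℂ)) := by
  classical
  refine (IsPairable.simpleFunc_mem H hK hKQ t ht htK (t.range.erase 0) fun w hw =>
    Finset.ne_of_mem_erase hw).congr
    fun x ω => ?_
  by_cases h : t (x, ω) = 0
  · exact Eventually.of_forall fun y => by simp [h]
  · simp [h]

/-- Simple functions approximate `f` pointwise in the `L^∞` norm, with error at most three times the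
norm of `f`. Doubling makes the modular of the error dominated, so it tends to zero, and the norm
bound is uniform in `y` as `of_sup_approx` requires. -/
theorem IsPairable.of_lp (H : PairingData Q T ε₁ ε₂ A Φ Ψ E u u₀) {K : Set (Rd d)}
    (hK : IsCompact K) (hKQ : K ⊆ Q) {f : Rd d → Ω → Lp ℂ ∞ (volume : Measure (Rd d))}
    (hf : AEStronglyMeasurable (fun p : Rd d × Ω => f p.1 p.2) (measQ Q μ))
    (hf0 : ∀ᵐ p ∂(measQ Q μ), p.1 ∉ K → f p.1 p.2 = 0)
    (hfin : ∫⁻ p, ENNReal.ofReal (Ψ ‖f p.1 p.2‖) ∂(measQ Q μ) ≠ ∞)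
    (hmx : ∀ᵐ p ∂(measQ Q μ), MX Ψ A (f p.1 p.2))
    (htr : ∀ ε, 0 < ε → AEStronglyMeasurable (fun p : Rd d × Ω =>
      trace T ε₁ ε₂ (fun x ω => (f x ω : Rd d → ℂ)) ε p.1 p.2) (measQ Q μ)) :
    IsPairable Q T ε₁ ε₂ A Ψ E u u₀ (fun x ω => (f x ω : Rd d → ℂ)) := by
  have hΨ := H.youngPair.right
  set f' := hf.mk (fun p : Rd d × Ω => f p.1 p.2) with hf'
  have hff' : ∀ᵐ p ∂(measQ Q μ), f p.1 p.2 = f' p := hf.ae_eq_mk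
  have hf'm : StronglyMeasurable f' := hf.stronglyMeasurable_mk
  -- The approximants must themselves take values satisfying `MX`, so they are drawn from the part
  -- of the range where this holds, together with zero.
  set s : Set (Lp ℂ ∞ (volume : Measure (Rd d))) :=
    insert 0 (range f' ∩ {w | MX Ψ A (w : Rd d → ℂ)}) with hs
  have hS : TopologicalSpace.IsSeparable (insert 0 (range f')) := by
    rw [insert_eq]
    exact (finite_singleton _).isSeparable.union hf'm.isSeparable_range
  have hsS : s ⊆ insert 0 (range f') := insert_subset_insert inter_subset_left
  have hsep : TopologicalSpace.SeparableSpace s := (hS.mono hsS).separableSpace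
  have h0s : (0 : Lp ℂ ∞ (volume : Measure (Rd d))) ∈ s := mem_insert _ _
  have hsX : ∀ w ∈ s, MX Ψ A (w : Rd d → ℂ) := by
    rintro w (rfl | hw)
    · exact (MX.zero hΨ).congr (Eventually.of_forall fun y => by simp)
    · exact hw.2
  borelize ↥(Lp ℂ ∞ (volume : Measure (Rd d)))
  have hKm : MeasurableSet (K ×ˢ (univ : Set Ω)) := hK.measurableSet.prod MeasurableSet.univ
  set b := fun n => SimpleFunc.approxOn f' hf'm.measurable s 0 h0s n with hb
  set t := fun n => (b n).restrict (K ×ˢ univ) with ht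
  have htv : ∀ n p, t n p = (K ×ˢ univ).indicator (b n) p := fun n p => by
    rw [ht, SimpleFunc.restrict_apply _ hKm]
  have hts : ∀ n p, t n p ∈ s := fun n p => by
    rw [htv]
    by_cases hp : p ∈ K ×ˢ (univ : Set Ω)
    · rw [indicator_of_mem hp]; exact SimpleFunc.approxOn_mem _ _ _ _
    · rw [indicator_of_notMem hp]; exact h0s
  have htP : ∀ n, IsPairable Q T ε₁ ε₂ A Ψ E u u₀ (fun x ω => (t n (x, ω) : Rd d → ℂ)) :=
    fun n => IsPairable.simpleFunc H hK hKQ (t n) (fun p => hsX _ (hts n p)) fun p hp => by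
      by_contra hpK
      refine hp ?_
      rw [htv, indicator_of_notMem fun h => hpK h.1]
  have hle : ∀ n p, ‖f' p - t n p‖ ≤ 3 * ‖f' p‖ := by
    intro n p
    have h1 : ‖b n p‖ ≤ 2 * ‖f' p‖ := by
      have h2 := SimpleFunc.edist_approxOn_y0_le hf'm.measurable h0s p n
      rw [edist_comm, edist_comm (0 : Lp ℂ ∞ (volume : Measure (Rd d))), edist_zero_right,
        edist_zero_right, ← ofReal_norm, ← ofReal_norm,
        ← ENNReal.ofReal_add (norm_nonneg _) (norm_nonneg _),
        ENNReal.ofReal_le_ofReal_iff (by positivity)] at h2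
      linarith
    have h3 : ‖t n p‖ ≤ ‖b n p‖ := by rw [htv]; exact norm_indicator_le_norm_self _ _
    linarith [norm_sub_le (f' p) (t n p)]
  have hlim : ∀ᵐ p ∂(measQ Q μ), Tendsto (fun n => ‖f' p - t n p‖) atTop (𝓝 0) := by
    filter_upwards [hff', hf0, hmx] with p h1 h2 h3
    rw [h1] at h2 h3
    by_cases hp : p ∈ K ×ˢ (univ : Set Ω)
    · have h4 := SimpleFunc.tendsto_approxOn hf'm.measurable h0s
        (subset_closure (mem_insert_of_mem _ ⟨mem_range_self p, h3⟩))
      simp only [htv, indicator_of_mem hp]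
      simpa using (tendsto_const_nhds (x := f' p)).sub h4 |>.norm
    · have h5 : p.1 ∉ K := fun h => hp ⟨h, mem_univ _⟩
      simp [htv, indicator_of_notMem hp, h2 h5]
  have hhm : ∀ n, StronglyMeasurable fun p => ‖f' p - t n p‖ := fun n =>
    (hf'm.sub (t n).stronglyMeasurable).norm
  refine IsPairable.of_sup_approx H htr hmx fun κ c hκ hc => ?_
  obtain ⟨C, hC0, hC⟩ := hΨ.exists_mul_le (c * 3)
  have hconv : Tendsto (fun n => ∫⁻ p, ENNReal.ofReal (Ψ (c * ‖f' p - t n p‖)) ∂(measQ Q μ)) atTop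
      (𝓝 (∫⁻ _, 0 ∂(measQ Q μ))) := by
    refine tendsto_lintegral_of_dominated_convergence'
      (fun p => ENNReal.ofReal C * ENNReal.ofReal (Ψ ‖f' p‖))
      (fun n => hΨ.aemeasurable_ofReal ((hhm n).aestronglyMeasurable.const_mul c)
        fun p => by positivity) (fun n => Eventually.of_forall fun p => ?_) ?_ ?_
    · dsimp only
      rw [← ENNReal.ofReal_mul hC0]
      refine ENNReal.ofReal_le_ofReal ((hΨ.mono (by positivity) ?_).trans
        (hC _ (norm_nonneg _) (by positivity)))
      calc c * ‖f' p - t n p‖ ≤ c * (3 * ‖f' p‖) := by gcongr; exact hle n p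
        _ = _ := by ring
    · rw [lintegral_const_mul' _ _ ENNReal.ofReal_ne_top]
      refine ENNReal.mul_ne_top ENNReal.ofReal_ne_top ?_
      rwa [lintegral_congr_ae (g := fun p => ENNReal.ofReal (Ψ ‖f p.1 p.2‖))]
      filter_upwards [hff'] with p hp
      rw [hp]
    · filter_upwards [hlim] with p hp
      have h1 := (hΨ.continuous_max.tendsto (c * 0)).comp (hp.const_mul c)
      have h2 := ENNReal.tendsto_ofReal h1
      simp only [mul_zero, max_self, hΨ.zero, ENNReal.ofReal_zero] at h2
      refine h2.congr fun n => ?_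
      rw [Function.comp_apply, max_eq_left (by positivity)]
  rw [lintegral_zero] at hconv
  obtain ⟨n, hn⟩ := (hconv.eventually (gt_mem_nhds (ENNReal.ofReal_pos.2 hκ))).exists
  refine ⟨_, htP n, fun p => ‖f' p - t n p‖, fun p => norm_nonneg _,
    (hhm n).aestronglyMeasurable, hn.le, ?_, fun ε hε => ?_⟩
  · filter_upwards [hff'] with p hp
    rw [hp]
    exact Lp.ae_norm_sub_le _ _
  -- Off one null set of points `x/ε₂`, point values are 1-Lipschitz on the whole separable range,
  -- whatever function the shift selects.
  · filter_upwards [T.ae_shift (inv_ne_zero (H.scale₁.pos ε hε).ne') hff',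
      ae_smul_fst (μ := μ) (Q := Q) (inv_ne_zero (H.scale₂.pos ε hε).ne')
        (ae_forall_norm_pointValue_sub_le hS)] with p h1 h2
    unfold trace
    have h3 : f p.1 (T.toFun ((ε₁ ε)⁻¹ • p.1) p.2) = f' (T.shift (ε₁ ε)⁻¹ p) := h1
    dsimp only
    rw [h3]
    exact h2 _ (mem_insert_of_mem _ (mem_range_self _)) _ (hsS (hts n _))

end LpValued

/-! ### Integrability from continuity in `x`, and the first statement -/

section CompactSupport

variable {d : ℕ} {Ω : Type*} [MeasurableSpace Ω] {μ : Measure Ω} [IsProbabilityMeasure μ]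
  {T : DynSystem d μ} {Q : Set (Rd d)} {ε₁ ε₂ : ℝ → ℝ} {A : StarSubalgebra ℂ (Rd d →ᵇ ℂ)}
  {Φ Ψ : ℝ → ℝ} {E : Set ℝ} {u : ℝ → Rd d → Ω → ℂ} {u₀ : Rd d → Ω → Rd d → ℂ}
  {f : Rd d → Ω → Lp ℂ ∞ (volume : Measure (Rd d))}

theorem exists_bound_of_isCompact {X : Type*} [TopologicalSpace X] {K : Set X}
    (hK : IsCompact K) {I : X → ℝ≥0∞}
    (h : ∀ x ∈ K, ∃ C : ℝ≥0∞, C ≠ ∞ ∧ ∀ᶠ x' in 𝓝 x, I x' ≤ C) :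
    ∃ C : ℝ≥0∞, C ≠ ∞ ∧ ∀ x ∈ K, I x ≤ C := by
  refine hK.induction_on (p := fun s => ∃ C : ℝ≥0∞, C ≠ ∞ ∧ ∀ x ∈ s, I x ≤ C)
    ⟨0, ENNReal.zero_ne_top, by simp⟩ ?_ ?_ ?_
  · rintro s t hst ⟨C, hC, ht⟩
    exact ⟨C, hC, fun x hx => ht x (hst hx)⟩
  · rintro s t ⟨C, hC, hs⟩ ⟨D, hD, ht⟩
    refine ⟨C + D, ENNReal.add_ne_top.2 ⟨hC, hD⟩, fun x hx => ?_⟩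
    rcases hx with hx | hx
    · exact (hs x hx).trans le_self_add
    · exact (ht x hx).trans le_add_self
  · intro x hx
    obtain ⟨C, hC, hx⟩ := h x hx
    exact ⟨{x' | I x' ≤ C}, mem_nhdsWithin_of_mem_nhds hx, C, hC, fun x' hx' => hx'⟩

/-- A measurable property of the values of a jointly measurable function holds almost everywhere as
soon as it holds almost everywhere on each slice. -/
theorem ae_of_forall_slice {F : Type*} [TopologicalSpace F] (hQ : IsOpen Q) {f : Rd d → Ω → F}
    (hf : AEStronglyMeasurable (fun p : Rd d × Ω => f p.1 p.2) (measQ Q μ)) {P : Rd d → F → Prop}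
    (hP : ∀ g : Rd d × Ω → F, StronglyMeasurable g → MeasurableSet {p | P p.1 (g p)})
    (h : ∀ x ∈ Q, ∀ᵐ ω ∂μ, P x (f x ω)) : ∀ᵐ p ∂(measQ Q μ), P p.1 (f p.1 p.2) := by
  have h1 := hf.ae_eq_mk
  have h2 : ∀ᵐ p ∂(measQ Q μ), P p.1 (hf.mk _ p) := by
    refine (Measure.ae_prod_iff_ae_ae (hP _ hf.stronglyMeasurable_mk)).2 ?_
    filter_upwards [Measure.ae_ae_of_ae_prod h1, ae_restrict_mem hQ.measurableSet] with x hx hxQ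
    filter_upwards [hx, h x hxQ] with ω h3 h4
    rw [← h3]
    exact h4
  filter_upwards [h1, h2] with p h3 h4
  rwa [h3]

theorem MemK.exists_compact {e : ℝ → ℝ}
    {N : (Ω → Lp ℂ ∞ (volume : Measure (Rd d))) → ℝ≥0∞} (hQ : IsOpen Q)
    (hf : MemK Q μ Φ e A N f) : ∃ K, IsCompact K ∧ K ⊆ Q ∧ (∀ x ∈ Q \ K, ∀ᵐ ω ∂μ, f x ω = 0) ∧
      ∀ᵐ p ∂(measQ Q μ), p.1 ∉ K → f p.1 p.2 = 0 := by
  obtain ⟨K, hK, hKQ, hf0⟩ := hf.support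
  refine ⟨K, hK, hKQ, hf0, ae_of_forall_slice hQ hf.measurable
    (P := fun x w => x ∉ K → w = 0) (fun g hg => ?_) fun x hx => ?_⟩
  · have h1 : {p : Rd d × Ω | p.1 ∉ K → g p = 0} = Prod.fst ⁻¹' K ∪ {p | g p = 0} := by
      ext p
      simp only [mem_ofPred_eq, mem_union, mem_preimage]
      tauto
    rw [h1]
    exact (measurable_fst hK.measurableSet).union (hg.measurableSet_eq_fun stronglyMeasurable_const)
  · by_cases hxK : x ∈ K
    · exact Eventually.of_forall fun ω h => absurd hxK h
    · filter_upwards [hf0 x ⟨hx, hxK⟩] with ω hω _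
      exact hω

/-- Continuity in the Luxemburg norm bounds the slice modulars near each point, by convexity and
doubling; compactness of the support makes the bound uniform. -/
theorem MemKOrlicz.lintegral_ne_top {e : ℝ → ℝ} (hΨ : YoungFn Ψ) (hQ : IsOpen Q)
    (hf : MemKOrlicz Q μ Ψ e A f) :
    ∫⁻ p, ENNReal.ofReal (Ψ ‖f p.1 p.2‖) ∂(measQ Q μ) ≠ ∞ := by
  obtain ⟨K, hK, hKQ, hf0, -⟩ := MemK.exists_compact hQ hf
  have hloc : ∀ x ∈ K, ∃ C : ℝ≥0∞, C ≠ ∞ ∧ ∀ᶠ x' in 𝓝 x,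
      ∫⁻ ω, ENNReal.ofReal (Ψ ‖f x' ω‖) ∂μ ≤ C := by
    intro x hx
    have hxQ := hKQ hx
    obtain ⟨δ, hδ, hδf⟩ : ∃ δ : ℝ, 0 < δ ∧ luxNorm Ψ μ (f x) < ENNReal.ofReal δ := by
      have h1 : luxNorm Ψ μ (f x) < ∞ := hf.norm_lt_top x hxQ
      refine ⟨(luxNorm Ψ μ (f x)).toReal + 1, by positivity, ?_⟩
      rw [ENNReal.lt_ofReal_iff_toReal_lt h1.ne]
      linarith
    have h2 := lintegral_luxNorm_le hΨ hδ hδf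
    obtain ⟨C, hC0, hC⟩ := hΨ.exists_mul_le (2 * δ)
    have h3 : AEMeasurable (fun ω => ENNReal.ofReal (Ψ (2 * ‖f x ω‖))) μ :=
      hΨ.aemeasurable_ofReal ((hf.measurable_slice x hxQ).norm.const_mul 2) fun ω => by positivity
    refine ⟨1 + ENNReal.ofReal C * 1, by simp, ?_⟩
    -- Closeness `1/2` absorbs the factor two that convexity puts on `f x' - f x`, so its modular is
    -- at most one.
    have h4 := (hf.continuous x hxQ).eventually
      (gt_mem_nhds (ENNReal.ofReal_pos.2 (half_pos one_pos)))
    filter_upwards [h4] with x' hx'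
    have h5 := lintegral_luxNorm_le hΨ (half_pos one_pos) hx'
    calc ∫⁻ ω, ENNReal.ofReal (Ψ ‖f x' ω‖) ∂μ ≤
        ∫⁻ ω, (ENNReal.ofReal (Ψ (‖f x' ω - f x ω‖ / (1 / 2))) +
          ENNReal.ofReal (Ψ (2 * ‖f x ω‖))) ∂μ := by
          refine lintegral_mono fun ω => ?_
          have h6 : 0 ≤ Ψ (‖f x' ω - f x ω‖ / (1 / 2)) := hΨ.nonneg _ (by positivity)
          have h7 : 0 ≤ Ψ (2 * ‖f x ω‖) := hΨ.nonneg _ (by positivity)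
          rw [← ENNReal.ofReal_add h6 h7]
          refine ENNReal.ofReal_le_ofReal ?_
          have h8 : ‖f x' ω‖ ≤ ‖f x' ω - f x ω‖ + ‖f x ω‖ := by
            simpa using norm_add_le (f x' ω - f x ω) (f x ω)
          have h9 := hΨ.add_le_half (norm_nonneg (f x' ω - f x ω)) (norm_nonneg (f x ω))
          have h10 : 2 * ‖f x' ω - f x ω‖ = ‖f x' ω - f x ω‖ / (1 / 2) := by ring
          rw [h10] at h9
          linarith [hΨ.mono (norm_nonneg _) h8]
      _ = ∫⁻ ω, ENNReal.ofReal (Ψ (‖f x' ω - f x ω‖ / (1 / 2))) ∂μ +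
          ∫⁻ ω, ENNReal.ofReal (Ψ (2 * ‖f x ω‖)) ∂μ := lintegral_add_right' _ h3
      _ ≤ 1 + ENNReal.ofReal C * ∫⁻ ω, ENNReal.ofReal (Ψ (‖f x ω‖ / δ)) ∂μ := by
          refine add_le_add h5 ?_
          rw [← lintegral_const_mul' _ _ ENNReal.ofReal_ne_top]
          refine lintegral_mono fun ω => ?_
          dsimp only
          rw [← ENNReal.ofReal_mul hC0]
          refine ENNReal.ofReal_le_ofReal ?_
          have h6 := hC (‖f x ω‖ / δ) (by positivity) (by positivity)
          rwa [show 2 * δ * (‖f x ω‖ / δ) = 2 * ‖f x ω‖ by field_simp] at h6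
      _ ≤ _ := by gcongr
  obtain ⟨C, hC, hCK⟩ := exists_bound_of_isCompact hK hloc
  have hm : AEMeasurable (fun p : Rd d × Ω => ENNReal.ofReal (Ψ ‖f p.1 p.2‖)) (measQ Q μ) :=
    hΨ.aemeasurable_ofReal (hf.measurable).norm fun p => norm_nonneg _
  rw [lintegral_prod _ hm]
  refine ne_top_of_le_ne_top (ENNReal.mul_ne_top hC hK.measure_lt_top.ne) (b := C * volume K) ?_
  calc _ ≤ ∫⁻ x in Q, K.indicator (fun _ => C) x := by
        refine setLIntegral_mono' hQ.measurableSet fun x hx => ?_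
        by_cases hxK : x ∈ K
        · rw [indicator_of_mem hxK]; exact hCK x hxK
        · rw [indicator_of_notMem hxK, lintegral_congr_ae (g := fun _ => 0), lintegral_zero]
          filter_upwards [hf0 x ⟨hx, hxK⟩] with ω hω
          rw [hω, norm_zero, hΨ.zero, ENNReal.ofReal_zero]
    _ ≤ ∫⁻ x, K.indicator (fun _ => C) x := setLIntegral_le_lintegral _ _
    _ = _ := lintegral_indicator_const hK.measurableSet _

theorem WeakSigmaConverges.pairingData (hQ : IsOpen Q) (hε₁ : IsScale ε₁) (hε₂ : IsScale ε₂)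
    (hA : IsHSupralgebra ε₁ A) (hP : IsYoungPair Φ Ψ) (hE : E ⊆ Ioi 0)
    (h : WeakSigmaConverges Q T ε₁ ε₂ A Φ E u u₀) : PairingData Q T ε₁ ε₂ A Φ Ψ E u u₀ := by
  refine ⟨hQ, hε₁, hε₂, hA, hP, hE, fun ε hε => (h.mem ε hε).1, fun κ hκ => ?_, h.limit_mem,
    h.pairing⟩
  obtain ⟨C, hC⟩ := h.bounded
  set δ := max C 0 + 1 with hδ
  have hδ0 : 0 < δ := by positivity
  have hs0 : 0 < min κ 1 := by positivity
  refine ⟨min κ 1 * δ⁻¹, by positivity, fun ε hε => ?_⟩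
  have h1 : luxNorm Φ (measQ Q μ) (fun p => u ε p.1 p.2) < ENNReal.ofReal δ :=
    (hC ε hε).trans_lt ((ENNReal.ofReal_lt_ofReal_iff hδ0).2 (by
      linarith [le_max_left C 0]))
  have h2 := lintegral_luxNorm_le hP.left hδ0 h1
  have h3 := hP.left.lintegral_smul_le (m := measQ Q μ) (g := fun p => ‖u ε p.1 p.2‖ / δ)
    (fun p => by positivity) hs0.le (min_le_right κ 1)
  have h4 : ∀ p : Rd d × Ω, min κ 1 * δ⁻¹ * ‖u ε p.1 p.2‖ = min κ 1 * (‖u ε p.1 p.2‖ / δ) :=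
    fun p => by ring
  simp only [h4]
  calc _ ≤ _ := h3
    _ ≤ ENNReal.ofReal (min κ 1) * 1 := by gcongr
    _ ≤ ENNReal.ofReal κ := by
      rw [mul_one]; exact ENNReal.ofReal_le_ofReal (min_le_left _ _)

/-- Admissibility supplies the measurability of the traces and the membership of `f(x, ω)` in the
closure of `A`; continuity in `x` supplies the finite modular. -/
theorem WeakSigmaConverges.pairingConverges (hQ : IsOpen Q) (hε₁ : IsScale ε₁) (hε₂ : IsScale ε₂)
    (hA : IsHSupralgebra ε₁ A) (hP : IsYoungPair Φ Ψ) (hE : E ⊆ Ioi 0)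
    (h : WeakSigmaConverges Q T ε₁ ε₂ A Φ E u u₀) (hf : MemKOrlicz Q μ Ψ ε₁ A f)
    (hf' : IsAdmissible Q T ε₁ ε₂ A Ψ (fun x ω => (f x ω : Rd d → ℂ))) :
    PairingConverges Q T ε₁ ε₂ E u u₀ (fun x ω => (f x ω : Rd d → ℂ)) := by
  obtain ⟨K, hK, hKQ, -, hf0⟩ := MemK.exists_compact hQ hf
  refine (IsPairable.of_lp (h.pairingData hQ hε₁ hε₂ hA hP hE) hK hKQ hf.measurable hf0
    (hf.lintegral_ne_top hP.right hQ) ?_ fun ε hε => (hf'.trace_mem ε hε).1).converges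
  filter_upwards [hf'.mem.mem] with p hp
  exact hp.mx hε₁ hP.right

theorem MemKLinfty.exists_bound {e : ℝ → ℝ} (hQ : IsOpen Q) (hf : MemKLinfty Q μ Φ e A f) :
    ∃ C : ℝ, 0 ≤ C ∧ ∀ᵐ p ∂(measQ Q μ), ‖f p.1 p.2‖ ≤ C := by
  obtain ⟨K, hK, hKQ, hf0, -⟩ := MemK.exists_compact hQ hf
  have hloc : ∀ x ∈ K, ∃ C : ℝ≥0∞, C ≠ ∞ ∧ ∀ᶠ x' in 𝓝 x, eLpNorm (f x') ∞ μ ≤ C := by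
    intro x hx
    have h1 : eLpNorm (f x) ∞ μ < ∞ := hf.norm_lt_top x (hKQ hx)
    refine ⟨1 + eLpNorm (f x) ∞ μ, ENNReal.add_ne_top.2 ⟨ENNReal.one_ne_top, h1.ne⟩, ?_⟩
    filter_upwards [(hf.continuous x (hKQ hx)).eventually (gt_mem_nhds one_pos)] with x' hx'
    have h2 : f x' = (fun ω => f x' ω - f x ω) + f x := by
      funext ω; simp
    rw [h2]
    refine le_trans ?_ (add_le_add_left hx'.le _)
    simp only [eLpNorm_exponent_top]
    exact eLpNormEssSup_add_le
  obtain ⟨C, hC, hCK⟩ := exists_bound_of_isCompact hK hloc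
  refine ⟨C.toReal, ENNReal.toReal_nonneg, ae_of_forall_slice hQ hf.measurable
    (P := fun _ w => ‖w‖ ≤ C.toReal) (fun g hg => ?_) fun x hx => ?_⟩
  · exact hg.norm.measurable measurableSet_Iic
  · by_cases hxK : x ∈ K
    · filter_upwards [ae_le_eLpNormEssSup (f := f x) (μ := μ)] with ω hω
      rw [← toReal_enorm]
      refine ENNReal.toReal_mono hC (hω.trans ?_)
      rw [← eLpNorm_exponent_top]
      exact hCK x hxK
    · filter_upwards [hf0 x ⟨hx, hxK⟩] with ω hω
      rw [hω, norm_zero]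
      exact ENNReal.toReal_nonneg

end CompactSupport

/-! ### Finite sums of elementary tensors and their traces -/

section Tensor

variable {d : ℕ} {Ω : Type*} [MeasurableSpace Ω] {μ : Measure Ω} [IsProbabilityMeasure μ]
  {T : DynSystem d μ} {Q : Set (Rd d)} {ε₁ ε₂ e : ℝ → ℝ} {A : StarSubalgebra ℂ (Rd d →ᵇ ℂ)}
  {Φ Ψ : ℝ → ℝ} {ι κ : Type*} [Fintype ι] [Fintype κ] {φ : ι → Rd d → ℂ} {ψ : ι → Ω → ℂ}
  {g : ι → Rd d →ᵇ ℂ}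

theorem MX.mean_phi_le {v : Rd d → ℂ} (hv : MX Φ A v) (hA : IsHSupralgebra e A) (he : IsScale e)
    (hΦ : YoungFn Φ) {c C : ℝ} (hc : 0 < c) (hC : ∀ y, ‖v y‖ ≤ C) :
    (mean fun y => Φ (c * ‖v y‖)) ≤ Φ (c * C) := by
  refine le_of_tendsto (hv.hasBallMean_phi hA he hΦ hc) ?_
  filter_upwards [eventually_ge_atTop 1] with R hR
  have := isProbabilityMeasure_ballMeas (d := d) (one_pos.trans_le hR)
  calc _ ≤ ∫ _, Φ (c * C) ∂(ballMeas d R) := by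
        refine integral_mono (hv.integrable_phi hΦ hc hR) (integrable_const _) fun y => ?_
        exact hΦ.mono (by positivity) (by have := hC y; gcongr)
    _ = _ := by simp

theorem MX.meanLuxNorm_le {v : Rd d → ℂ} (hv : MX Φ A v) (hA : IsHSupralgebra e A)
    (he : IsScale e) (hΦ : YoungFn Φ) {δ C : ℝ} (hδ : 0 < δ) (hC : ∀ y, ‖v y‖ ≤ C)
    (h : Φ (δ⁻¹ * C) ≤ 1) : meanLuxNorm Φ v ≤ ENNReal.ofReal δ := by
  refine iInf_le_of_le δ (iInf_le_of_le hδ (iInf_le_of_le ?_ le_rfl))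
  have h1 : ∀ y, ‖v y‖ / δ = δ⁻¹ * ‖v y‖ := fun y => by ring
  simp only [h1]
  exact (hv.mean_phi_le hA he hΦ (inv_pos.2 hδ) hC).trans h

theorem memX_of_mem (hΦ : YoungFn Φ) {w : Rd d →ᵇ ℂ} (hw : w ∈ A) : MemX Φ e A w := by
  refine ⟨w.continuous.aestronglyMeasurable, fun η hη => ⟨w, hw, iSup₂_le fun ε _ => ?_⟩⟩
  exact iInf_le_of_le η (iInf_le_of_le hη (iInf_le_of_le (by simp [hΦ.zero]) le_rfl))

/-- The function `∑ᵢ φᵢ ⊗ ψᵢ ⊗ gᵢ`. -/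
def tensor (φ : ι → Rd d → ℂ) (ψ : ι → Ω → ℂ) (g : ι → Rd d →ᵇ ℂ) : Rd d → Ω → Rd d → ℂ :=
  fun x ω y => ∑ i, φ i x * ψ i ω * g i y

theorem tensor_eq_coe (φ : ι → Rd d → ℂ) (ψ : ι → Ω → ℂ) (g : ι → Rd d →ᵇ ℂ) (x : Rd d) (ω : Ω) :
    tensor φ ψ g x ω = (∑ i, (φ i x * ψ i ω) • g i : Rd d →ᵇ ℂ) := by
  funext y
  simp [tensor]

theorem trace_tensor (φ : ι → Rd d → ℂ) (ψ : ι → Ω → ℂ) (g : ι → Rd d →ᵇ ℂ) (ε : ℝ) (x : Rd d)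
    (ω : Ω) : trace T ε₁ ε₂ (tensor φ ψ g) ε x ω =
      ∑ i, φ i x * ψ i (T.toFun ((ε₁ ε)⁻¹ • x) ω) * g i ((ε₂ ε)⁻¹ • x) := by
  unfold trace
  rw [tensor_eq_coe, pointValue_of_continuous _ (map_continuous _)]
  simp

theorem sum_elementary_mul_sum_elementary (a b c : ι → ℂ) (a' b' c' : κ → ℂ) :
    (∑ i, a i * b i * c i) * ∑ j, a' j * b' j * c' j =
      ∑ k : ι × κ, (a k.1 * a' k.2) * (b k.1 * b' k.2) * (c k.1 * c' k.2) := by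
  rw [Finset.sum_mul_sum, ← Finset.univ_product_univ, Finset.sum_product]
  refine Finset.sum_congr rfl fun i _ => Finset.sum_congr rfl fun j _ => ?_
  ring

theorem exists_bound_tensor (hφ : ∀ i, Continuous (φ i)) (hφc : ∀ i, HasCompactSupport (φ i))
    (hψ : ∀ i, MemLp (ψ i) ∞ μ) (g : ι → Rd d →ᵇ ℂ) :
    ∃ C : ℝ, 0 ≤ C ∧ ∀ᵐ p ∂(measQ Q μ), ∀ y : ι → Rd d,
      ‖∑ i, φ i p.1 * ψ i p.2 * g i (y i)‖ ≤ C := by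
  choose C hC0 hC using fun i => exists_bound_elementary (Q := Q) (hφ i) (hφc i) (hψ i) (g i)
  refine ⟨∑ i, C i, Finset.sum_nonneg fun i _ => hC0 i, ?_⟩
  filter_upwards [ae_all_iff.2 hC] with p hp y
  exact norm_sum_le_of_le _ fun i _ => hp i (y i)

theorem exists_compact_tensor (hφc : ∀ i, HasCompactSupport (φ i)) :
    ∃ K, IsCompact K ∧ ∀ i x, x ∉ K → φ i x = 0 :=
  ⟨⋃ i, tsupport (φ i), isCompact_iUnion fun i => hφc i, fun i _ hx =>
    image_eq_zero_of_notMem_tsupport fun h => hx (mem_iUnion.2 ⟨i, h⟩)⟩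

/-- The tensor depends on `(x, ω)` through finitely many scalar coefficients. Simple approximations
of these, combined linearly with the `gᵢ`, stay in `A` and converge uniformly in `y`. -/
theorem exists_tendsto_simpleFunc_tensor (hA : IsHSupralgebra e A) (he : IsScale e)
    (hΦ : YoungFn Φ) (hφ : ∀ i, Continuous (φ i)) (hψ : ∀ i, MemLp (ψ i) ∞ μ)
    (hg : ∀ i, g i ∈ A) :
    ∃ s : ℕ → SimpleFunc (Rd d × Ω) (Rd d →ᵇ ℂ), (∀ n p, s n p ∈ A) ∧
      ∀ᵐ p ∂(measQ Q μ), Tendsto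
        (fun n => meanLuxNorm Φ (fun y => tensor φ ψ g p.1 p.2 y - s n p y)) atTop (𝓝 0) := by
  set a : Rd d × Ω → ι → ℂ := fun p i => φ i p.1 * (hψ i).1.mk (ψ i) p.2 with ha
  have ham : StronglyMeasurable a := by
    refine (measurable_pi_lambda _ fun i => ?_).stronglyMeasurable
    exact ((hφ i).measurable.comp measurable_fst).mul
      ((hψ i).1.stronglyMeasurable_mk.measurable.comp measurable_snd)
  set L : (ι → ℂ) → Rd d →ᵇ ℂ := fun z => ∑ i, z i • g i with hL
  have hLc : Continuous L := by fun_prop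
  have hLA : ∀ z, L z ∈ A := fun z => sum_mem fun i _ => A.smul_mem (hg i) (z i)
  refine ⟨fun n => (ham.approx n).map L, fun n p => hLA _, ?_⟩
  filter_upwards [ae_snd (Q := Q) (ae_all_iff.2 fun i => (hψ i).1.ae_eq_mk)] with p hp
  have h1 : tensor φ ψ g p.1 p.2 = L (a p) := by
    rw [tensor_eq_coe]
    simp only [hL, ha, hp]
  obtain ⟨t, ht, htΦ⟩ := hΦ.exists_pos_le one_pos
  set z : ℕ → ℝ := fun n => ‖L (a p) - L (ham.approx n p)‖ with hz
  have hzlim : Tendsto z atTop (𝓝 0) := by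
    have h2 := (hLc.tendsto (a p)).comp (ham.tendsto_approx p)
    simpa using ((tendsto_const_nhds (x := L (a p))).sub h2).norm
  -- The added `1/(n+1)` keeps the Luxemburg parameter positive when `z n = 0`.
  have hlim : Tendsto (fun n : ℕ => ENNReal.ofReal ((z n + 1 / ((n : ℝ) + 1)) / t)) atTop
      (𝓝 0) := by
    have h2 := ENNReal.tendsto_ofReal
      ((hzlim.add tendsto_one_div_add_atTop_nhds_zero_nat).div_const t)
    simpa using h2
  refine tendsto_of_tendsto_of_tendsto_of_le_of_le tendsto_const_nhds hlim (fun _ => zero_le)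
    fun n => ?_
  have hz0 : 0 ≤ z n := norm_nonneg _
  have h3 : (fun y => tensor φ ψ g p.1 p.2 y - (ham.approx n).map L p y) =
      (L (a p) - L (ham.approx n p) : Rd d →ᵇ ℂ) := by
    funext y
    rw [h1]
    rfl
  dsimp only
  rw [h3]
  have hpos : 0 < (z n + 1 / ((n : ℝ) + 1)) / t := by positivity
  refine (MX.of_mem hΦ (sub_mem (hLA _) (hLA _))).meanLuxNorm_le hA he hΦ hpos
    (C := z n) (fun y => BoundedContinuousFunction.norm_coe_le_norm _ y) ?_
  refine (hΦ.mono (by positivity) ?_).trans htΦ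
  rw [inv_mul_le_iff₀ hpos, div_mul_cancel₀ _ ht.ne']
  have : 0 < 1 / ((n : ℝ) + 1) := by positivity
  linarith

theorem memOrliczX_tensor (hA : IsHSupralgebra e A) (he : IsScale e) (hΦ : YoungFn Φ)
    (hφ : ∀ i, Continuous (φ i)) (hφc : ∀ i, HasCompactSupport (φ i))
    (hψ : ∀ i, MemLp (ψ i) ∞ μ) (hg : ∀ i, g i ∈ A) :
    MemOrliczX Q μ Φ e A (tensor φ ψ g) := by
  have hmem : ∀ x ω, (∑ i, (φ i x * ψ i ω) • g i : Rd d →ᵇ ℂ) ∈ A := fun x ω =>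
    sum_mem fun i _ => A.smul_mem (hg i) _
  have hmx : ∀ x ω, MX Φ A (tensor φ ψ g x ω) := fun x ω => by
    rw [tensor_eq_coe]
    exact MX.of_mem hΦ (hmem x ω)
  refine ⟨Eventually.of_forall fun p => ?_,
    exists_tendsto_simpleFunc_tensor hA he hΦ hφ hψ hg, ?_⟩
  · rw [tensor_eq_coe]
    exact memX_of_mem hΦ (hmem _ _)
  · obtain ⟨C, hC0, hC⟩ := exists_bound_tensor (Q := Q) hφ hφc hψ g
    obtain ⟨K, hK, hφK⟩ := exists_compact_tensor hφc
    have hlim : Tendsto (fun δ : ℝ => ENNReal.ofReal (Φ (max (δ * C) 0)) * volume K) (𝓝[>] 0)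
        (𝓝 0) := by
      have h1 : Tendsto (fun δ : ℝ => Φ (max (δ * C) 0)) (𝓝 0) (𝓝 (Φ (max (0 * C) 0))) :=
        (hΦ.continuous_max.comp (continuous_id.mul continuous_const)).tendsto 0
      have h2 := ENNReal.Tendsto.mul_const (ENNReal.tendsto_ofReal h1)
        (b := volume K)
        (Or.inr hK.measure_lt_top.ne)
      simp only [zero_mul, max_self, hΦ.zero, ENNReal.ofReal_zero] at h2
      exact h2.mono_left nhdsWithin_le_nhds
    refine tendsto_of_tendsto_of_tendsto_of_le_of_le' tendsto_const_nhds hlim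
      (Eventually.of_forall fun _ => zero_le) ?_
    filter_upwards [self_mem_nhdsWithin] with δ hδ
    have hδ : 0 < δ := hδ
    rw [max_eq_left (by positivity)]
    have hb : ∀ p : Rd d × Ω, ‖K.indicator (fun _ => (C : ℂ)) p.1‖ ≤ C := fun p => by
      by_cases h : p.1 ∈ K
      · simp [indicator_of_mem h, abs_of_nonneg hC0]
      · simpa [indicator_of_notMem h] using hC0
    refine le_trans (lintegral_mono_ae ?_) (hΦ.lintegral_le_of_bounded (μ := μ) (Q := Q) hK
      (v := fun p => K.indicator (fun _ => (C : ℂ)) p.1) hδ.le (Eventually.of_forall hb)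
      (Eventually.of_forall fun p hp => indicator_of_notMem hp _))
    filter_upwards [hC] with p hp
    refine ENNReal.ofReal_le_ofReal ((hmx p.1 p.2).mean_phi_le hA he hΦ hδ fun y => ?_)
    by_cases h : p.1 ∈ K
    · simpa [tensor, indicator_of_mem h, abs_of_nonneg hC0] using hp fun _ => y
    · simp [tensor, indicator_of_notMem h, hφK _ _ h]

theorem integrable_elementary {φ : Rd d → ℂ} (hφ : Continuous φ) (hφc : HasCompactSupport φ)
    {ψ : Ω → ℂ} (hψ : MemLp ψ ∞ μ) (g : Rd d →ᵇ ℂ) (T : DynSystem d μ) {r s : ℝ} (hr : r ≠ 0) :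
    Integrable (fun p : Rd d × Ω => φ p.1 * ψ (T.toFun (r • p.1) p.2) * g (s • p.1))
      (measQ Q μ) := by
  obtain ⟨C, hC0, hC⟩ := exists_ae_bound_of_memLp_top hψ
  have h1 : Integrable (fun p : Rd d × Ω => φ p.1 * (1 : ℂ)) (measQ Q μ) :=
    Integrable.mul_prod (f := φ) (g := fun _ => (1 : ℂ))
      (hφ.integrable_of_hasCompactSupport hφc).restrict (integrable_const _)
  refine Integrable.mono' ((h1.norm.mul_const (C * ‖g‖)))
    (aestronglyMeasurable_trace_elementary hφ hψ.1 g hr) ?_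
  filter_upwards [T.ae_shift hr (ae_snd (Q := Q) hC)] with p hp
  rw [norm_mul, norm_mul, mul_one, mul_assoc]
  gcongr
  · exact hp
  · exact g.norm_coe_le_norm _

/-- For fixed `x`, invariance of `μ` removes `T(rx)` from the `ω`-integral, which decouples it from
the `x`-integral. -/
theorem integral_elementary {φ : Rd d → ℂ} (hφ : Continuous φ) (hφc : HasCompactSupport φ)
    (hφQ : tsupport φ ⊆ Q) {ψ : Ω → ℂ} (hψ : MemLp ψ ∞ μ) (g : Rd d →ᵇ ℂ) (T : DynSystem d μ)
    {r s : ℝ} (hr : r ≠ 0) :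
    ∫ p, φ p.1 * ψ (T.toFun (r • p.1) p.2) * g (s • p.1) ∂(measQ Q μ) =
      (∫ ω, ψ ω ∂μ) * ∫ x, g (s • x) * φ x := by
  have h0 := setIntegral_eq_integral_of_forall_compl_eq_zero (μ := volume) (s := Q)
    (f := fun x => (∫ ω, ψ ω ∂μ) * (g (s • x) * φ x)) fun x hx => by
      rw [image_eq_zero_of_notMem_tsupport fun h => hx (hφQ h), mul_zero, mul_zero]
  rw [integral_prod _ (integrable_elementary hφ hφc hψ g T hr), ← integral_const_mul, ← h0]
  refine integral_congr_ae (Eventually.of_forall fun x => ?_)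
  dsimp only
  have h1 : ∫ ω, ψ (T.toFun (r • x) ω) ∂μ = ∫ ω, ψ ω ∂μ := by
    have h2 := T.measurePreserving (r • x)
    have h3 := integral_map h2.measurable.aemeasurable (f := ψ) (by
      rw [h2.map_eq]; exact hψ.1)
    rw [← h3, h2.map_eq]
  rw [integral_mul_const, integral_const_mul, h1]
  ring

/-- Once the `ω`-integral is decoupled, only the oscillation of `gᵢ(x/ε₂)` remains, and it averages
to the mean value tested against `φᵢ`. -/
theorem tendsto_integral_trace_tensor (hA : IsHSupralgebra ε₁ A) (hε₁ : IsScale ε₁)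
    (hε₂ : IsScale ε₂) (T : DynSystem d μ) (hφ : ∀ i, Continuous (φ i))
    (hφc : ∀ i, HasCompactSupport (φ i)) (hφQ : ∀ i, tsupport (φ i) ⊆ Q)
    (hψ : ∀ i, MemLp (ψ i) ∞ μ) (hg : ∀ i, g i ∈ A) :
    Tendsto (fun ε => ∫ p, trace T ε₁ ε₂ (tensor φ ψ g) ε p.1 p.2 ∂(measQ Q μ)) (𝓝[>] 0)
      (𝓝 (∫ p, mean (tensor φ ψ g p.1 p.2) ∂(measQ Q μ))) := by
  choose m hm using fun i => hA.2 (g i) (hg i)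
  have hφi : ∀ i, Integrable (φ i) := fun i => (hφ i).integrable_of_hasCompactSupport (hφc i)
  have hmean : ∀ x ω, mean (tensor φ ψ g x ω) = ∑ i, φ i x * ψ i ω * m i := by
    intro x ω
    refine HasBallMean.mean_eq ?_
    have h1 := tendsto_finsetSum Finset.univ fun i _ =>
      Tendsto.const_mul (φ i x * ψ i ω) ((hm i).hasBallMean hε₁)
    refine h1.congr' ?_
    filter_upwards [eventually_gt_atTop 0] with R hR
    have := isProbabilityMeasure_ballMeas (d := d) hR
    simp only [tensor]
    rw [integral_finsetSum _ fun i _ => ((g i).integrable _).const_mul _]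
    simp only [integral_const_mul]
  have hlimit : ∫ p, mean (tensor φ ψ g p.1 p.2) ∂(measQ Q μ) =
      ∑ i, (∫ ω, ψ i ω ∂μ) * (m i * ∫ x, φ i x) := by
    simp only [hmean]
    rw [integral_finsetSum _ fun i _ => (Integrable.mul_prod (hφi i).restrict
      ((hψ i).integrable le_top)).mul_const _]
    refine Finset.sum_congr rfl fun i _ => ?_
    rw [integral_mul_const, integral_prod_mul,
      setIntegral_eq_integral_of_forall_compl_eq_zero fun x hx =>
        image_eq_zero_of_notMem_tsupport fun h => hx (hφQ i h)]
    ring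
  rw [hlimit]
  have hs : Tendsto ε₂ (𝓝[>] 0) (𝓝[>] 0) := by
    refine tendsto_nhdsWithin_iff.2 ⟨hε₂.tendsto_zero, ?_⟩
    filter_upwards [self_mem_nhdsWithin] with ε hε
    exact hε₂.pos ε hε
  have h1 := tendsto_finsetSum Finset.univ fun i _ =>
    Tendsto.const_mul (∫ ω, ψ i ω ∂μ) ((hm i).tendsto_scale hε₁ (hφi i) hs)
  refine h1.congr' ?_
  filter_upwards [self_mem_nhdsWithin] with ε hε
  have hr : (ε₁ ε)⁻¹ ≠ 0 := inv_ne_zero (hε₁.pos ε hε).ne'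
  simp only [trace_tensor]
  rw [integral_finsetSum _ fun i _ => integrable_elementary (hφ i) (hφc i) (hψ i) (g i) T hr]
  refine Finset.sum_congr rfl fun i _ => ?_
  rw [integral_elementary (hφ i) (hφc i) (hφQ i) (hψ i) (g i) T hr]

end Tensor

/-! ### Weak convergence of traces by duality -/

section TraceFamilies

variable {d : ℕ} {Ω : Type*} [MeasurableSpace Ω] {μ : Measure Ω} [IsProbabilityMeasure μ]
  {T : DynSystem d μ} {Q : Set (Rd d)} {ε₁ ε₂ : ℝ → ℝ} {A : StarSubalgebra ℂ (Rd d →ᵇ ℂ)}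
  {Φ Ψ : ℝ → ℝ}

theorem YoungFn.exists_lintegral_le (hΨ : YoungFn Ψ) {K : Set (Rd d)} (hK : IsCompact K) {C : ℝ}
    (hC0 : 0 ≤ C) {κ : ℝ} (hκ : 0 < κ) :
    ∃ c : ℝ, 0 < c ∧ ∀ v : Rd d × Ω → ℂ, (∀ᵐ p ∂(measQ Q μ), ‖v p‖ ≤ C) →
      (∀ᵐ p ∂(measQ Q μ), p.1 ∉ K → v p = 0) →
      ∫⁻ p, ENNReal.ofReal (Ψ (c * ‖v p‖)) ∂(measQ Q μ) ≤ ENNReal.ofReal κ := by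
  set V := volume.real K with hV
  have hV0 : 0 ≤ V := measureReal_nonneg
  have hKV : volume K = ENNReal.ofReal V := (ENNReal.ofReal_toReal hK.measure_lt_top.ne).symm
  obtain ⟨t, ht, htΨ⟩ := hΨ.exists_pos_le (η := κ / (V + 1)) (by positivity)
  refine ⟨t / (C + 1), by positivity, fun v hv hv0 => ?_⟩
  have h1 : Ψ (t / (C + 1) * C) ≤ κ / (V + 1) := by
    refine (hΨ.mono (by positivity) ?_).trans htΨ
    rw [div_mul_eq_mul_div, div_le_iff₀ (by positivity)]
    gcongr
    linarith
  refine (hΨ.lintegral_le_of_bounded hK (by positivity) hv hv0).trans ?_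
  rw [hKV, ← ENNReal.ofReal_mul (hΨ.nonneg _ (by positivity))]
  refine ENNReal.ofReal_le_ofReal ?_
  calc _ ≤ κ / (V + 1) * (V + 1) := by gcongr; linarith
    _ = κ := by field_simp

theorem luxNorm_le_of_lintegral_le {α F : Type*} [MeasurableSpace α] [NormedAddCommGroup F]
    {m : Measure α} {f : α → F} {c : ℝ} (hc : 0 < c)
    (h : ∫⁻ a, ENNReal.ofReal (Φ (c * ‖f a‖)) ∂m ≤ 1) : luxNorm Φ m f ≤ ENNReal.ofReal c⁻¹ := by
  refine iInf_le_of_le c⁻¹ (iInf_le_of_le (inv_pos.2 hc) (iInf_le_of_le ?_ le_rfl))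
  have h1 : ∀ a, ‖f a‖ / c⁻¹ = c * ‖f a‖ := fun a => by rw [div_inv_eq_mul, mul_comm]
  simpa only [h1] using h

/-- As `A` is an algebra, a product of two tensors is a tensor indexed by `ι × κ`, and for such
continuous functions of `y` the trace is multiplicative. -/
theorem pairingConverges_trace_tensor {ι κ : Type*} [Fintype ι] [Fintype κ] {φ : ι → Rd d → ℂ}
    {ψ : ι → Ω → ℂ} {g : ι → Rd d →ᵇ ℂ} {φ' : κ → Rd d → ℂ} {ψ' : κ → Ω → ℂ}
    {g' : κ → Rd d →ᵇ ℂ} (hA : IsHSupralgebra ε₁ A) (hε₁ : IsScale ε₁) (hε₂ : IsScale ε₂)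
    (hφ : ∀ i, Continuous (φ i)) (hφc : ∀ i, HasCompactSupport (φ i))
    (hφQ : ∀ i, tsupport (φ i) ⊆ Q) (hψ : ∀ i, MemLp (ψ i) ∞ μ) (hg : ∀ i, g i ∈ A)
    (hφ' : ∀ i, Continuous (φ' i)) (hψ' : ∀ i, MemLp (ψ' i) ∞ μ) (hg' : ∀ i, g' i ∈ A) :
    PairingConverges Q T ε₁ ε₂ (Ioi 0) (trace T ε₁ ε₂ (tensor φ ψ g)) (tensor φ ψ g)
      (tensor φ' ψ' g') := by
  have h1 := tendsto_integral_trace_tensor (Q := Q) hA hε₁ hε₂ T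
    (φ := fun k : ι × κ => fun x => φ k.1 x * φ' k.2 x)
    (ψ := fun k : ι × κ => fun ω => ψ k.1 ω * ψ' k.2 ω) (g := fun k : ι × κ => g k.1 * g' k.2)
    (fun k => (hφ k.1).mul (hφ' k.2)) (fun k => (hφc k.1).mul_right)
    (fun k => (tsupport_mul_subset_left).trans (hφQ k.1))
    (fun k => (hψ' k.2).mul (hψ k.1)) (fun k => mul_mem (hg k.1) (hg' k.2))
  unfold PairingConverges
  have h2 : ∀ x ω y, tensor φ ψ g x ω y * tensor φ' ψ' g' x ω y =
      tensor (fun k : ι × κ => fun x => φ k.1 x * φ' k.2 x)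
        (fun k : ι × κ => fun ω => ψ k.1 ω * ψ' k.2 ω) (fun k : ι × κ => g k.1 * g' k.2) x ω y :=
    fun x ω y => sum_elementary_mul_sum_elementary _ _ _ _ _ _
  have h3 : ∀ ε x ω, trace T ε₁ ε₂ (tensor φ ψ g) ε x ω * trace T ε₁ ε₂ (tensor φ' ψ' g') ε x ω =
      trace T ε₁ ε₂ (tensor (fun k : ι × κ => fun x => φ k.1 x * φ' k.2 x)
        (fun k : ι × κ => fun ω => ψ k.1 ω * ψ' k.2 ω) (fun k : ι × κ => g k.1 * g' k.2)) ε x ω :=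
    fun ε x ω => by
      rw [trace_tensor, trace_tensor, trace_tensor, sum_elementary_mul_sum_elementary]
      rfl
  simp only [h2, h3]
  exact h1

/-- This lets the traces of a test function play the part of the weakly convergent family. -/
theorem pairingData_trace_tensor {ι : Type*} [Fintype ι] {φ : ι → Rd d → ℂ}
    {ψ : ι → Ω → ℂ} {g : ι → Rd d →ᵇ ℂ} (hQ : IsOpen Q) (hA : IsHSupralgebra ε₁ A)
    (hε₁ : IsScale ε₁) (hε₂ : IsScale ε₂) (hP : IsYoungPair Φ Ψ)
    (hφ : ∀ i, Continuous (φ i)) (hφc : ∀ i, HasCompactSupport (φ i))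
    (hφQ : ∀ i, tsupport (φ i) ⊆ Q) (hψ : ∀ i, MemLp (ψ i) ∞ μ) (hg : ∀ i, g i ∈ A) :
    PairingData Q T ε₁ ε₂ A Φ Ψ (Ioi 0) (trace T ε₁ ε₂ (tensor φ ψ g)) (tensor φ ψ g) := by
  have hr : ∀ ε ∈ Ioi (0 : ℝ), (ε₁ ε)⁻¹ ≠ 0 := fun ε hε => inv_ne_zero (hε₁.pos ε hε).ne'
  refine ⟨hQ, hε₁, hε₂, hA, hP, subset_rfl, fun ε hε => ?_, fun κ hκ => ?_,
    memOrliczX_tensor hA hε₁ hP.left hφ hφc hψ hg, ?_⟩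
  · simp only [trace_tensor]
    exact Finset.aestronglyMeasurable_fun_sum _ fun i _ =>
      aestronglyMeasurable_trace_elementary (hφ i) (hψ i).1 (g i) (hr ε hε)
  · obtain ⟨C, hC0, hC⟩ := exists_bound_tensor (Q := Q) hφ hφc hψ g
    obtain ⟨K, hK, hφK⟩ := exists_compact_tensor hφc
    obtain ⟨c, hc, hcv⟩ := hP.left.exists_lintegral_le (μ := μ) (Q := Q) hK hC0 hκ
    refine ⟨c, hc, fun ε hε => hcv (fun p => trace T ε₁ ε₂ (tensor φ ψ g) ε p.1 p.2) ?_ ?_⟩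
    · filter_upwards [T.ae_shift (hr ε hε) hC] with p hp
      rw [trace_tensor]
      exact hp fun _ => (ε₂ ε)⁻¹ • p.1
    · refine Eventually.of_forall fun p hp => ?_
      rw [trace_tensor]
      exact Finset.sum_eq_zero fun i _ => by rw [hφK i _ hp, zero_mul, zero_mul]
  · rintro f ⟨n, φ', ψ', g', hφ', hψ', hg', rfl⟩
    exact pairingConverges_trace_tensor hA hε₁ hε₂ hφ hφc hφQ hψ hg
      (fun i => (hφ' i).1.continuous) (fun i => (hψ' i).memLp) hg'

/-- The Lipschitz bound for point values on a separable set, applied with zero adjoined to the range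
and taken as second function. -/
theorem ae_norm_trace_le {f : Rd d → Ω → Lp ℂ ∞ (volume : Measure (Rd d))}
    (hf : AEStronglyMeasurable (fun p : Rd d × Ω => f p.1 p.2) (measQ Q μ)) (hε₁ : IsScale ε₁)
    (hε₂ : IsScale ε₂) (T : DynSystem d μ) {ε : ℝ} (hε : 0 < ε) :
    ∀ᵐ p ∂(measQ Q μ), ‖trace T ε₁ ε₂ (fun x ω => (f x ω : Rd d → ℂ)) ε p.1 p.2‖ ≤
      ‖f p.1 (T.toFun ((ε₁ ε)⁻¹ • p.1) p.2)‖ := by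
  have hS : TopologicalSpace.IsSeparable (insert 0 (range (hf.mk _))) := by
    rw [insert_eq]
    exact (finite_singleton _).isSeparable.union hf.stronglyMeasurable_mk.isSeparable_range
  filter_upwards [T.ae_shift (inv_ne_zero (hε₁.pos ε hε).ne') hf.ae_eq_mk,
    ae_smul_fst (μ := μ) (Q := Q) (inv_ne_zero (hε₂.pos ε hε).ne')
      (ae_forall_norm_pointValue_sub_le hS)] with p h1 h2
  have h3 : f p.1 (T.toFun ((ε₁ ε)⁻¹ • p.1) p.2) = hf.mk _ (T.shift (ε₁ ε)⁻¹ p) := h1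
  have h4 := h2 _ (mem_insert_of_mem _ (mem_range_self (T.shift (ε₁ ε)⁻¹ p))) 0 (mem_insert _ _)
  have h5 : pointValue ((0 : Lp ℂ ∞ (volume : Measure (Rd d))) : Rd d → ℂ) ((ε₂ ε)⁻¹ • p.1) = 0 := by
    rw [pointValue_congr (Lp.coeFn_zero ℂ ∞ (volume : Measure (Rd d)))]
    exact pointValue_zero _
  unfold trace
  dsimp only
  rw [h3]
  rwa [h5, sub_zero, sub_zero] at h4

theorem weakSigmaConverges_trace (hQ : IsOpen Q) (hε₁ : IsScale ε₁) (hε₂ : IsScale ε₂)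
    (hA : IsHSupralgebra ε₁ A) (hP : IsYoungPair Φ Ψ)
    {v : Rd d → Ω → Lp ℂ ∞ (volume : Measure (Rd d))} (hv : MemKLinfty Q μ Φ ε₁ A v)
    (hv' : IsAdmissible Q T ε₁ ε₂ A Φ (fun x ω => (v x ω : Rd d → ℂ))) :
    WeakSigmaConverges Q T ε₁ ε₂ A Φ (Ioi 0)
      (fun ε => trace T ε₁ ε₂ (fun x ω => (v x ω : Rd d → ℂ)) ε)
      (fun x ω => (v x ω : Rd d → ℂ)) := by
  have hΦ := hP.left
  obtain ⟨K, hK, hKQ, -, hv0⟩ := MemK.exists_compact hQ hv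
  obtain ⟨C, hC0, hC⟩ := hv.exists_bound hQ
  refine ⟨fun ε hε => hv'.trace_mem ε hε, ?_, hv'.mem, fun f hf => ?_⟩
  · obtain ⟨c, hc, hcv⟩ := hΦ.exists_lintegral_le (μ := μ) (Q := Q) hK hC0 one_pos
    refine ⟨c⁻¹, fun ε hε => luxNorm_le_of_lintegral_le hc ?_⟩
    have hr : (ε₁ ε)⁻¹ ≠ 0 := inv_ne_zero (hε₁.pos ε hε).ne'
    have htr := ae_norm_trace_le hv.measurable hε₁ hε₂ T hε
    rw [← ENNReal.ofReal_one]
    refine hcv _ ?_ ?_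
    · filter_upwards [htr, T.ae_shift hr hC] with p h1 h2
      exact h1.trans h2
    · filter_upwards [htr, T.ae_shift hr hv0] with p h1 h2 hp
      have h3 : v p.1 (T.toFun ((ε₁ ε)⁻¹ • p.1) p.2) = 0 := h2 hp
      rw [h3, norm_zero] at h1
      exact norm_le_zero_iff.1 h1
  · obtain ⟨n, φ, ψ, g, hφ, hψ, hg, rfl⟩ := hf
    -- The roles are exchanged: the traces of the test function are the family, bounded for `Ψ`, and
    -- `v` is the function paired with it, measured by `Φ`. Commutativity of the product returns the
    -- desired pairing.
    have H := pairingData_trace_tensor (T := T) hQ hA hε₁ hε₂ hP.symm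
      (fun i => (hφ i).1.continuous) (fun i => (hφ i).2.1) (fun i => (hφ i).2.2)
      (fun i => (hψ i).memLp) hg
    have hfin : ∫⁻ p, ENNReal.ofReal (Φ ‖v p.1 p.2‖) ∂(measQ Q μ) ≠ ∞ := by
      have h1 := hΦ.lintegral_le_of_bounded hK zero_le_one (v := fun p => (‖v p.1 p.2‖ : ℂ)) (C := C)
        (by simpa using hC) (by
          filter_upwards [hv0] with p h1 h2
          simp [h1 h2])
      simp only [one_mul, Complex.norm_real, norm_norm] at h1
      exact ne_top_of_le_ne_top
        (ENNReal.mul_ne_top ENNReal.ofReal_ne_top hK.measure_lt_top.ne) h1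
    have h1 := (IsPairable.of_lp H hK hKQ hv.measurable hv0 hfin (by
      filter_upwards [hv'.mem.mem] with p hp
      exact hp.mx hε₁ hΦ) fun ε hε => (hv'.trace_mem ε hε).1).converges
    unfold PairingConverges at h1 ⊢
    simp only [mul_comm (trace T ε₁ ε₂ (tensor φ ψ g) _ _ _), mul_comm (tensor φ ψ g _ _ _)] at h1
    exact h1

end TraceFamilies

end StochSigma

end

theorem proposition3p4 {d : ℕ} (hd : 1 ≤ d) {Ω : Type*} [MeasurableSpace Ω] (μ : Measure Ω)
    [IsProbabilityMeasure μ] (T : DynSystem d μ) (Q : Set (Rd d)) (hQ : IsOpen Q)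
    (Φ : ℝ → ℝ) (hΦ : IsNFunction Φ) (hΦ2 : DeltaTwo Φ) (hΦ' : DeltaPrime Φ)
    (ε₁ ε₂ : ℝ → ℝ) (hε₁ : IsScale ε₁) (hε₂ : IsScale ε₂)
    (hε : Tendsto (fun ε => ε₂ ε / ε₁ ε) (𝓝[>] 0) (𝓝 0))
    (A : StarSubalgebra ℂ (Rd d →ᵇ ℂ)) (hA : IsHSupralgebra ε₁ A) :
    (∀ (E : Set ℝ), E ⊆ Ioi 0 →
      ∀ (u : ℝ → Rd d → Ω → ℂ) (u₀ : Rd d → Ω → Rd d → ℂ),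
        WeakSigmaConverges Q T ε₁ ε₂ A Φ E u u₀ →
        ∀ f : Rd d → Ω → Lp ℂ ∞ (volume : Measure (Rd d)),
          MemKOrlicz Q μ (conj Φ) ε₁ A f →
          IsAdmissible Q T ε₁ ε₂ A (conj Φ) (fun x ω => (f x ω : Rd d → ℂ)) →
          PairingConverges Q T ε₁ ε₂ E u u₀ (fun x ω => (f x ω : Rd d → ℂ))) ∧
    (∀ v : Rd d → Ω → Lp ℂ ∞ (volume : Measure (Rd d)),
      MemKLinfty Q μ Φ ε₁ A v →
      IsAdmissible Q T ε₁ ε₂ A Φ (fun x ω => (v x ω : Rd d → ℂ)) →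
      WeakSigmaConverges Q T ε₁ ε₂ A Φ (Ioi 0) (fun ε => trace T ε₁ ε₂ (fun x ω => (v x ω : Rd d → ℂ)) ε)
        (fun x ω => (v x ω : Rd d → ℂ))) := by
  have hP := hΦ.isYoungPair hΦ'
  exact ⟨fun E hE u u₀ hu f hf hf' => hu.pairingConverges hQ hε₁ hε₂ hA hP hE hf hf',
    fun v hv hv' => weakSigmaConverges_trace hQ hε₁ hε₂ hA hP hv hv'⟩
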